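/- Let $T>0$, let $n\ge 1$ be an integer, and let $\lambda:[0,T]\to(0,\infty)$ be continuous. Let $F$ be the cumulative distribution function of a nonnegative random variable with a density and finite mean. Jobs arrive on $[0,T]$ according to a nonhomogeneous Poisson process with intensity $\lambda$; the job values are i.i.d. with cdf $F$ and independent of the arrivals. There are $n$ workers. When a job arrives its value is revealed, and it must at once be accepted, its value being gained as a reward, or be rejected for good; each worker can take only one job, so at most $n$ jobs are accepted. Let $r^\star$ be the optimal expected reward, that is, the supremum of the expected total reward over all measurable decision rules in which each decision depends only on the arrival times and values of the jobs that have arrived so far. A family of critical curves $y_1,\dots,y_n:[0,T]\to\mathbb R$ defines a decision rule: while $k$ workers are free, a job arriving at time $t$ is accepted if and only if its value is greater than $y_k(t)$. Let i.i.d. realisations of this job arrival process be given. From the first $M$ of them the algorithm NPSA computes critical curves as follows. Put $\delta_M=T M^{-1/3}$ and $\ell(t)=\lfloor t/\delta_M\rfloor\,\delta_M$, let $C_i(a,b)$ be the number of jobs that arrive in $[a,b)$ in the $i$-th realisation, and let $$\widetilde\lambda^{(M)}(t)=\frac1{M\delta_M}\sum_{i=1}^M C_i\big(\ell(t),\ell(t)+\delta_M\big).$$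 Let $x_1,\dots,x_N$ be all job values observed in the $M$ realisations, $F_N(x)=\frac1N\sum_{i=1}^N \mathbf 1_{x_i\le x}$, and $$\widetilde\phi^{(M)}(y)=\int_y^\infty \big(1-F_N(x)\big)\,dx$$ (with $\widetilde\phi^{(M)}=0$ if $N=0$). The NPSA critical curves $\widetilde y^{(M)}_1,\dots,\widetilde y^{(M)}_n$ are the exact solution on $[0,T]$ (continuous, and differentiable apart from finitely many times) of $$\frac{d\widetilde y_k}{dt}(t)=-\widetilde\lambda^{(M)}(t)\Big(\widetilde\phi^{(M)}(\widetilde y_k(t))-\widetilde\phi^{(M)}(\widetilde y_{k-1}(t))\Big),\qquad \widetilde y_k(T)=0,\qquad 1\le k\le n,$$ where $\widetilde\phi^{(M)}(\widetilde y_0(t))$ is read as $0$. Let the random variable $R^{(M)}$ be the expected total reward, with respect to a fresh job arrival process with the true $\lambda$ and $F$, of the decision rule given by the curves $\widetilde y^{(M)}_1,\dots,\widetilde y^{(M)}_n$. Theorem. A solution $\widetilde y^{(M)}_1,\dots,\widetilde y^{(M)}_n$ as above always exists, and for every $\varepsilon\in(0,1)$, $$\lim_{M\to\infty}\mathbb P\left[\frac{R^{(M)}}{r^\star}\ge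 1-\varepsilon\right]=1.$$ -/

import Mathlib

open MeasureTheory ProbabilityTheory Filter Topology Set
open scoped Finset

noncomputable section

namespace SeqAlloc

/-! ### Realisations of the job arrival process -/

/-- A realisation `(N, t, x)` of the job arrival process: `N` jobs arrive, the `i`-th of them
(`i < N`, counting from `0`) at time `t i` and with value `x i`.
The entries with index `i ≥ N` are never used. -/
abbrev Realisation : Type := ℕ × (ℕ → ℝ) × (ℕ → ℝ)

namespace Realisation

/-- The number of jobs. -/
def num (r : Realisation) : ℕ := r.1

/-- The arrival times. -/
def time (r : Realisation) : ℕ → ℝ := r.2.1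

/-- The job values. -/
def value (r : Realisation) : ℕ → ℝ := r.2.2

open Classical in
/-- The number of jobs whose arrival time lies in `B`. -/
def count (r : Realisation) (B : Set ℝ) : ℕ :=
  #{i ∈ Finset.range r.num | r.time i ∈ B}

/-- Arrival times and values of the jobs `0, …, i`: all that a decision-maker has seen when
job `i` arrives. -/
def history (r : Realisation) (i : ℕ) : Fin (i + 1) → ℝ × ℝ :=
  fun j => (r.time j, r.value j)

end Realisation

/-- `X` is a random realisation of the job arrival process on the horizon `[0, T]`: the jobs arrive
according to a nonhomogeneous Poisson process with intensity `lam`, and their values are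
i.i.d. with law `ν`, independent of the arrivals. -/
structure IsJobProcess {Ω : Type*} [MeasurableSpace Ω] (P : Measure Ω) (T : ℝ) (lam : ℝ → ℝ)
    (ν : Measure ℝ) (X : Ω → Realisation) : Prop where
  measurable : Measurable X
  /-- The jobs arrive in `[0, T]` and are listed in the order of their arrival. -/
  time_mem : ∀ᵐ ω ∂P, ∀ i < (X ω).num, (X ω).time i ∈ Icc 0 T
  time_lt : ∀ᵐ ω ∂P, ∀ i j, i < j → j < (X ω).num → (X ω).time i < (X ω).time j
  /-- The number of arrivals in `B` is Poisson with mean `∫_B lam`. -/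
  count_law : ∀ B : Set ℝ, MeasurableSet B → B ⊆ Icc 0 T →
    P.map (fun ω => (X ω).count B) = poissonMeasure (∫ t in B, lam t).toNNReal
  /-- The numbers of arrivals in disjoint sets are independent. -/
  count_indep : ∀ (k : ℕ) (B : Fin k → Set ℝ), (∀ j, MeasurableSet (B j)) →
    (∀ j, B j ⊆ Icc 0 T) → Pairwise (fun i j => Disjoint (B i) (B j)) →
    iIndepFun (fun j ω => (X ω).count (B j)) P
  value_law : ∀ i, P.map (fun ω => (X ω).value i) = ν
  value_indep : iIndepFun (fun i ω => (X ω).value i) P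
  indep : IndepFun (fun ω => ((X ω).num, (X ω).time)) (fun ω => (X ω).value) P

/-! ### Decision rules and their rewards -/

/-- A rule for accepting jobs: if `k ≥ 1` workers are still free when job `i` arrives, then the job
is accepted exactly when its history lies in `A k i`. The history includes job `i` but no later
job, so that decisions are immediate and do not look into the future. -/
abbrev AcceptRule : Type := ℕ → (i : ℕ) → Set (Fin (i + 1) → ℝ × ℝ)

open Classical in
/-- The number of workers still free when job `i` arrives (each worker takes one job). -/
def workersLeft (n : ℕ) (A : AcceptRule) (r : Realisation) : ℕ → ℕ
  | 0 => n
  | i + 1 =>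
    if r.history i ∈ A (workersLeft n A r i) i then workersLeft n A r i - 1
    else workersLeft n A r i

open Classical in
/-- The total value of the accepted jobs when `n` workers follow the rule `A`. -/
def reward (n : ℕ) (A : AcceptRule) (r : Realisation) : ℝ :=
  ∑ i ∈ Finset.range r.num,
    if 0 < workersLeft n A r i ∧ r.history i ∈ A (workersLeft n A r i) i then r.value i else 0

/-- The expected total reward of `n` workers who follow `A` on the job arrival process `Y`. -/
def expectedReward {Ω : Type*} [MeasurableSpace Ω] (P : Measure Ω) (Y : Ω → Realisation)
    (n : ℕ) (A : AcceptRule) : ℝ :=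
  ∫ ω, reward n A (Y ω) ∂P

/-- The admissible decision rules: the measurable ones. -/
structure DecisionRule where
  accept : AcceptRule
  measurable : ∀ k i, MeasurableSet (accept k i)

/-- The optimal expected reward: the supremum over all admissible decision rules. -/
def optimalReward {Ω : Type*} [MeasurableSpace Ω] (P : Measure Ω) (Y : Ω → Realisation)
    (n : ℕ) : ℝ :=
  ⨆ D : DecisionRule, expectedReward P Y n D.accept

/-- The rule given by critical curves `y 1, …, y n`: while worker `k` is active (that is, while `k`
workers are free), a job that arrives at time `t` is accepted if its value exceeds `y k t`. -/
def curveRule (y : ℕ → ℝ → ℝ) : AcceptRule :=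
  fun k i => {h | y k (h (Fin.last i)).1 < (h (Fin.last i)).2}

/-! ### The algorithm -/

/-- The bin width `T * M ^ (-1/3)`. -/
def binWidth (T : ℝ) (M : ℕ) : ℝ := T * (M : ℝ) ^ (-(1 / 3) : ℝ)

/-- The left end point of the bin that contains `t`. -/
def binStart (T : ℝ) (M : ℕ) (t : ℝ) : ℝ := (⌊t / binWidth T M⌋ : ℝ) * binWidth T M

/-- The piecewise constant intensity estimator from the realisations `0, …, M - 1`. -/
def rateEstimator (T : ℝ) (M : ℕ) (X : ℕ → Realisation) (t : ℝ) : ℝ :=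
  1 / (M * binWidth T M) *
    ∑ m ∈ Finset.range M,
      ((X m).count (Ico (binStart T M t) (binStart T M t + binWidth T M)) : ℝ)

/-- The number of jobs in the first `M` realisations. -/
def sampleSize (M : ℕ) (X : ℕ → Realisation) : ℕ := ∑ m ∈ Finset.range M, (X m).num

/-- The empirical cdf of all job values observed in the first `M` realisations. -/
def empiricalCdf (M : ℕ) (X : ℕ → Realisation) (x : ℝ) : ℝ :=
  1 / (sampleSize M X : ℝ) *
    ∑ m ∈ Finset.range M, ∑ i ∈ Finset.range (X m).num,
      (Iic x).indicator (fun _ => (1 : ℝ)) ((X m).value i)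

/-- The mean shortage estimator, the tail integral of one minus the empirical cdf. (It is `0` if no
job at all has been observed, an event of vanishing probability.) -/
def shortageEstimator (M : ℕ) (X : ℕ → Realisation) (y : ℝ) : ℝ :=
  ∫ x in Ioi y, (1 - empiricalCdf M X x)

/-- `y 1, …, y n` solve on `[0, T]` the system
`y' (k+1) = -lam * (phi (y (k+1)) - phi (y k))`, `y (k+1) T = 0` for `0 ≤ k < n`, where
`phi (y 0)` is read as `0`. Solutions are continuous, and differentiable with the prescribed
derivative apart from a finite set of times, as is appropriate for piecewise constant `lam`. -/
def IsCriticalCurves (T : ℝ) (lam phi : ℝ → ℝ) (n : ℕ) (y : ℕ → ℝ → ℝ) : Prop :=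
  ∀ k < n, ContinuousOn (y (k + 1)) (Icc 0 T) ∧ y (k + 1) T = 0 ∧
    ∃ S : Set ℝ, S.Finite ∧ ∀ t ∈ Ioo 0 T \ S,
      HasDerivAt (y (k + 1))
        (-lam t * (phi (y (k + 1) t) - if k = 0 then 0 else phi (y k t))) t

/-- `y` are the critical curves that the algorithm computes from the first `M` realisations. -/
def IsNPSACurves (T : ℝ) (n M : ℕ) (X : ℕ → Realisation) (y : ℕ → ℝ → ℝ) : Prop :=
  IsCriticalCurves T (rateEstimator T M X) (shortageEstimator M X) n y

end SeqAlloc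

end

noncomputable section

namespace SeqAlloc

/-! ### Differential inequalities with finitely many exceptional times -/

/-! Measure time by the expected number `s` of jobs still to come. The intensity then disappears:
the critical curves are functions `z k` of `s` with `z k' = φ (z k) - φ (z (k-1))`, where `φ` is the
mean shortage function. The sums `V k = z 1 + ... + z k` telescope to `V k' = φ (z k)`, the Bellman
equation for the value of `k` free workers.

Verification. Follow the reward collected so far plus the value of the workers still free. Over a
time `h` its expectation changes by the expected advantages of the decisions minus the decay of the
free workers' value. New arrivals are independent of the past and the value of a job is independent
of what preceded it, so perfect decisions balance the decay up to `O(h²)`. Refining the partition,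
no rule earns more than `V n` at time `0` (`IsJobProcess.expectedReward_le`), and a rule that errs
only on jobs whose value is within `η` of the critical curve loses at most `η Λ`, with `Λ` the
expected number of jobs (`IsJobProcess.le_expectedReward`). Hence the optimum is `V n`, it is
positive, and uniformly close curves earn nearly as much.

Closeness. The intensity estimator need not converge pointwise. The computed curves are compared
with `z` run on the estimated clock, the remaining integral of the estimator; since shortage
functions decrease, discrepancies are damped and the error is linear in the error of the shortage
function (`IsCriticalCurves.abs_sub_le`). The clock is squeezed between empirical counts shifted by
one bin, and the shortage estimator is a ratio of sample means, so strong laws apply; monotonicity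
makes both limits locally uniform (`ae_tendsto_estimators`). Almost surely the curves are therefore
eventually within `η = ε V / Λ`, which suffices. -/

theorem le_of_hasDerivAt_nonneg_off_finite {f f' : ℝ → ℝ} {S : Set ℝ} (hS : S.Finite) :
    ∀ {a b : ℝ}, a ≤ b → ContinuousOn f (Icc a b) →
      (∀ t ∈ Ioo a b \ S, HasDerivAt f (f' t) t) → (∀ t ∈ Ioo a b \ S, 0 ≤ f' t) → f a ≤ f b := by
  -- An exceptional time inside the interval cuts it in two, and the smaller exceptional set serves
  -- both halves.
  induction S, hS using Set.Finite.induction_on with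
  | empty =>
    intro a b hab hc hd h0
    refine (monotoneOn_of_deriv_nonneg (convex_Icc a b) hc ?_ ?_) (left_mem_Icc.2 hab)
      (right_mem_Icc.2 hab) hab
    · intro t ht
      rw [interior_Icc] at ht
      exact (hd t ⟨ht, by simp⟩).differentiableAt.differentiableWithinAt
    · intro t ht
      rw [interior_Icc] at ht
      rw [(hd t ⟨ht, by simp⟩).deriv]
      exact h0 t ⟨ht, by simp⟩
  | @insert c S hc hS ih =>
    intro a b hab hf hd h0
    by_cases hcab : c ∈ Ioo a b
    · have h1 : f a ≤ f c := by
        refine ih hcab.1.le (hf.mono (Icc_subset_Icc_right hcab.2.le)) ?_ ?_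
        · rintro t ⟨ht, htS⟩
          exact hd t ⟨⟨ht.1, ht.2.trans hcab.2⟩, by simp [htS, ht.2.ne]⟩
        · rintro t ⟨ht, htS⟩
          exact h0 t ⟨⟨ht.1, ht.2.trans hcab.2⟩, by simp [htS, ht.2.ne]⟩
      have h2 : f c ≤ f b := by
        refine ih hcab.2.le (hf.mono (Icc_subset_Icc_left hcab.1.le)) ?_ ?_
        · rintro t ⟨ht, htS⟩
          exact hd t ⟨⟨hcab.1.trans ht.1, ht.2⟩, by simp [htS, ht.1.ne']⟩
        · rintro t ⟨ht, htS⟩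
          exact h0 t ⟨⟨hcab.1.trans ht.1, ht.2⟩, by simp [htS, ht.1.ne']⟩
      exact h1.trans h2
    · refine ih hab hf ?_ ?_
      · rintro t ⟨ht, htS⟩
        refine hd t ⟨ht, ?_⟩
        rintro (rfl | h)
        exacts [hcab ht, htS h]
      · rintro t ⟨ht, htS⟩
        refine h0 t ⟨ht, ?_⟩
        rintro (rfl | h)
        exacts [hcab ht, htS h]

/-- A function whose derivative is at least `-C * rate` wherever it is positive, and which ends
at `0`, is at most `C` times the remaining integral `cum` of `rate`. -/
theorem le_mul_of_deriv_ge_of_pos {T C : ℝ} {cum rate e e' : ℝ → ℝ} {S : Set ℝ} (hS : S.Finite)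
    (hC : 0 ≤ C) (hcum : ContinuousOn cum (Icc 0 T)) (hcum0 : ∀ t ∈ Icc 0 T, 0 ≤ cum t)
    (hcumd : ∀ t ∈ Ioo 0 T \ S, HasDerivAt cum (-rate t) t)
    (he : ContinuousOn e (Icc 0 T)) (heT : e T ≤ 0)
    (hed : ∀ t ∈ Ioo 0 T \ S, HasDerivAt e (e' t) t)
    (hpos : ∀ t ∈ Ioo 0 T \ S, 0 < e t → -(C * rate t) ≤ e' t) {t : ℝ} (ht : t ∈ Icc 0 T) :
    e t ≤ C * cum t := by
  rcases le_or_gt (e t) 0 with h | h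
  · exact h.trans (mul_nonneg hC (hcum0 t ht))
  have hsub : Icc t T ⊆ Icc 0 T := Icc_subset_Icc_left ht.1
  -- The least element `u` of `Z` is the first time from `t` on at which `e` is not positive. The
  -- derivative bound is available on all of `(t, u)`, so `e - C * cum` increases there.
  set Z : Set ℝ := Icc t T ∩ e ⁻¹' Iic 0 with hZ
  have hZc : IsCompact Z :=
    isCompact_Icc.of_isClosed_subset
      ((he.mono hsub).preimage_isClosed_of_isClosed isClosed_Icc isClosed_Iic) inter_subset_left
  have hZne : Z.Nonempty := ⟨T, ⟨⟨ht.2, le_rfl⟩, heT⟩⟩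
  obtain ⟨u, huZ, hmin⟩ := hZc.exists_isLeast hZne
  have hu0 : u ∈ Icc 0 T := hsub huZ.1
  have hposu : ∀ s ∈ Ioo t u, 0 < e s := by
    intro s hs
    by_contra hcon
    exact absurd (hmin ⟨⟨hs.1.le, hs.2.le.trans huZ.1.2⟩, not_lt.1 hcon⟩) (not_le.2 hs.2)
  have hin : ∀ s ∈ Ioo t u, s ∈ Ioo 0 T := fun s hs =>
    ⟨ht.1.trans_lt hs.1, hs.2.trans_le huZ.1.2⟩
  have key := le_of_hasDerivAt_nonneg_off_finite (f := fun s => e s - C * cum s)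
    (f' := fun s => e' s - C * -rate s) hS huZ.1.1
    ((he.sub (hcum.const_smul C)).mono (Icc_subset_Icc ht.1 huZ.1.2))
    (fun s hs => (hed s ⟨hin s hs.1, hs.2⟩).sub ((hcumd s ⟨hin s hs.1, hs.2⟩).const_mul C))
    (fun s hs => by
      have := hpos s ⟨hin s hs.1, hs.2⟩ (hposu s hs.1)
      linarith)
  have h1 : e u ≤ 0 := huZ.2
  have h2 := mul_nonneg hC (hcum0 u hu0)
  linarith

/-! ### The system in operational time -/

/-- The critical curves as functions of the expected number of jobs still to come. -/
def IsOperational (phi : ℝ → ℝ) (S : ℝ) (n : ℕ) (z : ℕ → ℝ → ℝ) : Prop :=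
  ∀ k < n, z (k + 1) 0 = 0 ∧ ∀ s ∈ Icc 0 S,
    HasDerivWithinAt (z (k + 1))
      (phi (z (k + 1) s) - if k = 0 then 0 else phi (z k s)) (Icc 0 S) s

/-- The properties shared by mean shortage functions. -/
structure IsShortage (phi : ℝ → ℝ) : Prop where
  nonneg : ∀ y, 0 ≤ phi y
  antitone : Antitone phi
  abs_sub_le : ∀ x y, |phi x - phi y| ≤ |x - y|

theorem IsShortage.continuous {phi : ℝ → ℝ} (h : IsShortage phi) : Continuous phi :=
  (LipschitzWith.of_dist_le_mul (K := 1) fun x y => by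
    simpa [Real.dist_eq] using h.abs_sub_le x y).continuous

/-- `φ` may be unbounded towards `-∞`, so Picard–Lindelöf is applied to the field truncated at `-B`,
which is bounded by `φ (-B) + G` uniformly in `y`. As `φ ≥ 0`, the solution falls at speed at most
`G` and stays above `-S G = -B`, where the truncation has no effect. -/
theorem IsShortage.exists_solution {phi g : ℝ → ℝ} (hphi : IsShortage phi) {S : ℝ} (hS : 0 ≤ S)
    (hg : ContinuousOn g (Icc 0 S)) :
    ∃ z : ℝ → ℝ, z 0 = 0 ∧ ∀ s ∈ Icc 0 S, HasDerivWithinAt z (phi (z s) - g s) (Icc 0 S) s := by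
  obtain ⟨G, hG⟩ := isCompact_Icc.exists_bound_of_continuousOn hg
  have hG0 : 0 ≤ G := (norm_nonneg _).trans (hG 0 ⟨le_rfl, hS⟩)
  set B := S * G
  have hL : 0 ≤ phi (-B) + G := add_nonneg (hphi.nonneg _) hG0
  have hPL : IsPicardLindelof (fun s y => phi (max y (-B)) - g s) (tmin := 0) (tmax := S)
      ⟨0, le_rfl, hS⟩ (0 : ℝ) ⟨(phi (-B) + G) * S, mul_nonneg hL hS⟩ 0 ⟨phi (-B) + G, hL⟩ 1 := by
    refine ⟨fun s _ => ?_, fun y _ => ?_, fun s hs y _ => ?_, ?_⟩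
    · refine (LipschitzWith.of_dist_le_mul fun x y => ?_).lipschitzOnWith
      simp only [Real.dist_eq, sub_sub_sub_cancel_right, NNReal.coe_one, one_mul]
      exact (hphi.abs_sub_le _ _).trans (abs_max_sub_max_le_abs x y (-B))
    · exact continuousOn_const.sub hg
    · have h1 := hG s hs
      have h2 := hphi.nonneg (max y (-B))
      have h3 := hphi.antitone (le_max_right y (-B))
      rw [Real.norm_eq_abs, abs_le] at *
      change -(phi (-B) + G) ≤ _ ∧ _ ≤ phi (-B) + G
      constructor <;> linarith
    · change (phi (-B) + G) * max (S - 0) (0 - 0) ≤ (phi (-B) + G) * S - 0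
      simp [hS]
  obtain ⟨z, hz0, hz⟩ := hPL.exists_eq_forall_mem_Icc_hasDerivWithinAt₀
  refine ⟨z, hz0, fun s hs => ?_⟩
  have hlow : -B ≤ z s := by
    have := le_of_hasDerivAt_nonneg_off_finite (f := fun s => z s + s * G)
      (f' := fun s => phi (max (z s) (-B)) - g s + 1 * G) finite_empty hs.1 ?_ ?_ ?_
    · simp only [hz0, zero_mul, add_zero] at this
      have h2 : s * G ≤ B := mul_le_mul_of_nonneg_right hs.2 hG0
      linarith
    · have hzc : ContinuousOn z (Icc 0 S) := fun s hs => (hz s hs).continuousWithinAt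
      exact (hzc.mono (Icc_subset_Icc_right hs.2)).add (by fun_prop)
    · rintro t ⟨ht, -⟩
      have ht' : t ∈ Ioo 0 S := ⟨ht.1, ht.2.trans_le hs.2⟩
      exact ((hz t (Ioo_subset_Icc_self ht')).hasDerivAt (Icc_mem_nhds ht'.1 ht'.2)).add
        ((hasDerivAt_id t).mul_const G)
    · rintro t ⟨ht, -⟩
      have h1 := hG t ⟨ht.1.le, ht.2.le.trans hs.2⟩
      rw [Real.norm_eq_abs, abs_le] at h1
      have h2 := hphi.nonneg (max (z t) (-B))
      linarith
  have := hz s hs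
  rwa [max_eq_left hlow] at this

/-- The system is triangular: each curve solves a scalar equation forced by the previous one. -/
theorem IsShortage.exists_isOperational {phi : ℝ → ℝ} (hphi : IsShortage phi) {S : ℝ} (hS : 0 ≤ S)
    (n : ℕ) : ∃ z, IsOperational phi S n z := by
  induction n with
  | zero => exact ⟨fun _ _ => 0, fun k hk => absurd hk (Nat.not_lt_zero k)⟩
  | succ n ih =>
    obtain ⟨z, hz⟩ := ih
    have hg : ContinuousOn (fun s => if n = 0 then 0 else phi (z n s)) (Icc 0 S) := by
      rcases n with - | m
      · simpa using continuousOn_const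
      · simp only [Nat.add_eq_zero_iff, one_ne_zero, and_false, if_false]
        exact hphi.continuous.comp_continuousOn
          fun s hs => ((hz m (Nat.lt_succ_self m)).2 s hs).continuousWithinAt
    obtain ⟨w, hw0, hw⟩ := hphi.exists_solution hS hg
    refine ⟨Function.update z (n + 1) w, fun k hk => ?_⟩
    rcases Nat.lt_succ_iff_lt_or_eq.1 hk with h | rfl
    · have h1 : k + 1 ≠ n + 1 := by omega
      have h2 : k ≠ n + 1 := by omega
      simpa [Function.update_of_ne h1, Function.update_of_ne h2] using hz k h
    · have h2 : k ≠ k + 1 := by omega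
      simp only [Function.update_self, Function.update_of_ne h2]
      exact ⟨hw0, hw⟩

/-- A cumulative rate: the integral over the remaining time of a piecewise regular rate. -/
structure IsRemaining (T : ℝ) (rate cum : ℝ → ℝ) : Prop where
  continuousOn : ContinuousOn cum (Icc 0 T)
  nonneg : ∀ t ∈ Icc 0 T, 0 ≤ cum t
  terminal : cum T = 0
  rate_nonneg : ∀ t, t ∈ Ioo 0 T → 0 ≤ rate t
  deriv : ∃ S : Set ℝ, S.Finite ∧ ∀ t ∈ Ioo 0 T \ S, HasDerivAt cum (-rate t) t

theorem IsRemaining.le {T : ℝ} {rate cum : ℝ → ℝ} (h : IsRemaining T rate cum) {t u : ℝ}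
    (ht : 0 ≤ t) (htu : t ≤ u) (hu : u ≤ T) : cum u ≤ cum t := by
  obtain ⟨S, hS, hd⟩ := h.deriv
  have := le_of_hasDerivAt_nonneg_off_finite (f := fun s => -cum s) (f' := fun s => - -rate s) hS
    htu (h.continuousOn.neg.mono (Icc_subset_Icc ht hu))
    (fun s hs => (hd s ⟨⟨ht.trans_lt hs.1.1, hs.1.2.trans_le hu⟩, hs.2⟩).neg)
    (fun s hs => by
      simpa using h.rate_nonneg s ⟨ht.trans_lt hs.1.1, hs.1.2.trans_le hu⟩)
  simpa using this

/-- Chain rule for the change of clock. The rate enters only through `cum`, so jumps of the rate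
merely create exceptional times. -/
theorem IsOperational.hasDerivAt_comp {phi : ℝ → ℝ} {S T : ℝ} {n : ℕ} {z : ℕ → ℝ → ℝ}
    (hz : IsOperational phi S n z) {rate cum : ℝ → ℝ}
    (hmem : ∀ t ∈ Icc 0 T, cum t ∈ Icc 0 S) {k : ℕ} (hk : k < n) {t : ℝ} (ht : t ∈ Ioo 0 T)
    (hd : HasDerivAt cum (-rate t) t) :
    HasDerivAt (fun t => z (k + 1) (cum t))
      (-rate t * (phi (z (k + 1) (cum t)) - if k = 0 then 0 else phi (z k (cum t)))) t := by
  have h1 := (hz k hk).2 (cum t) (hmem t (Ioo_subset_Icc_self ht))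
  have h2 : HasDerivWithinAt (z (k + 1) ∘ cum) _ (Icc 0 T) t :=
    h1.comp t hd.hasDerivWithinAt (fun u hu => hmem u hu)
  have h3 := h2.hasDerivAt (Icc_mem_nhds ht.1 ht.2)
  rw [mul_comm]
  exact h3

theorem IsOperational.continuousOn {phi : ℝ → ℝ} {S : ℝ} {n : ℕ} {z : ℕ → ℝ → ℝ}
    (hz : IsOperational phi S n z) {k : ℕ} (hk : k < n) : ContinuousOn (z (k + 1)) (Icc 0 S) :=
  fun s hs => ((hz k hk).2 s hs).continuousWithinAt

theorem IsOperational.isCriticalCurves {phi : ℝ → ℝ} {S T : ℝ} {n : ℕ} {z : ℕ → ℝ → ℝ}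
    (hz : IsOperational phi S n z) {rate cum : ℝ → ℝ} (hcum : IsRemaining T rate cum)
    (hmem : ∀ t ∈ Icc 0 T, cum t ∈ Icc 0 S) :
    IsCriticalCurves T rate phi n (fun k t => z k (cum t)) := by
  intro k hk
  obtain ⟨E, hE, hd⟩ := hcum.deriv
  refine ⟨(hz.continuousOn hk).comp hcum.continuousOn hmem, ?_, E, hE, fun t ht => ?_⟩
  · simp [hcum.terminal, (hz k hk).1]
  · exact hz.hasDerivAt_comp hmem hk ht.1 (hd t ht)

theorem exists_isCriticalCurves {T : ℝ} (hT : 0 ≤ T) {rate cum phi : ℝ → ℝ}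
    (hcum : IsRemaining T rate cum) (hphi : IsShortage phi) (n : ℕ) :
    ∃ y, IsCriticalCurves T rate phi n y := by
  obtain ⟨z, hz⟩ := hphi.exists_isOperational (hcum.nonneg 0 ⟨le_rfl, hT⟩) n
  exact ⟨_, hz.isCriticalCurves hcum fun t ht =>
    ⟨hcum.nonneg t ht, hcum.le le_rfl ht.1 ht.2⟩⟩

/-- Stability constants. -/
def stabConst (S : ℝ) : ℕ → ℝ
  | 0 => 0
  | k + 1 => (stabConst S k + 2) * S

theorem stabConst_nonneg {S : ℝ} (hS : 0 ≤ S) (k : ℕ) : 0 ≤ stabConst S k := by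
  induction k with
  | zero => exact le_rfl
  | succ k ih => exact mul_nonneg (by linarith) hS

/-- Critical curves for a perturbed rate and shortage function are close to the unperturbed ones,
run at the perturbed operational time. -/
theorem IsCriticalCurves.abs_sub_le {T S D : ℝ} {n : ℕ} {rate cum phi psi : ℝ → ℝ}
    {z y : ℕ → ℝ → ℝ} (hy : IsCriticalCurves T rate psi n y) (hcum : IsRemaining T rate cum)
    (hpsi : IsShortage psi) (hz : IsOperational phi S n z)
    (hmem : ∀ t ∈ Icc 0 T, cum t ∈ Icc 0 S) (hS : 0 ≤ S) (hD : 0 ≤ D)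
    (hclose : ∀ k < n, ∀ s ∈ Icc 0 S, |psi (z (k + 1) s) - phi (z (k + 1) s)| ≤ D) :
    ∀ k < n, ∀ t ∈ Icc 0 T, |y (k + 1) t - z (k + 1) (cum t)| ≤ stabConst S (k + 1) * D := by
  -- The forcing by the previous curve is off by its own error, passed on by the 1-Lipschitz `psi`,
  -- plus one `D`; the current shortage term adds another `D`. Integrating the rate costs a factor
  -- `cum t ≤ S`, whence the recursion for `stabConst`.
  have step : ∀ k < n, (∀ t ∈ Icc 0 T,
      |(if k = 0 then 0 else psi (y k t)) - (if k = 0 then 0 else phi (z k (cum t)))|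
        ≤ (stabConst S k + 1) * D) →
      ∀ t ∈ Icc 0 T, |y (k + 1) t - z (k + 1) (cum t)| ≤ stabConst S (k + 1) * D := by
    intro k hk hprev t ht
    obtain ⟨hyc, hyT, E, hE, hyd⟩ := hy k hk
    obtain ⟨E', hE', hcd⟩ := hcum.deriv
    have hwc : ContinuousOn (fun t => z (k + 1) (cum t)) (Icc 0 T) :=
      (hz.continuousOn hk).comp hcum.continuousOn hmem
    have hwT : z (k + 1) (cum T) = 0 := by rw [hcum.terminal, (hz k hk).1]
    have hC : 0 ≤ (stabConst S k + 2) * D :=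
      mul_nonneg (by linarith [stabConst_nonneg hS k]) hD
    have hwd : ∀ t ∈ Ioo 0 T \ (E ∪ E'), HasDerivAt (fun t => z (k + 1) (cum t))
        (-rate t * (phi (z (k + 1) (cum t)) - if k = 0 then 0 else phi (z k (cum t)))) t :=
      fun t ht => hz.hasDerivAt_comp hmem hk ht.1 (hcd t ⟨ht.1, fun h => ht.2 (Or.inr h)⟩)
    have hyd' : ∀ t ∈ Ioo 0 T \ (E ∪ E'), HasDerivAt (y (k + 1))
        (-rate t * (psi (y (k + 1) t) - if k = 0 then 0 else psi (y k t))) t :=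
      fun t ht => hyd t ⟨ht.1, fun h => ht.2 (Or.inl h)⟩
    have hcd' : ∀ t ∈ Ioo 0 T \ (E ∪ E'), HasDerivAt cum (-rate t) t :=
      fun t ht => hcd t ⟨ht.1, fun h => ht.2 (Or.inr h)⟩
    -- Where the difference is positive, `psi` at `y` is at most `psi` at the reference curve, so
    -- the feedback term has the favourable sign and no Gronwall exponential appears.
    have up := le_mul_of_deriv_ge_of_pos (e := fun t => y (k + 1) t - z (k + 1) (cum t))
      (hE.union hE') hC hcum.continuousOn hcum.nonneg hcd' (hyc.sub hwc) (by simp [hyT, hwT])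
      (fun t ht => (hyd' t ht).sub (hwd t ht)) (fun u hu hpos => by
        have hu' := Ioo_subset_Icc_self hu.1
        have h1 := abs_le.1 (hprev u hu')
        have h2 := abs_le.1 (hclose k hk _ (hmem u hu'))
        have h3 : psi (y (k + 1) u) ≤ psi (z (k + 1) (cum u)) := hpsi.antitone (by linarith)
        have h4 := hcum.rate_nonneg u hu.1
        have h5 : psi (y (k + 1) u) - phi (z (k + 1) (cum u))
            - ((if k = 0 then 0 else psi (y k u)) - (if k = 0 then 0 else phi (z k (cum u))))
            ≤ (stabConst S k + 2) * D := by linarith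
        have h6 := mul_le_mul_of_nonneg_left h5 h4
        linarith) ht
    have low := le_mul_of_deriv_ge_of_pos (e := fun t => z (k + 1) (cum t) - y (k + 1) t)
      (hE.union hE') hC hcum.continuousOn hcum.nonneg hcd' (hwc.sub hyc) (by simp [hyT, hwT])
      (fun t ht => (hwd t ht).sub (hyd' t ht)) (fun u hu hpos => by
        have hu' := Ioo_subset_Icc_self hu.1
        have h1 := abs_le.1 (hprev u hu')
        have h2 := abs_le.1 (hclose k hk _ (hmem u hu'))
        have h3 : psi (z (k + 1) (cum u)) ≤ psi (y (k + 1) u) := hpsi.antitone (by linarith)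
        have h4 := hcum.rate_nonneg u hu.1
        have h5 : -((stabConst S k + 2) * D) ≤ psi (y (k + 1) u) - phi (z (k + 1) (cum u))
            - ((if k = 0 then 0 else psi (y k u)) - (if k = 0 then 0 else phi (z k (cum u)))) := by
          linarith
        have h6 := mul_le_mul_of_nonneg_left h5 h4
        linarith) ht
    have hle : (stabConst S k + 2) * D * cum t ≤ stabConst S (k + 1) * D := by
      have := mul_le_mul_of_nonneg_left (hmem t ht).2 hC
      simp only [stabConst]
      linarith
    rw [abs_le]
    constructor <;> linarith
  intro k
  induction k with
  | zero =>
    intro hk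
    exact step 0 hk fun t _ => by simpa [stabConst] using hD
  | succ k ih =>
    intro hk
    refine step (k + 1) hk fun t ht => ?_
    have h1 := ih (by omega) t ht
    have h2 := hclose k (by omega) _ (hmem t ht)
    have h3 := hpsi.abs_sub_le (y (k + 1) t) (z (k + 1) (cum t))
    simp only [Nat.add_eq_zero_iff, one_ne_zero, and_false, if_false]
    refine (_root_.abs_sub_le _ (psi (z (k + 1) (cum t))) _).trans ?_
    linarith

/-! ### The integrated intensity estimator -/

/-- The fraction of the bin of `a` (bins of width `d`) that lies before `t`. -/
def ramp (d a t : ℝ) : ℝ := max 0 (min 1 (t / d - ⌊a / d⌋))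

theorem ramp_nonneg (d a t : ℝ) : 0 ≤ ramp d a t := le_max_left _ _

theorem ramp_le_one (d a t : ℝ) : ramp d a t ≤ 1 := max_le zero_le_one (min_le_left _ _)

theorem continuous_ramp (d a : ℝ) : Continuous (ramp d a) := by
  unfold ramp
  fun_prop

theorem ramp_mono {d : ℝ} (hd : 0 < d) (a : ℝ) : Monotone (ramp d a) := fun s t hst => by
  unfold ramp
  gcongr

theorem ramp_eq_one {d a t : ℝ} (hd : 0 < d) (h : a < t - d) : ramp d a t = 1 := by
  have h1 : a / d < t / d - 1 := by
    rw [div_lt_iff₀ hd, sub_mul, div_mul_cancel₀ _ hd.ne']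
    linarith
  have h2 := Int.floor_le (a / d)
  unfold ramp
  rw [min_eq_left (by linarith), max_eq_right zero_le_one]

theorem ramp_eq_zero {d a t : ℝ} (hd : 0 < d) (h : t + d ≤ a) : ramp d a t = 0 := by
  have h1 : t / d + 1 ≤ a / d := by
    rw [le_div_iff₀ hd, add_mul, div_mul_cancel₀ _ hd.ne']
    linarith
  have h2 := Int.lt_floor_add_one (a / d)
  unfold ramp
  rw [min_eq_right (by linarith), max_eq_left (by linarith)]

/-- Away from bin edges the bin of `t` is locally constant, and the ramp is near `t` affine,
constantly `1` or constantly `0` as `a` lies in the same, an earlier or a later bin. -/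
theorem hasDerivAt_ramp {d a t : ℝ} (ht : t / d ≠ ⌊t / d⌋) :
    HasDerivAt (ramp d a) (if ⌊a / d⌋ = ⌊t / d⌋ then 1 / d else 0) t := by
  have hlt : (⌊t / d⌋ : ℝ) < t / d := lt_of_le_of_ne (Int.floor_le _) ht.symm
  have hlt' := Int.lt_floor_add_one (t / d)
  have hcont : ContinuousAt (fun u : ℝ => u / d) t := by fun_prop
  split_ifs with h
  · have hlin : HasDerivAt (fun u : ℝ => u / d - ⌊a / d⌋) (1 / d) t :=
      ((hasDerivAt_id t).div_const d).sub_const _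
    refine hlin.congr_of_eventuallyEq ?_
    filter_upwards [hcont.eventually (lt_mem_nhds hlt), hcont.eventually (gt_mem_nhds hlt')]
      with u hu hu'
    unfold ramp
    rw [h, min_eq_right (by linarith), max_eq_right (by linarith)]
  · rcases lt_or_gt_of_ne h with h | h
    · refine (hasDerivAt_const t (1 : ℝ)).congr_of_eventuallyEq ?_
      filter_upwards [hcont.eventually (lt_mem_nhds hlt)] with u hu
      have : (⌊a / d⌋ : ℝ) + 1 ≤ ⌊t / d⌋ := by exact_mod_cast h
      unfold ramp
      rw [min_eq_left (by linarith), max_eq_right zero_le_one]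
    · refine (hasDerivAt_const t (0 : ℝ)).congr_of_eventuallyEq ?_
      filter_upwards [hcont.eventually (gt_mem_nhds hlt')] with u hu
      have : (⌊t / d⌋ : ℝ) + 1 ≤ ⌊a / d⌋ := by exact_mod_cast h
      unfold ramp
      rw [min_eq_right (by linarith), max_eq_left (by linarith)]

/-- The integral of the intensity estimator up to time `t`. -/
def cumEstimator (T : ℝ) (M : ℕ) (X : ℕ → Realisation) (t : ℝ) : ℝ :=
  1 / (M : ℝ) * ∑ m ∈ Finset.range M, ∑ i ∈ Finset.range (X m).num,
    ramp (binWidth T M) ((X m).time i) t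

theorem binWidth_pos {T : ℝ} (hT : 0 < T) {M : ℕ} (hM : 0 < M) : 0 < binWidth T M :=
  mul_pos hT (Real.rpow_pos_of_pos (by exact_mod_cast hM) _)

theorem mem_bin_iff {T : ℝ} (hT : 0 < T) {M : ℕ} (hM : 0 < M) (a t : ℝ) :
    a ∈ Ico (binStart T M t) (binStart T M t + binWidth T M) ↔
      ⌊a / binWidth T M⌋ = ⌊t / binWidth T M⌋ := by
  have hd := binWidth_pos hT hM
  rw [Int.floor_eq_iff, le_div_iff₀ hd, div_lt_iff₀ hd, add_mul, one_mul]
  rfl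

theorem Realisation.count_eq_sum (r : Realisation) (B : Set ℝ) [DecidablePred (· ∈ B)] :
    (r.count B : ℝ) = ∑ i ∈ Finset.range r.num, if r.time i ∈ B then (1 : ℝ) else 0 := by
  classical
  rw [Realisation.count, Finset.card_filter]
  push_cast
  exact Finset.sum_congr rfl fun i _ => by congr

/-- Sorted by jobs instead of bins, the intensity estimator is a sum of ramp slopes. -/
theorem hasDerivAt_cumEstimator {T : ℝ} (hT : 0 < T) {M : ℕ} (hM : 0 < M) (X : ℕ → Realisation)
    {t : ℝ} (ht : t / binWidth T M ≠ ⌊t / binWidth T M⌋) :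
    HasDerivAt (cumEstimator T M X) (rateEstimator T M X t) t := by
  classical
  have key : rateEstimator T M X t = 1 / (M : ℝ) * ∑ m ∈ Finset.range M,
      ∑ i ∈ Finset.range (X m).num,
        if ⌊(X m).time i / binWidth T M⌋ = ⌊t / binWidth T M⌋ then 1 / binWidth T M else 0 := by
    rw [rateEstimator, ← one_div_mul_one_div, mul_assoc, Finset.mul_sum]
    congr 1
    refine Finset.sum_congr rfl fun m _ => ?_
    rw [Realisation.count_eq_sum, Finset.mul_sum]
    refine Finset.sum_congr rfl fun i _ => ?_
    simp only [mem_bin_iff hT hM, mul_ite, mul_one, mul_zero]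
  rw [key]
  exact (HasDerivAt.fun_sum fun m _ => HasDerivAt.fun_sum fun i _ => hasDerivAt_ramp ht).const_mul _

theorem continuous_cumEstimator (T : ℝ) (M : ℕ) (X : ℕ → Realisation) :
    Continuous (cumEstimator T M X) :=
  (continuous_finsetSum _ fun _ _ => continuous_finsetSum _ fun _ _ =>
    continuous_ramp _ _).const_mul _

theorem cumEstimator_mono {T : ℝ} (hT : 0 < T) (M : ℕ) (X : ℕ → Realisation) :
    Monotone (cumEstimator T M X) := by
  rcases Nat.eq_zero_or_pos M with rfl | hM
  · intro s t _
    simp [cumEstimator]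
  · intro s t hst
    exact mul_le_mul_of_nonneg_left (Finset.sum_le_sum fun m _ => Finset.sum_le_sum fun i _ =>
      ramp_mono (binWidth_pos hT hM) _ hst) (by positivity)

/-- The integral of the intensity estimator over the remaining time. -/
def remainingEstimator (T : ℝ) (M : ℕ) (X : ℕ → Realisation) (t : ℝ) : ℝ :=
  cumEstimator T M X T - cumEstimator T M X t

theorem rateEstimator_nonneg {T : ℝ} (hT : 0 < T) (M : ℕ) (X : ℕ → Realisation) (t : ℝ) :
    0 ≤ rateEstimator T M X t := by
  have : 0 ≤ binWidth T M := mul_nonneg hT.le (Real.rpow_nonneg (Nat.cast_nonneg M) _)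
  unfold rateEstimator
  positivity

theorem isRemaining_remainingEstimator {T : ℝ} (hT : 0 < T) (M : ℕ) (X : ℕ → Realisation) :
    IsRemaining T (rateEstimator T M X) (remainingEstimator T M X) where
  continuousOn := (continuous_const.sub (continuous_cumEstimator T M X)).continuousOn
  nonneg t ht := sub_nonneg.2 (cumEstimator_mono hT M X ht.2)
  terminal := sub_self _
  rate_nonneg t _ := rateEstimator_nonneg hT M X t
  deriv := by
    rcases Nat.eq_zero_or_pos M with rfl | hM
    · refine ⟨∅, finite_empty, fun t _ => ?_⟩
      have h1 : remainingEstimator T 0 X = fun _ => 0 := by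
        funext t
        simp [remainingEstimator, cumEstimator]
      rw [h1]
      simpa [rateEstimator] using hasDerivAt_const t (0 : ℝ)
    · have hd := binWidth_pos hT hM
      -- The exceptional times are the bin edges in `[0, T]`.
      refine ⟨(fun j : ℤ => (j : ℝ) * binWidth T M) '' Icc 0 ⌊T / binWidth T M⌋,
        (Set.finite_Icc _ _).image _, fun t ht => ?_⟩
      refine (hasDerivAt_cumEstimator hT hM X fun h => ht.2 ⟨⌊t / binWidth T M⌋, ?_, ?_⟩).const_sub _
      · exact ⟨Int.floor_nonneg.2 (div_nonneg ht.1.1.le hd.le),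
          Int.floor_le_floor (div_le_div_of_nonneg_right ht.1.2.le hd.le)⟩
      · simp only
        rw [← h, div_mul_cancel₀ _ hd.ne']

/-- The average number of jobs that arrive before time `t`. -/
def empiricalCum (M : ℕ) (X : ℕ → Realisation) (t : ℝ) : ℝ :=
  (∑ m ∈ Finset.range M, ((X m).count (Iio t) : ℝ)) / M

/-- A job earlier than `t` by more than a bin width has its whole bin before `t`. With the reverse
bound, the integrated estimator is trapped between counts displaced by one bin, so that only the
vanishing of the bin width matters, not its rate. -/
theorem empiricalCum_le_cumEstimator {T : ℝ} (hT : 0 < T) {M : ℕ} (hM : 0 < M)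
    (X : ℕ → Realisation) (t : ℝ) :
    empiricalCum M X (t - binWidth T M) ≤ cumEstimator T M X t := by
  classical
  rw [empiricalCum, cumEstimator, div_eq_inv_mul, one_div]
  refine mul_le_mul_of_nonneg_left (Finset.sum_le_sum fun m _ => ?_) (by positivity)
  rw [Realisation.count_eq_sum]
  refine Finset.sum_le_sum fun i _ => ?_
  split_ifs with h
  · exact (ramp_eq_one (binWidth_pos hT hM) h).ge
  · exact ramp_nonneg _ _ _

theorem cumEstimator_le_empiricalCum {T : ℝ} (hT : 0 < T) {M : ℕ} (hM : 0 < M)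
    (X : ℕ → Realisation) (t : ℝ) :
    cumEstimator T M X t ≤ empiricalCum M X (t + binWidth T M) := by
  classical
  rw [empiricalCum, cumEstimator, one_div, div_eq_inv_mul]
  refine mul_le_mul_of_nonneg_left (Finset.sum_le_sum fun m _ => ?_) (by positivity)
  rw [Realisation.count_eq_sum]
  refine Finset.sum_le_sum fun i _ => ?_
  split_ifs with h
  · exact ramp_le_one _ _ _
  · exact (ramp_eq_zero (binWidth_pos hT hM) (not_lt.1 h)).le

theorem empiricalCum_mono (M : ℕ) (X : ℕ → Realisation) : Monotone (empiricalCum M X) := by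
  classical
  intro s t hst
  refine div_le_div_of_nonneg_right (Finset.sum_le_sum fun m _ => ?_) (Nat.cast_nonneg M)
  exact_mod_cast Finset.card_le_card fun i hi => by
    simp only [Finset.mem_filter, mem_Iio] at hi ⊢
    exact ⟨hi.1, hi.2.trans_le hst⟩

theorem tendsto_binWidth (T : ℝ) : Tendsto (binWidth T) atTop (𝓝 0) := by
  have h : Tendsto (fun M : ℕ => (M : ℝ) ^ (-(1 / 3) : ℝ)) atTop (𝓝 0) :=
    (tendsto_rpow_neg_atTop (by norm_num)).comp tendsto_natCast_atTop_atTop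
  rw [← mul_zero T]
  exact h.const_mul T

/-! ### The mean shortage estimator -/

/-- The total excess of the job values of `r` over `y`. -/
def Realisation.excess (r : Realisation) (y : ℝ) : ℝ :=
  ∑ i ∈ Finset.range r.num, max (r.value i - y) 0

/-- With an empty sample the empirical cdf is `0` by division by zero, and the integral of `1` over
a half-line takes the default value `0`, which is the stated convention. -/
theorem shortageEstimator_of_sampleSize_eq_zero {M : ℕ} {X : ℕ → Realisation}
    (h : sampleSize M X = 0) (y : ℝ) : shortageEstimator M X y = 0 := by
  simp [shortageEstimator, empiricalCdf, h, Measure.real]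

theorem setIntegral_Ioi_indicator_Iio (y v : ℝ) :
    ∫ x in Ioi y, (Iio v).indicator (fun _ => (1 : ℝ)) x = max (v - y) 0 := by
  rw [integral_indicator measurableSet_Iio, Measure.restrict_restrict measurableSet_Iio]
  simp [Iio_inter_Ioi]

theorem integrableOn_Ioi_indicator_Iio (y v : ℝ) :
    IntegrableOn ((Iio v).indicator (fun _ => (1 : ℝ))) (Ioi y) := by
  rw [IntegrableOn, integrable_indicator_iff measurableSet_Iio, IntegrableOn,
    Measure.restrict_restrict measurableSet_Iio, Iio_inter_Ioi]
  exact integrableOn_const (by simp)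

/-- One minus the empirical cdf averages the indicators of the half-lines below the observed values,
and the tail integral of each indicator is a positive part. The estimator thus becomes a sample
mean, accessible to the strong law. -/
theorem shortageEstimator_of_sampleSize_ne_zero {M : ℕ} {X : ℕ → Realisation}
    (h : sampleSize M X ≠ 0) (y : ℝ) :
    shortageEstimator M X y =
      1 / (sampleSize M X : ℝ) * ∑ m ∈ Finset.range M, (X m).excess y := by
  have hN : (sampleSize M X : ℝ) ≠ 0 := by exact_mod_cast h
  have key : ∀ x, 1 - empiricalCdf M X x = 1 / (sampleSize M X : ℝ) *
      ∑ m ∈ Finset.range M, ∑ i ∈ Finset.range (X m).num,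
        (Iio ((X m).value i)).indicator (fun _ => (1 : ℝ)) x := by
    intro x
    have h1 : ∀ v, (Iio v).indicator (fun _ => (1 : ℝ)) x
        = 1 - (Iic x).indicator (fun _ => (1 : ℝ)) v := by
      intro v
      by_cases hv : v ≤ x
      · simp [indicator, hv, not_lt.2 hv]
      · simp [indicator, hv, not_le.1 hv]
    have h2 : ∑ m ∈ Finset.range M, ∑ i ∈ Finset.range (X m).num, (1 : ℝ) = sampleSize M X := by
      simp [sampleSize]
    simp only [h1, Finset.sum_sub_distrib, mul_sub, h2, empiricalCdf]
    rw [one_div, inv_mul_cancel₀ hN]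
  simp only [shortageEstimator, key]
  rw [integral_const_mul, integral_finsetSum _ fun m _ =>
    integrable_finsetSum _ fun i _ => integrableOn_Ioi_indicator_Iio _ _]
  congr 1
  refine Finset.sum_congr rfl fun m _ => ?_
  rw [integral_finsetSum _ fun i _ => integrableOn_Ioi_indicator_Iio _ _]
  exact Finset.sum_congr rfl fun i _ => setIntegral_Ioi_indicator_Iio _ _

theorem abs_max_sub_zero_sub_le (v x y : ℝ) : |max (v - x) 0 - max (v - y) 0| ≤ |x - y| := by
  refine (abs_max_sub_max_le_abs _ _ _).trans ?_
  rw [sub_sub_sub_cancel_left, abs_sub_comm]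

theorem isShortage_shortageEstimator (M : ℕ) (X : ℕ → Realisation) :
    IsShortage (shortageEstimator M X) := by
  by_cases h : sampleSize M X = 0
  · have : shortageEstimator M X = fun _ => 0 := by
      funext y
      exact shortageEstimator_of_sampleSize_eq_zero h y
    rw [this]
    exact ⟨fun _ => le_rfl, fun _ _ _ => le_rfl, fun x y => by simp⟩
  · have hN : (0 : ℝ) < sampleSize M X := by exact_mod_cast Nat.pos_of_ne_zero h
    refine ⟨fun y => ?_, fun x y hxy => ?_, fun x y => ?_⟩
    · rw [shortageEstimator_of_sampleSize_ne_zero h]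
      exact mul_nonneg (by positivity) (Finset.sum_nonneg fun m _ =>
        Finset.sum_nonneg fun i _ => le_max_right _ _)
    · rw [shortageEstimator_of_sampleSize_ne_zero h, shortageEstimator_of_sampleSize_ne_zero h]
      refine mul_le_mul_of_nonneg_left (Finset.sum_le_sum fun m _ => Finset.sum_le_sum fun i _ =>
        max_le_max_right 0 (by linarith)) (by positivity)
    · rw [shortageEstimator_of_sampleSize_ne_zero h, shortageEstimator_of_sampleSize_ne_zero h,
        ← mul_sub, abs_mul, abs_of_pos (by positivity), one_div, ← div_eq_inv_mul,
        div_le_iff₀ hN, ← Finset.sum_sub_distrib]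
      refine (Finset.abs_sum_le_sum_abs _ _).trans ?_
      have hN' : |x - y| * (sampleSize M X : ℝ) =
          ∑ m ∈ Finset.range M, ∑ i ∈ Finset.range (X m).num, |x - y| := by
        simp [sampleSize, Finset.mul_sum, mul_comm]
      rw [hN']
      refine Finset.sum_le_sum fun m _ => ?_
      rw [Realisation.excess, Realisation.excess, ← Finset.sum_sub_distrib]
      exact (Finset.abs_sum_le_sum_abs _ _).trans
        (Finset.sum_le_sum fun i _ => abs_max_sub_zero_sub_le _ _ _)

theorem exists_isNPSACurves {T : ℝ} (hT : 0 < T) (n M : ℕ) (X : ℕ → Realisation) :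
    ∃ y, IsNPSACurves T n M X y :=
  exists_isCriticalCurves hT.le (isRemaining_remainingEstimator hT M X)
    (isShortage_shortageEstimator M X) n

/-! ### Auxiliary facts of probability -/

/-- The index shift that evaluates the mean of the Poisson law. -/
theorem poissonMeasure_weight_succ (r : NNReal) (n : ℕ) :
    Real.exp (-r) * (r : ℝ) ^ (n + 1) / ((n + 1).factorial : ℝ) * ((n + 1 : ℕ) : ℝ)
      = Real.exp (-r) * (r : ℝ) ^ n / (n.factorial : ℝ) * r := by
  rw [Nat.factorial_succ]
  have : ((n : ℝ) + 1) ≠ 0 := by positivity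
  push_cast
  field_simp
  ring

theorem integrable_natCast_poissonMeasure (r : NNReal) :
    Integrable (fun n : ℕ => (n : ℝ)) (poissonMeasure r) := by
  rw [integrable_poissonMeasure_iff]
  refine (summable_nat_add_iff 1).1 ?_
  refine ((hasSum_one_poissonMeasure r).summable.mul_right (r : ℝ)).congr fun n => ?_
  rw [Real.norm_eq_abs, Nat.abs_cast, poissonMeasure_weight_succ]

theorem integral_natCast_poissonMeasure (r : NNReal) :
    ∫ n, (n : ℝ) ∂(poissonMeasure r) = r := by
  have h0 := hasSum_integral_poissonMeasure (integrable_natCast_poissonMeasure r)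
  rw [← h0.tsum_eq, h0.summable.tsum_eq_zero_add]
  simp only [smul_eq_mul, poissonMeasure_weight_succ, Nat.cast_zero, mul_zero, zero_add]
  rw [tsum_mul_right, (hasSum_one_poissonMeasure r).tsum_eq, one_mul]

theorem integral_infinitePi_eval {ν : Measure ℝ} [IsProbabilityMeasure ν] {g : ℝ → ℝ}
    (hg : Measurable g) (i : ℕ) :
    ∫ v : ℕ → ℝ, g (v i) ∂(Measure.infinitePi fun _ => ν) = ∫ x, g x ∂ν := by
  have h := measurePreserving_eval_infinitePi (fun _ : ℕ => ν) i
  conv_rhs => rw [← h.map_eq]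
  rw [integral_map h.measurable.aemeasurable hg.aestronglyMeasurable]

/-- The two hypotheses make the joint law a triple product, which is then reassociated. -/
theorem indepFun_prodMk_right {Ω α β γ : Type*} [MeasurableSpace Ω]
    [MeasurableSpace α] [MeasurableSpace β] [MeasurableSpace γ] {P : Measure Ω}
    [IsProbabilityMeasure P] {f : Ω → α} {g : Ω → β} {h : Ω → γ} (hf : Measurable f)
    (hg : Measurable g) (hh : Measurable h) (h1 : IndepFun (fun ω => (f ω, g ω)) h P)
    (h2 : IndepFun f g P) : IndepFun f (fun ω => (g ω, h ω)) P := by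
  have := Measure.isProbabilityMeasure_map (μ := P) hf.aemeasurable
  have := Measure.isProbabilityMeasure_map (μ := P) hg.aemeasurable
  have := Measure.isProbabilityMeasure_map (μ := P) hh.aemeasurable
  have h3 : IndepFun g h P := h1.comp measurable_snd measurable_id
  rw [indepFun_iff_map_prod_eq_prod_map_map (by fun_prop) (by fun_prop)] at h1 h2 h3 ⊢
  rw [h3, ← Measure.prodAssoc_prod, ← h2, ← h1, Measure.map_map (by fun_prop) (by fun_prop)]
  rfl

/-! ### Measurability -/

namespace Realisation

theorem measurable_num : Measurable num := measurable_fst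

theorem measurable_time (i : ℕ) : Measurable fun r : Realisation => r.time i :=
  (measurable_pi_apply i).comp (measurable_fst.comp measurable_snd)

theorem measurable_value (i : ℕ) : Measurable fun r : Realisation => r.value i :=
  (measurable_pi_apply i).comp (measurable_snd.comp measurable_snd)

theorem measurable_history (i : ℕ) : Measurable fun r : Realisation => r.history i :=
  measurable_pi_lambda _ fun _ => (measurable_time _).prodMk (measurable_value _)

/-- Functions that depend measurably on `r` and on a measurable index are measurable. -/
theorem measurable_index {β : Type*} [MeasurableSpace β] {f : ℕ → Realisation → β}
    {k : Realisation → ℕ} (hf : ∀ i, Measurable (f i)) (hk : Measurable k) :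
    Measurable fun r => f (k r) r :=
  (measurable_from_prod_countable_right (f := fun p : ℕ × Realisation => f p.1 p.2) hf).comp
    (hk.prodMk measurable_id)

theorem measurable_count {B : Set ℝ} (hB : MeasurableSet B) :
    Measurable fun r : Realisation => r.count B := by
  classical
  have : (fun r : Realisation => r.count B) =
      fun r => ∑ i ∈ Finset.range r.num, B.indicator (fun _ => 1) (r.time i) := by
    funext r
    simp only [count, Finset.card_filter, indicator]
  rw [this]
  refine measurable_index (f := fun k (r : Realisation) =>
    ∑ i ∈ Finset.range k, B.indicator (fun _ => 1) (r.time i)) (fun k => ?_) measurable_num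
  exact Finset.measurable_sum _ fun i _ =>
    (measurable_const.indicator hB).comp (measurable_time i)

theorem measurable_sum_num {f : ℕ → Realisation → ℝ} (hf : ∀ i, Measurable (f i))
    {k : Realisation → ℕ} (hk : Measurable k) :
    Measurable fun r : Realisation => ∑ i ∈ Finset.range (k r), f i r :=
  measurable_index (f := fun k (r : Realisation) => ∑ i ∈ Finset.range k, f i r)
    (fun _ => Finset.measurable_sum _ fun i _ => hf i) hk

/-- The jobs arrive in `[0, T)`, at increasing times. -/
structure Good (T : ℝ) (r : Realisation) : Prop where
  time_mem : ∀ i < r.num, r.time i ∈ Ico 0 T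
  time_lt : ∀ i j, i < j → j < r.num → r.time i < r.time j

theorem measurableSet_good (T : ℝ) : MeasurableSet {r : Realisation | r.Good T} := by
  have : {r : Realisation | r.Good T} =
      {r | ∀ i, i < r.num → r.time i ∈ Ico 0 T} ∩
      {r | ∀ i j, i < j → j < r.num → r.time i < r.time j} := by
    ext r
    exact ⟨fun h => ⟨h.1, h.2⟩, fun h => ⟨h.1, h.2⟩⟩
  rw [this]
  have hlt : ∀ i, MeasurableSet {r : Realisation | i < r.num} := fun i =>
    measurable_num (MeasurableSet.of_discrete (s := {k | i < k}))
  refine MeasurableSet.inter ?_ ?_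
  · simp only [ofPred_forall]
    refine MeasurableSet.iInter fun i => ?_
    exact MeasurableSet.imp (hlt i) (measurable_time i measurableSet_Ico)
  · simp only [ofPred_forall]
    refine MeasurableSet.iInter fun i => MeasurableSet.iInter fun j => MeasurableSet.iInter fun _ =>
      MeasurableSet.imp (hlt j) (measurableSet_lt (measurable_time i) (measurable_time j))

theorem count_le_num (r : Realisation) (B : Set ℝ) : r.count B ≤ r.num := by
  classical
  rw [count]
  exact (Finset.card_filter_le _ _).trans (Finset.card_range _).le

theorem Good.lt_count_iff {T : ℝ} {r : Realisation} (h : r.Good T) (s : ℝ) (i : ℕ) :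
    i < r.count (Iio s) ↔ i < r.num ∧ r.time i < s := by
  classical
  set F := {i ∈ Finset.range r.num | r.time i ∈ Iio s} with hF
  have hc : r.count (Iio s) = #F := by
    rw [Realisation.count]
    congr!
  have hmem : ∀ j, j ∈ F ↔ j < r.num ∧ r.time j < s := by simp [hF]
  rw [hc, ← hmem]
  constructor
  · intro hi
    by_contra hn
    have hsub : F ⊆ Finset.range i := by
      intro j hj
      rw [Finset.mem_range]
      by_contra hij
      rcases (not_lt.1 hij).eq_or_lt with rfl | hlt
      · exact hn hj
      · have hj' := (hmem j).1 hj
        exact hn ((hmem i).2 ⟨hlt.trans hj'.1, (h.time_lt i j hlt hj'.1).trans hj'.2⟩)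
    have := Finset.card_le_card hsub
    rw [Finset.card_range] at this
    omega
  · intro hi
    have hi' := (hmem i).1 hi
    have hsub : Finset.range (i + 1) ⊆ F := by
      intro j hj
      rcases (Nat.lt_succ_iff.1 (Finset.mem_range.1 hj)).eq_or_lt with rfl | hlt
      · exact hi
      · exact (hmem j).2 ⟨hlt.trans hi'.1, (h.time_lt j i hlt hi'.1).trans hi'.2⟩
    have := Finset.card_le_card hsub
    rw [Finset.card_range] at this
    omega

theorem count_union (r : Realisation) {B C : Set ℝ} (h : Disjoint B C) :
    r.count (B ∪ C) = r.count B + r.count C := by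
  classical
  simp only [count, mem_union, Finset.filter_or]
  refine Finset.card_union_of_disjoint (Finset.disjoint_filter.2 fun i _ hB hC => ?_)
  exact Set.disjoint_left.1 h hB hC

theorem count_Iio_add (r : Realisation) {s s' : ℝ} (h : s ≤ s') :
    r.count (Iio s) + r.count (Ico s s') = r.count (Iio s') := by
  rw [← count_union, Iio_union_Ico_eq_Iio h]
  exact Set.disjoint_left.2 fun x hx hx' => absurd hx (not_lt.2 hx'.1)

theorem count_congr (r : Realisation) {B C : Set ℝ}
    (h : ∀ i < r.num, r.time i ∈ B ↔ r.time i ∈ C) : r.count B = r.count C := by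
  classical
  unfold count
  congr 1
  exact Finset.filter_congr fun i hi => h i (Finset.mem_range.1 hi)

theorem count_eq_num (r : Realisation) {B : Set ℝ} (h : ∀ i < r.num, r.time i ∈ B) :
    r.count B = r.num := by
  classical
  rw [count, Finset.filter_true_of_mem fun i hi => h i (Finset.mem_range.1 hi), Finset.card_range]

end Realisation

/-! ### The job arrival process -/

section Arrivals

variable {Ω : Type*} [MeasurableSpace Ω] {P : Measure Ω} {T : ℝ} {lam : ℝ → ℝ} {ν : Measure ℝ}
  {X : Ω → Realisation}

theorem IsJobProcess.measurable_count (h : IsJobProcess P T lam ν X) {B : Set ℝ}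
    (hB : MeasurableSet B) : Measurable fun ω => (X ω).count B :=
  (Realisation.measurable_count hB).comp h.measurable

theorem IsJobProcess.integrable_count (h : IsJobProcess P T lam ν X) {B : Set ℝ}
    (hB : MeasurableSet B) (hBT : B ⊆ Icc 0 T) :
    Integrable (fun ω => ((X ω).count B : ℝ)) P := by
  have := integrable_natCast_poissonMeasure (∫ t in B, lam t).toNNReal
  rw [← h.count_law B hB hBT] at this
  exact this.comp_measurable (h.measurable_count hB)

theorem IsJobProcess.integral_count (h : IsJobProcess P T lam ν X) {B : Set ℝ}
    (hB : MeasurableSet B) (hBT : B ⊆ Icc 0 T) (hlam : ∀ t ∈ Icc 0 T, 0 < lam t) :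
    ∫ ω, ((X ω).count B : ℝ) ∂P = ∫ t in B, lam t := by
  have := integral_natCast_poissonMeasure (∫ t in B, lam t).toNNReal
  rw [← h.count_law B hB hBT, integral_map (h.measurable_count hB).aemeasurable
    (by fun_prop), Real.coe_toNNReal _ (setIntegral_nonneg hB fun t ht => (hlam t (hBT ht)).le)]
    at this
  exact this

theorem IsJobProcess.measureReal_count_eq_zero (h : IsJobProcess P T lam ν X) {B : Set ℝ}
    (hB : MeasurableSet B) (hBT : B ⊆ Icc 0 T) (hlam : ∀ t ∈ Icc 0 T, 0 < lam t) :
    P.real {ω | (X ω).count B = 0} = Real.exp (-∫ t in B, lam t) := by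
  have := poissonMeasure_real_singleton (∫ t in B, lam t).toNNReal 0
  rw [← h.count_law B hB hBT, map_measureReal_apply (h.measurable_count hB) (by simp),
    Real.coe_toNNReal _ (setIntegral_nonneg hB fun t ht => (hlam t (hBT ht)).le)] at this
  simpa [preimage] using this

/-- The count at the single time `T` is Poisson with mean `0`. Excluding an arrival at `T` lets the
jobs before `T` be all the jobs. -/
theorem IsJobProcess.ae_good [IsProbabilityMeasure P] (hT : 0 ≤ T) (h : IsJobProcess P T lam ν X) :
    ∀ᵐ ω ∂P, (X ω).Good T := by
  classical
  have h0 : ∀ᵐ ω ∂P, (X ω).count {T} = 0 := by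
    have h1 := h.count_law {T} (measurableSet_singleton T) (by simpa using hT)
    have h2 : ∫ t in {T}, lam t = 0 := by simp
    rw [h2, Real.toNNReal_zero] at h1
    have h3 : (P.map fun ω => (X ω).count {T}) {0} = 1 := by
      rw [h1, poissonMeasure_singleton]
      simp
    rw [Measure.map_apply (h.measurable_count (measurableSet_singleton T)) (by simp)] at h3
    exact (mem_ae_iff_prob_eq_one
      (h.measurable_count (measurableSet_singleton T) (measurableSet_singleton 0))).2 h3
  filter_upwards [h0, h.time_mem, h.time_lt] with ω h1 h2 h3
  refine ⟨fun i hi => ⟨(h2 i hi).1, lt_of_le_of_ne (h2 i hi).2 fun heq => ?_⟩, h3⟩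
  rw [Realisation.count, Finset.card_eq_zero, Finset.filter_eq_empty_iff] at h1
  exact h1 (Finset.mem_range.2 hi) heq

/-- Every job process has a version all of whose realisations are good. -/
theorem IsJobProcess.exists_good_version [IsProbabilityMeasure P] (hT : 0 ≤ T)
    (h : IsJobProcess P T lam ν X) :
    ∃ X' : Ω → Realisation, IsJobProcess P T lam ν X' ∧ X =ᵐ[P] X' ∧ ∀ ω, (X' ω).Good T := by
  classical
  -- Bad realisations lose their jobs but keep their values, so the laws of the values are literally
  -- untouched.
  set g : Realisation → Realisation := fun r => if r.Good T then r else (0, r.time, r.value)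
    with hg
  have hgm : Measurable g := by
    refine Measurable.ite (Realisation.measurableSet_good T) measurable_id ?_
    exact measurable_const.prodMk measurable_snd
  have hgood : ∀ r, (g r).Good T := by
    intro r
    simp only [hg]
    split_ifs with hr
    · exact hr
    · exact ⟨fun i hi => absurd hi (Nat.not_lt_zero i), fun i j _ hj => absurd hj (Nat.not_lt_zero j)⟩
  have hval : ∀ r, (g r).value = r.value := by
    intro r
    simp only [hg]
    split_ifs <;> rfl
  have hae : X =ᵐ[P] fun ω => g (X ω) := by
    filter_upwards [h.ae_good hT] with ω hω
    simp only [hg, if_pos hω]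
  refine ⟨fun ω => g (X ω), ⟨hgm.comp h.measurable, ?_, ?_, ?_, ?_, ?_, ?_, ?_⟩, hae,
    fun ω => hgood _⟩
  · exact .of_forall fun ω i hi => Ico_subset_Icc_self ((hgood _).time_mem i hi)
  · exact .of_forall fun ω => (hgood _).time_lt
  · intro B hB hBT
    rw [← h.count_law B hB hBT]
    refine Measure.map_congr ?_
    filter_upwards [hae] with ω hω
    rw [← hω]
  · intro k B hB hBT hd
    refine (iIndepFun_congr fun j => ?_).1 (h.count_indep k B hB hBT hd)
    filter_upwards [hae] with ω hω
    rw [← hω]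
  · simpa only [hval] using h.value_law
  · simpa only [hval] using h.value_indep
  · refine h.indep.congr ?_ ?_
    · filter_upwards [hae] with ω hω
      rw [← hω]
    · filter_upwards [hae] with ω hω
      rw [← hω]

theorem IsJobProcess.ae_num_eq [IsProbabilityMeasure P] (h : IsJobProcess P T lam ν X) :
    (fun ω => (X ω).num) =ᵐ[P] fun ω => (X ω).count (Icc 0 T) := by
  filter_upwards [h.time_mem] with ω hω
  rw [Realisation.count_eq_num _ hω]

theorem IsJobProcess.map_num [IsProbabilityMeasure P] (h : IsJobProcess P T lam ν X) :
    P.map (fun ω => (X ω).num) = poissonMeasure (∫ t in Icc 0 T, lam t).toNNReal := by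
  rw [Measure.map_congr h.ae_num_eq, h.count_law _ measurableSet_Icc le_rfl]

theorem IsJobProcess.measurable_value (h : IsJobProcess P T lam ν X) (i : ℕ) :
    Measurable fun ω => (X ω).value i :=
  (Realisation.measurable_value i).comp h.measurable

theorem IsJobProcess.map_num_value [IsProbabilityMeasure P] [IsProbabilityMeasure ν]
    (h : IsJobProcess P T lam ν X) :
    P.map (fun ω => ((X ω).num, (X ω).value)) =
      (poissonMeasure (∫ t in Icc 0 T, lam t).toNNReal).prod (Measure.infinitePi fun _ => ν) := by
  have hnum : Measurable fun ω => (X ω).num := Realisation.measurable_num.comp h.measurable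
  have hval : Measurable fun ω => (X ω).value := measurable_pi_lambda _ h.measurable_value
  have h1 : IndepFun (fun ω => (X ω).num) (fun ω => (X ω).value) P :=
    h.indep.comp measurable_fst measurable_id
  rw [(indepFun_iff_map_prod_eq_prod_map_map hnum.aemeasurable hval.aemeasurable).1 h1, h.map_num]
  congr 1
  have := h.value_indep.map_fun_eq_infinitePi_map h.measurable_value
  simp only [h.value_law] at this
  exact this

/-- Given `k` jobs the absolute sum has mean at most `k` times that of `|g|`, and the Poisson mean
is finite. -/
theorem integrable_sum_poissonMeasure_prod [IsProbabilityMeasure ν] (r : NNReal) {g : ℝ → ℝ}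
    (hgm : Measurable g) (hg : Integrable g ν) :
    Integrable (fun p : ℕ × (ℕ → ℝ) => ∑ i ∈ Finset.range p.1, g (p.2 i))
      ((poissonMeasure r).prod (Measure.infinitePi fun _ => ν)) := by
  have hi : ∀ i : ℕ, Integrable (fun v : ℕ → ℝ => g (v i)) (Measure.infinitePi fun _ => ν) :=
    fun i => (measurePreserving_eval_infinitePi (fun _ => ν) i).integrable_comp_of_integrable hg
  have hv : ∀ i : ℕ, ∫ v : ℕ → ℝ, ‖g (v i)‖ ∂(Measure.infinitePi fun _ => ν) = ∫ x, ‖g x‖ ∂ν :=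
    integral_infinitePi_eval hgm.norm
  have hm : Measurable fun p : ℕ × (ℕ → ℝ) => ∑ i ∈ Finset.range p.1, g (p.2 i) :=
    measurable_from_prod_countable_right fun n =>
      Finset.measurable_sum (Finset.range n) fun i _ => hgm.comp (measurable_pi_apply i)
  rw [integrable_prod_iff hm.aestronglyMeasurable]
  refine ⟨.of_forall fun n => integrable_finsetSum (Finset.range n) fun i _ => hi i, ?_⟩
  refine ((integrable_natCast_poissonMeasure r).mul_const (∫ x, ‖g x‖ ∂ν)).mono'
    Measurable.of_discrete.aestronglyMeasurable (.of_forall fun n => ?_)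
  rw [Real.norm_of_nonneg (integral_nonneg fun _ => norm_nonneg _)]
  refine (integral_mono (integrable_finsetSum (Finset.range n) fun i _ => hi i).norm
    (integrable_finsetSum (Finset.range n) fun i _ => (hi i).norm) fun v => norm_sum_le _ _).trans ?_
  rw [integral_finsetSum _ fun i _ => (hi i).norm]
  rw [Finset.sum_congr rfl fun i _ => hv i]
  simp

/-- Wald's identity. -/
theorem IsJobProcess.wald [IsProbabilityMeasure P] [IsProbabilityMeasure ν]
    (h : IsJobProcess P T lam ν X) (hlam : ∀ t ∈ Icc 0 T, 0 < lam t) {g : ℝ → ℝ}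
    (hgm : Measurable g) (hg : Integrable g ν) :
    Integrable (fun ω => ∑ i ∈ Finset.range (X ω).num, g ((X ω).value i)) P ∧
      ∫ ω, ∑ i ∈ Finset.range (X ω).num, g ((X ω).value i) ∂P
        = (∫ t in Icc 0 T, lam t) * ∫ x, g x ∂ν := by
  have hI := integrable_sum_poissonMeasure_prod (∫ t in Icc 0 T, lam t).toNNReal hgm hg
  have hmm : Measurable fun ω => ((X ω).num, (X ω).value) :=
    (Realisation.measurable_num.comp h.measurable).prodMk
      (measurable_pi_lambda _ h.measurable_value)
  have hi : ∀ i : ℕ, Integrable (fun v : ℕ → ℝ => g (v i)) (Measure.infinitePi fun _ => ν) :=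
    fun i => (measurePreserving_eval_infinitePi (fun _ => ν) i).integrable_comp_of_integrable hg
  have hv : ∀ i : ℕ, ∫ v : ℕ → ℝ, g (v i) ∂(Measure.infinitePi fun _ => ν) = ∫ x, g x ∂ν :=
    integral_infinitePi_eval hgm
  refine ⟨?_, ?_⟩
  · have hI' := hI
    rw [← h.map_num_value] at hI'
    exact hI'.comp_measurable hmm
  · have h1 : ∫ ω, ∑ i ∈ Finset.range (X ω).num, g ((X ω).value i) ∂P
        = ∫ p : ℕ × (ℕ → ℝ), ∑ i ∈ Finset.range p.1, g (p.2 i)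
          ∂(P.map fun ω => ((X ω).num, (X ω).value)) := by
      rw [integral_map hmm.aemeasurable (by rw [h.map_num_value]; exact hI.aestronglyMeasurable)]
    rw [h1, h.map_num_value, integral_prod _ hI]
    simp only [integral_finsetSum _ fun i _ => hi i, hv, Finset.sum_const, Finset.card_range,
      nsmul_eq_mul]
    rw [integral_mul_const, integral_natCast_poissonMeasure, Real.coe_toNNReal]
    exact setIntegral_nonneg measurableSet_Icc fun t ht => (hlam t ht).le

end Arrivals

/-! ### Dependence of the number of free workers on the past -/

section Workers

variable {n : ℕ} {A : AcceptRule}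

theorem workersLeft_le (r : Realisation) (i : ℕ) : workersLeft n A r i ≤ n := by
  induction i with
  | zero => exact le_rfl
  | succ i ih =>
    rw [workersLeft]
    split_ifs <;> omega

theorem workersLeft_congr {r r' : Realisation} (i : ℕ)
    (h : ∀ j < i, r.time j = r'.time j ∧ r.value j = r'.value j) :
    workersLeft n A r i = workersLeft n A r' i := by
  induction i with
  | zero => rfl
  | succ i ih =>
    have hh : r.history i = r'.history i := by
      funext j
      have := h j j.2
      simp only [Realisation.history, this.1, this.2]
    rw [workersLeft, workersLeft, ih fun j hj => h j (hj.trans (Nat.lt_succ_self i)), hh]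

theorem measurable_workersLeft (hA : ∀ k i, MeasurableSet (A k i)) (i : ℕ) :
    Measurable fun r => workersLeft n A r i := by
  classical
  induction i with
  | zero => exact measurable_const
  | succ i ih =>
    refine Realisation.measurable_index
      (f := fun k (r : Realisation) => if r.history i ∈ A k i then k - 1 else k) (fun k => ?_) ih
    exact Measurable.ite (Realisation.measurable_history i (hA k i)) measurable_const
      measurable_const

end Workers

/-! ### The arrivals before a given time. -/

namespace Realisation

/-- The number and the times of the arrivals before `s`. -/
def past (s : ℝ) (r : Realisation) : ℕ × (ℕ → ℝ) :=
  -- The filler `s` hides the later arrival times; it is never below a `u ≤ s`, so it does not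
  -- disturb the events `time i < u`.
  (r.count (Iio s), fun i => if i < r.count (Iio s) then r.time i else s)

theorem measurable_past (s : ℝ) : Measurable (past s) := by
  have hc : Measurable fun r : Realisation => r.count (Iio s) := measurable_count measurableSet_Iio
  refine hc.prodMk (measurable_pi_lambda _ fun i => ?_)
  exact Measurable.ite (hc (MeasurableSet.of_discrete (s := {k | i < k}))) (measurable_time i)
    measurable_const

theorem workersLeft_eq_past (n : ℕ) (A : AcceptRule) (s : ℝ) (r : Realisation) :
    workersLeft n A r (r.count (Iio s)) =
      workersLeft n A ((r.past s).1, (r.past s).2, r.value) (r.past s).1 := by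
  refine workersLeft_congr _ fun j hj => ⟨?_, rfl⟩
  change r.time j = if j < r.count (Iio s) then r.time j else s
  rw [if_pos hj]

/-- The times in `I` cut `[0, s)` into atoms, indexed by the set `J` of those times that lie after
the atom. The atoms with `u ∈ J` make up `[0, u)`, and a good realisation has no job before `0`. -/
theorem Good.sum_count_atoms {T : ℝ} {r : Realisation} (h : r.Good T) {s : ℝ}
    (I : Finset (Iic s)) (u : I) :
    ∑ J ∈ Finset.univ.filter (fun J : Finset I => u ∈ J),
      r.count {t | t ∈ Ico 0 s ∧ ∀ v : I, v ∈ J ↔ t < v} = r.count (Iio (u : ℝ)) := by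
  classical
  simp only [count, Finset.card_filter]
  rw [Finset.sum_comm]
  refine Finset.sum_congr rfl fun i hi => ?_
  have h0 := (h.time_mem i (Finset.mem_range.1 hi)).1
  set t := r.time i
  have hu : (u : ℝ) ≤ s := u.1.2
  by_cases ht : t < u
  · have hmem : (Finset.univ.filter fun v : I => t < v) ∈
        Finset.univ.filter (fun J : Finset I => u ∈ J) := by simpa using ht
    rw [Finset.sum_eq_single_of_mem _ hmem]
    · have : t ∈ {t | t ∈ Ico 0 s ∧ ∀ v : I, v ∈ (Finset.univ.filter fun v : I => r.time i < v) ↔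
          t < v} := ⟨⟨h0, ht.trans_le hu⟩, by simp [t]⟩
      rw [if_pos this, if_pos (mem_Iio.2 ht)]
    · intro J _ hJ
      refine if_neg fun hmem => hJ ?_
      ext v
      simpa using hmem.2 v
  · rw [if_neg (by simpa using ht)]
    refine Finset.sum_eq_zero fun J hJ => if_neg fun hmem => ht ?_
    exact (hmem.2 u).1 (Finset.mem_filter.1 hJ).2

end Realisation

/-! ### Independence of arrivals and values from the past. -/

section Arrivals

variable {Ω : Type*} [MeasurableSpace Ω] {P : Measure Ω} [IsProbabilityMeasure P] {T : ℝ}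
  {lam : ℝ → ℝ} {ν : Measure ℝ} {X : Ω → Realisation}

/-- The sets `Iio u` overlap, so the axiom on disjoint sets is not directly applicable. It suffices
to treat finitely many `u`; their counts are sums of counts of disjoint atoms, all disjoint from
`[s, s')`. The index `none` stands for `[s, s')`. -/
theorem IsJobProcess.indepFun_count_counts (h : IsJobProcess P T lam ν X)
    (hgood : ∀ ω, (X ω).Good T) {s s' : ℝ} (hs : 0 ≤ s) (hss' : s ≤ s') (hs' : s' ≤ T) :
    IndepFun (fun ω => (X ω).count (Ico s s')) (fun ω (u : Iic s) => (X ω).count (Iio (u : ℝ)))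
      P := by
  classical
  refine IndepFun.indepFun_process (h.measurable_count measurableSet_Ico)
    (fun u => h.measurable_count measurableSet_Iio) fun I => ?_
  set B : Option (Finset I) → Set ℝ := fun J => J.elim (Ico s s') fun J =>
    {t | t ∈ Ico 0 s ∧ ∀ v : I, v ∈ J ↔ t < v} with hB
  have hBm : ∀ J, MeasurableSet (B J) := by
    rintro (- | J)
    · exact measurableSet_Ico
    · have : B (some J) = Ico 0 s ∩ ⋂ v : I, {t | v ∈ J ↔ t < v} := by
        ext t
        simp [hB]
      rw [this]
      refine measurableSet_Ico.inter (MeasurableSet.iInter fun v => ?_)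
      by_cases hv : v ∈ J
      · simp only [hv, true_iff]
        exact measurableSet_Iio
      · simp only [hv, false_iff, not_lt]
        exact measurableSet_Ici
  have hBT : ∀ J, B J ⊆ Icc 0 T := by
    rintro (- | J)
    · exact fun t ht => ⟨hs.trans ht.1, ht.2.le.trans hs'⟩
    · exact fun t ht => ⟨ht.1.1, ht.1.2.le.trans (hss'.trans hs')⟩
  have hBd : Pairwise fun J J' => Disjoint (B J) (B J') := by
    intro J J' hJ
    refine Set.disjoint_left.2 fun t ht ht' => hJ ?_
    rcases J with - | J <;> rcases J' with - | J'
    · rfl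
    · exact absurd ht'.1.2 (not_lt.2 ht.1)
    · exact absurd ht.1.2 (not_lt.2 ht'.1)
    · congr 1
      ext v
      rw [ht.2 v, ht'.2 v]
  have hind : iIndepFun (fun J ω => (X ω).count (B J)) P := by
    set e := Fintype.equivFin (Option (Finset I))
    have h1 := h.count_indep _ (fun j => B (e.symm j)) (fun j => hBm _) (fun j => hBT _)
      (fun i j hij => hBd (e.symm.injective.ne hij))
    simpa using h1.precomp e.injective
  have h2 := hind.indepFun_finset {none} (Finset.univ.erase none) (by simp)
    fun J => h.measurable_count (hBm J)
  have hφ : Measurable fun p : ({none} : Finset (Option (Finset I))) → ℕ => p ⟨none, by simp⟩ :=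
    measurable_pi_apply _
  have hψ : Measurable fun (p : ↥(Finset.univ.erase none : Finset (Option (Finset I))) → ℕ)
      (u : I) => ∑ J ∈ Finset.univ.filter (fun J : Finset I => u ∈ J), p ⟨some J, by simp⟩ :=
    measurable_pi_lambda _ fun u => Finset.measurable_sum _ fun J _ => measurable_pi_apply _
  have h3 := h2.comp hφ hψ
  refine h3.congr (.of_forall fun ω => rfl) (.of_forall fun ω => ?_)
  funext u
  exact (hgood ω).sum_count_atoms I u

/-- Arrival times are recovered from counts: job `i` comes before `u` exactly when more than `i`
jobs do. Hence the past is measurable with respect to the counts of the `Iio u` with `u ≤ s`. -/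
theorem IsJobProcess.indepFun_count_past (h : IsJobProcess P T lam ν X)
    (hgood : ∀ ω, (X ω).Good T) {s s' : ℝ} (hs : 0 ≤ s) (hss' : s ≤ s') (hs' : s' ≤ T) :
    IndepFun (fun ω => (X ω).count (Ico s s')) (fun ω => (X ω).past s) P := by
  have h1 := h.indepFun_count_counts hgood hs hss' hs'
  rw [IndepFun_iff_Indep] at h1 ⊢
  refine indep_of_indep_of_le_right h1 ?_
  set m : MeasurableSpace Ω := MeasurableSpace.comap
    (fun ω (u : Iic s) => (X ω).count (Iio (u : ℝ))) inferInstance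
  have hc : ∀ u ≤ s, Measurable[m] fun ω => (X ω).count (Iio u) := fun u hu =>
    (measurable_pi_apply (⟨u, hu⟩ : Iic s)).comp
      (comap_measurable fun ω (u : Iic s) => (X ω).count (Iio (u : ℝ)))
  refine Measurable.comap_le ?_
  refine (hc s le_rfl).prodMk (measurable_pi_lambda _ fun i => ?_)
  refine measurable_of_Iio fun u => ?_
  by_cases hu : u ≤ s
  · have : (fun ω => if i < (X ω).count (Iio s) then (X ω).time i else s) ⁻¹' Iio u =
        (fun ω => (X ω).count (Iio u)) ⁻¹' {k | i < k} := by
      ext ω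
      simp only [mem_preimage, mem_Iio, mem_ofPred_eq, (hgood ω).lt_count_iff]
      split_ifs with hi
      · exact ⟨fun h => ⟨hi.1, h⟩, fun h => h.2⟩
      · exact ⟨fun h => absurd h (not_lt.2 hu), fun h => absurd ⟨h.1, h.2.trans_le hu⟩ hi⟩
    rw [this]
    exact hc u hu MeasurableSet.of_discrete
  · have : (fun ω => if i < (X ω).count (Iio s) then (X ω).time i else s) ⁻¹' Iio u = univ := by
      ext ω
      simp only [mem_preimage, mem_Iio, mem_univ, iff_true]
      split_ifs with hi
      · exact (((hgood ω).lt_count_iff s i).1 hi).2.trans (not_le.1 hu)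
      · exact not_le.1 hu
    rw [this]
    exact MeasurableSet.univ

/-- The number of jobs in `[s, s')` is independent of the number of workers free at time `s`. -/
theorem IsJobProcess.indepFun_count_workersLeft (h : IsJobProcess P T lam ν X)
    (hgood : ∀ ω, (X ω).Good T) {s s' : ℝ} (hs : 0 ≤ s) (hss' : s ≤ s') (hs' : s' ≤ T)
    (n : ℕ) {A : AcceptRule} (hA : ∀ k i, MeasurableSet (A k i)) :
    IndepFun (fun ω => (X ω).count (Ico s s'))
      (fun ω => workersLeft n A (X ω) ((X ω).count (Iio s))) P := by
  have hval : Measurable fun ω => (X ω).value := measurable_pi_lambda _ h.measurable_value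
  have hpast : Measurable fun ω => (X ω).past s := (Realisation.measurable_past s).comp h.measurable
  have hnt : Measurable fun p : ℕ × (ℕ → ℝ) =>
      (Realisation.count (p.1, p.2, 0) (Ico s s'), Realisation.past s (p.1, p.2, 0)) := by
    have hm : Measurable fun p : ℕ × (ℕ → ℝ) => ((p.1, p.2, 0) : Realisation) := by
      exact measurable_fst.prodMk (measurable_snd.prodMk measurable_const)
    exact ((Realisation.measurable_count measurableSet_Ico).comp hm).prodMk
      ((Realisation.measurable_past s).comp hm)
  have h1 : IndepFun (fun ω => ((X ω).count (Ico s s'), (X ω).past s)) (fun ω => (X ω).value) P :=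
    h.indep.comp hnt measurable_id
  -- Since the values are independent of all arrivals, the whole value sequence may be adjoined to
  -- the past.
  have h2 := indepFun_prodMk_right (h.measurable_count measurableSet_Ico) hpast hval h1
    (h.indepFun_count_past hgood hs hss' hs')
  simp only [Realisation.workersLeft_eq_past n A s]
  refine h2.comp (φ := id) (ψ := fun p : (ℕ × (ℕ → ℝ)) × (ℕ → ℝ) =>
    workersLeft n A (p.1.1, p.1.2, p.2) p.1.1) measurable_id ?_
  have hm : Measurable fun p : (ℕ × (ℕ → ℝ)) × (ℕ → ℝ) => ((p.1.1, p.1.2, p.2) : Realisation) :=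
    (measurable_fst.comp measurable_fst).prodMk
      ((measurable_snd.comp measurable_fst).prodMk measurable_snd)
  exact (Realisation.measurable_index (f := fun i r => workersLeft n A r i)
    (measurable_workersLeft hA) Realisation.measurable_num).comp hm

/-- The value of job `i` is independent of the arrivals and of the number of workers free when
job `i` arrives. -/
theorem IsJobProcess.indepFun_value_workersLeft (h : IsJobProcess P T lam ν X) (n : ℕ)
    {A : AcceptRule} (hA : ∀ k i, MeasurableSet (A k i)) (i : ℕ) :
    IndepFun (fun ω => (X ω).value i)
      (fun ω => (workersLeft n A (X ω) i, ((X ω).num, (X ω).time))) P := by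
  have hvf : Measurable fun ω (j : Finset.range i) => (X ω).value j :=
    measurable_pi_lambda _ fun j => h.measurable_value j
  have hnt : Measurable fun ω => ((X ω).num, (X ω).time) :=
    (Realisation.measurable_num.comp h.measurable).prodMk
      ((measurable_fst.comp measurable_snd).comp h.measurable)
  have h1 : IndepFun (fun ω => ((X ω).value i, fun j : Finset.range i => (X ω).value j))
      (fun ω => ((X ω).num, (X ω).time)) P := by
    refine h.indep.symm.comp (φ := fun v : ℕ → ℝ => (v i, fun j : Finset.range i => v j)) ?_
      measurable_id
    exact (measurable_pi_apply i).prodMk (measurable_pi_lambda _ fun j => measurable_pi_apply _)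
  have hφ : Measurable fun p : ({i} : Finset ℕ) → ℝ => p ⟨i, by simp⟩ := measurable_pi_apply _
  have h2 : IndepFun (fun ω => (X ω).value i) (fun ω (j : Finset.range i) => (X ω).value j) P :=
    (h.value_indep.indepFun_finset {i} (Finset.range i) (by simp) h.measurable_value).comp hφ measurable_id
  have h3 := indepFun_prodMk_right (h.measurable_value i) hvf hnt h1 h2
  -- Values from index `i` on are replaced by `0`, which the number of workers free at job `i`
  -- cannot notice.
  have hm : Measurable fun p : (Finset.range i → ℝ) × (ℕ × (ℕ → ℝ)) =>
      ((p.2.1, p.2.2, fun j => if hj : j ∈ Finset.range i then p.1 ⟨j, hj⟩ else 0) :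
        Realisation) := by
    refine (measurable_fst.comp measurable_snd).prodMk
      ((measurable_snd.comp measurable_snd).prodMk (measurable_pi_lambda _ fun j => ?_))
    split_ifs with hj
    · exact (measurable_pi_apply _).comp measurable_fst
    · exact measurable_const
  have h4 := h3.comp (φ := id) measurable_id
    (((measurable_workersLeft (n := n) hA i).comp hm).prodMk measurable_snd)
  refine h4.congr (.of_forall fun ω => rfl) (.of_forall fun ω => Prod.ext ?_ rfl)
  refine workersLeft_congr i fun j hj => ⟨rfl, ?_⟩
  change (if hj : j ∈ Finset.range i then (X ω).value j else 0) = (X ω).value j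
  rw [dif_pos (Finset.mem_range.2 hj)]

/-- Averaging out the value of a job that arrives in `[s, s')`. -/
theorem IsJobProcess.integral_value_sub_eq_zero [IsProbabilityMeasure ν]
    (h : IsJobProcess P T lam ν X) (n : ℕ)
    {A : AcceptRule} (hA : ∀ k i, MeasurableSet (A k i)) {f : ℕ → ℝ → ℝ}
    (hfm : ∀ k, Measurable (f k)) (hfi : ∀ k, Integrable (f k) ν) (s s' : ℝ) (i : ℕ) :
    Integrable (fun ω => (if i < (X ω).num ∧ (X ω).time i ∈ Ico s s' then (1 : ℝ) else 0) *
      (f (workersLeft n A (X ω) i) ((X ω).value i) - ∫ x, f (workersLeft n A (X ω) i) x ∂ν)) P ∧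
    ∫ ω, (if i < (X ω).num ∧ (X ω).time i ∈ Ico s s' then (1 : ℝ) else 0) *
      (f (workersLeft n A (X ω) i) ((X ω).value i) - ∫ x, f (workersLeft n A (X ω) i) x ∂ν) ∂P
      = 0 := by
  classical
  -- Splitting by the number `k` of free workers removes the random index of `f` and leaves a finite
  -- sum of products of independent factors, the second of mean zero.
  set w : ℕ → ℕ × (ℕ × (ℕ → ℝ)) → ℝ := fun k p =>
    if p.1 = k ∧ p.2.1 > i ∧ p.2.2 i ∈ Ico s s' then 1 else 0 with hw
  have hwm : ∀ k, Measurable (w k) := by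
    intro k
    refine Measurable.ite ?_ measurable_const measurable_const
    refine MeasurableSet.inter (measurable_fst (measurableSet_singleton k)) (MeasurableSet.inter
      ((measurable_fst.comp measurable_snd) (MeasurableSet.of_discrete (s := {j | j > i})))
      (((measurable_pi_apply i).comp (measurable_snd.comp measurable_snd)) measurableSet_Ico))
  set c : ℕ → ℝ := fun k => ∫ x, f k x ∂ν with hc
  set ξ : Ω → ℕ × (ℕ × (ℕ → ℝ)) := fun ω => (workersLeft n A (X ω) i, ((X ω).num, (X ω).time))
    with hξ
  have hξm : Measurable ξ :=
    ((measurable_workersLeft hA i).comp h.measurable).prodMk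
      ((Realisation.measurable_num.comp h.measurable).prodMk
        ((measurable_fst.comp measurable_snd).comp h.measurable))
  have hind : ∀ k, IndepFun (fun ω => w k (ξ ω)) (fun ω => f k ((X ω).value i) - c k) P := fun k =>
    (h.indepFun_value_workersLeft n hA i).symm.comp (hwm k) ((hfm k).sub_const (c k))
  have hfi' : ∀ k, Integrable (fun ω => f k ((X ω).value i)) P := by
    intro k
    have := hfi k
    rw [← h.value_law i] at this
    exact this.comp_measurable (h.measurable_value i)
  have hf0 : ∀ k, ∫ ω, (f k ((X ω).value i) - c k) ∂P = 0 := by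
    intro k
    have hck : c k = ∫ ω, f k ((X ω).value i) ∂P := by
      simp only [hc]
      rw [← h.value_law i,
        integral_map (h.measurable_value i).aemeasurable (hfm k).aestronglyMeasurable]
    rw [integral_sub (hfi' k) (integrable_const _), ← hck]
    simp
  have hwi : ∀ k, Integrable (fun ω => w k (ξ ω)) P := fun k =>
    Integrable.of_bound ((hwm k).comp hξm).aestronglyMeasurable 1 (.of_forall fun ω => by
      simp only [hw]
      split_ifs <;> simp)
  have hint : ∀ k, Integrable (fun ω => w k (ξ ω) * (f k ((X ω).value i) - c k)) P := fun k =>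
    (hind k).integrable_mul (hwi k) ((hfi' k).sub (integrable_const _))
  have hrew : ∀ ω, (if i < (X ω).num ∧ (X ω).time i ∈ Ico s s' then (1 : ℝ) else 0) *
      (f (workersLeft n A (X ω) i) ((X ω).value i) - ∫ x, f (workersLeft n A (X ω) i) x ∂ν) =
      ∑ k ∈ Finset.range (n + 1), w k (ξ ω) * (f k ((X ω).value i) - c k) := by
    intro ω
    rw [Finset.sum_eq_single_of_mem (workersLeft n A (X ω) i)
      (Finset.mem_range.2 (Nat.lt_succ_of_le (workersLeft_le _ _)))]
    · simp [hw, hξ, hc]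
    · intro k _ hk
      have : ¬ (workersLeft n A (X ω) i = k) := fun h => hk h.symm
      simp [hw, hξ, this]
  simp only [hrew]
  refine ⟨integrable_finsetSum _ fun k _ => hint k, ?_⟩
  rw [integral_finsetSum _ fun k _ => hint k]
  refine Finset.sum_eq_zero fun k _ => ?_
  rw [(hind k).integral_fun_mul_eq_mul_integral (hwi k).aestronglyMeasurable
    ((hfi' k).sub (integrable_const _)).aestronglyMeasurable, hf0, mul_zero]

/-- Averaging out the values of all jobs that arrive in `[s, s')`. -/
theorem IsJobProcess.integral_sum_value_sub_eq_zero [IsProbabilityMeasure ν]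
    (h : IsJobProcess P T lam ν X) (hlam : ∀ t ∈ Icc 0 T, 0 < lam t) (n : ℕ)
    {A : AcceptRule} (hA : ∀ k i, MeasurableSet (A k i)) {f : ℕ → ℝ → ℝ}
    (hfm : ∀ k, Measurable (f k)) (hfi : ∀ k, Integrable (f k) ν) {g : ℝ → ℝ} (hgm : Measurable g)
    (hg : Integrable g ν) (hfg : ∀ k ≤ n, ∀ x, |f k x - ∫ x, f k x ∂ν| ≤ g x) (s s' : ℝ) :
    ∫ ω, ∑ i ∈ Finset.range (X ω).num, (if i < (X ω).num ∧ (X ω).time i ∈ Ico s s' then (1 : ℝ)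
      else 0) * (f (workersLeft n A (X ω) i) ((X ω).value i)
        - ∫ x, f (workersLeft n A (X ω) i) x ∂ν) ∂P = 0 := by
  classical
  set D : ℕ → Ω → ℝ := fun i ω => (if i < (X ω).num ∧ (X ω).time i ∈ Ico s s' then (1 : ℝ)
      else 0) * (f (workersLeft n A (X ω) i) ((X ω).value i)
        - ∫ x, f (workersLeft n A (X ω) i) x ∂ν) with hD
  have hDi := fun i => h.integral_value_sub_eq_zero n hA hfm hfi s s' i
  have hg0 : ∀ x, 0 ≤ g x := fun x => (abs_nonneg _).trans (hfg 0 (Nat.zero_le n) x)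
  have hDg : ∀ i ω, |D i ω| ≤ if i < (X ω).num then g ((X ω).value i) else 0 := by
    intro i ω
    simp only [hD, abs_mul]
    by_cases hi : i < (X ω).num
    · rw [if_pos hi]
      refine (mul_le_of_le_one_left (abs_nonneg _) ?_).trans (hfg _ (workersLeft_le _ _) _)
      split_ifs <;> simp
    · simp [hi]
  -- The number of jobs is unbounded, so the sum is truncated at `N`; the dominating sum over all
  -- jobs is integrable by Wald's identity.
  have hlim : Tendsto (fun N => ∫ ω, ∑ i ∈ Finset.range N, D i ω ∂P) atTop
      (𝓝 (∫ ω, ∑ i ∈ Finset.range (X ω).num, D i ω ∂P)) := by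
    refine tendsto_integral_of_dominated_convergence
      (fun ω => ∑ i ∈ Finset.range (X ω).num, g ((X ω).value i))
      (fun N => (integrable_finsetSum _ fun i _ => (hDi i).1).aestronglyMeasurable)
      (h.wald hlam hgm hg).1 (fun N => .of_forall fun ω => ?_) (.of_forall fun ω => ?_)
    · rw [Real.norm_eq_abs]
      refine (Finset.abs_sum_le_sum_abs _ _).trans ((Finset.sum_le_sum fun i _ => hDg i ω).trans ?_)
      rw [← Finset.sum_filter]
      refine Finset.sum_le_sum_of_subset_of_nonneg (fun i hi => ?_) fun i _ _ => hg0 _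
      exact Finset.mem_range.2 (Finset.mem_filter.1 hi).2
    · refine tendsto_const_nhds.congr' ?_
      filter_upwards [eventually_ge_atTop (X ω).num] with N hN
      refine Finset.sum_subset (Finset.range_mono hN) fun i _ hi => ?_
      have : ¬ i < (X ω).num := fun h => hi (Finset.mem_range.2 h)
      simp [hD, this]
  refine tendsto_nhds_unique hlim ?_
  have : ∀ N, ∫ ω, ∑ i ∈ Finset.range N, D i ω ∂P = 0 := by
    intro N
    rw [integral_finsetSum _ fun i _ => (hDi i).1]
    exact Finset.sum_eq_zero fun i _ => (hDi i).2
  simp only [this]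
  exact tendsto_const_nhds

end Arrivals

/-! ### Verification: the value of a decision rule -/

/-- The mean shortage function of the law `ν`. -/
def meanShortage (ν : Measure ℝ) (y : ℝ) : ℝ := ∫ x, max (x - y) 0 ∂ν

/-- The expected future reward with `k` free workers, in terms of the critical curves. -/
def curveValue (y : ℕ → ℝ → ℝ) (k : ℕ) (t : ℝ) : ℝ := ∑ j ∈ Finset.range k, y (j + 1) t

/-- Quantitative form of the equations satisfied by the critical curves. -/
structure IsValueFamily (T C : ℝ) (lam phi : ℝ → ℝ) (n : ℕ) (y : ℕ → ℝ → ℝ) : Prop where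
  nonneg : 0 ≤ C
  rate_le : ∀ s s', 0 ≤ s → s ≤ s' → s' ≤ T → ∫ t in Ico s s', lam t ≤ C * (s' - s)
  shortage_mem : ∀ k, 0 < k → k ≤ n → ∀ t ∈ Icc 0 T, phi (y k t) ∈ Icc 0 C
  abs_le : ∀ k, 0 < k → k ≤ n → ∀ t ∈ Icc 0 T, |y k t| ≤ C
  lipschitz : ∀ k, 0 < k → k ≤ n → ∀ s s', 0 ≤ s → s ≤ s' → s' ≤ T →
    |y k s - y k s'| ≤ C * (s' - s)
  terminal : ∀ k, 0 < k → k ≤ n → y k T = 0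
  drift : ∀ k ≤ n, ∀ s s', 0 ≤ s → s ≤ s' → s' ≤ T →
    |curveValue y k s' - curveValue y k s +
      (∫ t in Ico s s', lam t) * (if k = 0 then 0 else phi (y k s'))| ≤ C * (s' - s) ^ 2

/-- With `m + 1` equal steps the accumulated error is `C T² / (m + 1)`, which vanishes in the limit.
-/
theorem le_of_sub_le_sq {U : ℝ → ℝ} {T C : ℝ} (hT : 0 ≤ T)
    (h : ∀ s s', 0 ≤ s → s ≤ s' → s' ≤ T → U s' - U s ≤ C * (s' - s) ^ 2) : U T ≤ U 0 := by
  have key : ∀ m : ℕ, U T - U 0 ≤ C * T ^ 2 / ((m : ℝ) + 1) := by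
    intro m
    have hm : (0 : ℝ) < (m : ℝ) + 1 := by positivity
    have h1 := Finset.sum_range_sub (fun j : ℕ => U (j * (T / (m + 1)))) (m + 1)
    have h2 : ((m + 1 : ℕ) : ℝ) * (T / (m + 1)) = T := by
      push_cast
      field_simp
    simp only [h2, Nat.cast_zero, zero_mul] at h1
    rw [← h1]
    have h3 : ∀ j ∈ Finset.range (m + 1), U ((j + 1 : ℕ) * (T / (m + 1))) - U (j * (T / (m + 1)))
        ≤ C * (T / (m + 1)) ^ 2 := by
      intro j hj
      have hj' : ((j + 1 : ℕ) : ℝ) ≤ ((m + 1 : ℕ) : ℝ) := by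
        exact_mod_cast Finset.mem_range.1 hj
      have hd : 0 ≤ T / ((m : ℝ) + 1) := by positivity
      have h4 := h (j * (T / (m + 1))) ((j + 1 : ℕ) * (T / (m + 1))) (by positivity)
        (mul_le_mul_of_nonneg_right (by push_cast; linarith) hd)
        ((mul_le_mul_of_nonneg_right hj' hd).trans_eq h2)
      refine h4.trans_eq ?_
      push_cast
      ring
    refine (Finset.sum_le_sum h3).trans_eq ?_
    rw [Finset.sum_const, Finset.card_range, nsmul_eq_mul]
    push_cast
    field_simp
  have hlim : Tendsto (fun m : ℕ => C * T ^ 2 / ((m : ℝ) + 1)) atTop (𝓝 0) :=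
    tendsto_const_nhds.div_atTop
      (tendsto_atTop_add_const_right _ _ tendsto_natCast_atTop_atTop)
  exact sub_nonpos.1 (ge_of_tendsto' hlim key)

/-- The first term is exact, so only the later ones cost `C`; the last factor is the number of terms
beyond the first, also when there are none. -/
theorem abs_sum_Ico_sub_le {g : ℕ → ℝ} {C : ℝ} {a b : ℕ} (hab : a ≤ b)
    (hg : ∀ i, |g i - g a| ≤ C) :
    |∑ i ∈ Finset.Ico a b, g i - ((b - a : ℕ) : ℝ) * g a|
      ≤ C * (((b - a : ℕ) : ℝ) - 1 + if b - a = 0 then 1 else 0) := by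
  rcases hab.eq_or_lt with rfl | hlt
  · simp
  have h1 : ∑ i ∈ Finset.Ico a b, g i - ((b - a : ℕ) : ℝ) * g a
      = ∑ i ∈ Finset.Ico a b, (g i - g a) := by
    simp [Finset.sum_sub_distrib]
  rw [h1, Finset.sum_eq_sum_Ico_succ_bot hlt, sub_self, zero_add, if_neg (by omega), add_zero]
  refine (Finset.abs_sum_le_sum_abs _ _).trans ((Finset.sum_le_sum fun i _ => hg i).trans_eq ?_)
  rw [Finset.sum_const, Nat.card_Ico, nsmul_eq_mul, mul_comm]
  congr 1
  have : b - a = b - (a + 1) + 1 := by omega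
  rw [this]
  push_cast
  ring

/-! ### Gains and advantages of single decisions. -/

open Classical in
/-- The reward from job `i`. -/
def gain (n : ℕ) (A : AcceptRule) (r : Realisation) (i : ℕ) : ℝ :=
  if 0 < workersLeft n A r i ∧ r.history i ∈ A (workersLeft n A r i) i then r.value i else 0

open Classical in
/-- The advantage of the decision on job `i` over its rejection, if workers have the values `c`. -/
def advantage (n : ℕ) (A : AcceptRule) (c : ℕ → ℝ) (r : Realisation) (i : ℕ) : ℝ :=
  if 0 < workersLeft n A r i ∧ r.history i ∈ A (workersLeft n A r i) i then
    r.value i - c (workersLeft n A r i) else 0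

/-- The advantage of the best decision, with `k` workers free and a job of value `x`. -/
def bestAdvantage (c : ℕ → ℝ) (k : ℕ) (x : ℝ) : ℝ := if k = 0 then 0 else max (x - c k) 0

open Classical in
/-- The indicator of the arrival of job `i` in `[s, s')`. -/
def arrives (s s' : ℝ) (r : Realisation) (i : ℕ) : ℝ :=
  if i < r.num ∧ r.time i ∈ Ico s s' then 1 else 0

theorem reward_eq_sum_gain (n : ℕ) (A : AcceptRule) (r : Realisation) :
    reward n A r = ∑ i ∈ Finset.range r.num, gain n A r i := rfl

theorem arrives_nonneg (s s' : ℝ) (r : Realisation) (i : ℕ) : 0 ≤ arrives s s' r i := by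
  unfold arrives
  split_ifs <;> simp

theorem arrives_le_one (s s' : ℝ) (r : Realisation) (i : ℕ) : arrives s s' r i ≤ 1 := by
  unfold arrives
  split_ifs <;> simp

theorem measurable_arrives (s s' : ℝ) (i : ℕ) : Measurable fun r => arrives s s' r i :=
  Measurable.ite ((Realisation.measurable_num (MeasurableSet.of_discrete (s := {j | i < j}))).inter
    (Realisation.measurable_time i measurableSet_Ico)) measurable_const measurable_const

theorem Realisation.Good.sum_arrives {T : ℝ} {r : Realisation} (h : r.Good T) (s s' : ℝ)
    (g : ℕ → ℝ) :
    ∑ i ∈ Finset.range r.num, arrives s s' r i * g i =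
      ∑ i ∈ Finset.Ico (r.count (Iio s)) (r.count (Iio s')), g i := by
  classical
  simp only [arrives, ite_mul, one_mul, zero_mul]
  rw [← Finset.sum_filter]
  refine Finset.sum_congr ?_ fun _ _ => rfl
  ext i
  rw [Finset.mem_Ico, ← not_lt, h.lt_count_iff, h.lt_count_iff, Finset.mem_filter,
    Finset.mem_range, mem_Ico]
  constructor
  · rintro ⟨h1, -, h2, h3⟩
    exact ⟨fun h4 => absurd h4.2 (not_lt.2 h2), h1, h3⟩
  · rintro ⟨h1, h2, h3⟩
    exact ⟨h2, h2, not_lt.1 fun h4 => h1 ⟨h2, h4⟩, h3⟩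

/-- At a fixed time, acceptance with `k` free workers removes `y k` from their total value, which is
the advantage minus the gain; rejection changes nothing. -/
theorem curveValue_workersLeft_sub (n : ℕ) (A : AcceptRule) (y : ℕ → ℝ → ℝ) (r : Realisation)
    (t : ℝ) {a b : ℕ} (hab : a ≤ b) :
    curveValue y (workersLeft n A r b) t - curveValue y (workersLeft n A r a) t =
      ∑ i ∈ Finset.Ico a b, (advantage n A (fun k => y k t) r i - gain n A r i) := by
  induction b, hab using Nat.le_induction with
  | base => simp
  | succ b hab ih =>
    rw [Finset.sum_Ico_succ_top hab, ← ih]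
    have key : curveValue y (workersLeft n A r (b + 1)) t - curveValue y (workersLeft n A r b) t =
        advantage n A (fun k => y k t) r b - gain n A r b := by
      rw [workersLeft, advantage, gain]
      rcases Nat.eq_zero_or_pos (workersLeft n A r b) with h0 | h0
      · simp [h0]
      · by_cases hA : r.history b ∈ A (workersLeft n A r b) b
        · obtain ⟨k, hk⟩ := Nat.exists_eq_succ_of_ne_zero h0.ne'
          rw [if_pos hA, if_pos ⟨h0, hA⟩, if_pos ⟨h0, hA⟩, hk]
          simp [curveValue, Finset.sum_range_succ]
        · simp [hA]
    linarith

section Arrivals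

variable {Ω : Type*} [MeasurableSpace Ω] {P : Measure Ω} [IsProbabilityMeasure P] {T : ℝ}
  {lam : ℝ → ℝ} {ν : Measure ℝ} {X : Ω → Realisation}

/-- With `L` the mean count, the number of jobs beyond the first has mean `L - 1 + exp (-L)`, which
is of second order because `exp (-L) ≤ 1 / (1 + L)`. -/
theorem IsJobProcess.integral_count_sub_one_le (h : IsJobProcess P T lam ν X)
    (hlam : ∀ t ∈ Icc 0 T, 0 < lam t) {B : Set ℝ} (hB : MeasurableSet B) (hBT : B ⊆ Icc 0 T) :
    Integrable (fun ω => ((X ω).count B : ℝ) - 1 + if (X ω).count B = 0 then 1 else 0) P ∧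
    ∫ ω, (((X ω).count B : ℝ) - 1 + if (X ω).count B = 0 then 1 else 0) ∂P
      ≤ (∫ t in B, lam t) ^ 2 := by
  set L := ∫ t in B, lam t
  have hL : 0 ≤ L := setIntegral_nonneg hB fun t ht => (hlam t (hBT ht)).le
  have hms : MeasurableSet {ω | (X ω).count B = 0} :=
    h.measurable_count hB (measurableSet_singleton 0)
  have h1 : (fun ω => if (X ω).count B = 0 then (1 : ℝ) else 0) =
      {ω | (X ω).count B = 0}.indicator 1 := by
    funext ω
    simp [indicator]
  have hi1 : Integrable (fun ω => if (X ω).count B = 0 then (1 : ℝ) else 0) P := by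
    rw [h1]
    exact (integrable_const 1).indicator hms
  have hi2 : Integrable (fun ω => ((X ω).count B : ℝ) - 1) P :=
    (h.integrable_count hB hBT).sub (integrable_const 1)
  refine ⟨hi2.add hi1, ?_⟩
  rw [integral_add hi2 hi1, integral_sub (h.integrable_count hB hBT) (integrable_const 1),
    h.integral_count hB hBT hlam, h1, integral_indicator_one hms,
    h.measureReal_count_eq_zero hB hBT hlam]
  have h2 : Real.exp (-L) ≤ 1 / (1 + L) := by
    rw [Real.exp_neg, one_div]
    exact inv_anti₀ (by linarith) (by linarith [Real.add_one_le_exp L])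
  have h3 : L - 1 + 1 / (1 + L) ≤ L ^ 2 := by
    have : L - 1 + 1 / (1 + L) = L ^ 2 / (1 + L) := by
      field_simp
      ring
    rw [this]
    exact div_le_self (by positivity) (by linarith)
  simp only [integral_const, probReal_univ, smul_eq_mul, mul_one]
  change L - 1 + Real.exp (-L) ≤ L ^ 2
  linarith

theorem integral_bestAdvantage (c : ℕ → ℝ) (k : ℕ) :
    ∫ x, bestAdvantage c k x ∂ν = if k = 0 then 0 else meanShortage ν (c k) := by
  unfold bestAdvantage
  split_ifs <;> simp [meanShortage]

variable [IsProbabilityMeasure ν]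

theorem integrable_max_sub_zero (hν : Integrable (fun x : ℝ => x) ν) (c : ℝ) :
    Integrable (fun x => max (x - c) 0) ν :=
  (hν.sub (integrable_const c)).pos_part

theorem IsJobProcess.integrable_sum_num (h : IsJobProcess P T lam ν X)
    (hlam : ∀ t ∈ Icc 0 T, 0 < lam t) (hν : Integrable (fun x : ℝ => x) ν) {C : ℝ} (hC : 0 ≤ C)
    {f : ℕ → Realisation → ℝ} (hf : ∀ i, Measurable (f i))
    (hfC : ∀ i r, |f i r| ≤ |r.value i| + C) {k : Realisation → ℕ} (hk : Measurable k)
    (hkn : ∀ r, k r ≤ r.num) :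
    Integrable (fun ω => ∑ i ∈ Finset.range (k (X ω)), f i (X ω)) P := by
  have hw := (h.wald hlam (g := fun x => |x| + C) (by fun_prop)
    (hν.abs.add (integrable_const C))).1
  refine hw.mono' ((Realisation.measurable_sum_num hf hk).comp h.measurable).aestronglyMeasurable
    (.of_forall fun ω => ?_)
  rw [Real.norm_eq_abs]
  refine (Finset.abs_sum_le_sum_abs _ _).trans ((Finset.sum_le_sum fun i _ => hfC i _).trans ?_)
  exact Finset.sum_le_sum_of_subset_of_nonneg (Finset.range_mono (hkn _))
    fun i _ _ => add_nonneg (abs_nonneg _) hC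

theorem measurable_gain {n : ℕ} {A : AcceptRule} (hA : ∀ k i, MeasurableSet (A k i)) (i : ℕ) :
    Measurable fun r => gain n A r i := by
  classical
  refine Realisation.measurable_index
    (f := fun k (r : Realisation) => if 0 < k ∧ r.history i ∈ A k i then r.value i else 0)
    (fun k => ?_) (measurable_workersLeft hA i)
  exact Measurable.ite ((MeasurableSet.const _).inter (Realisation.measurable_history i (hA k i)))
    (Realisation.measurable_value i) measurable_const

theorem measurable_advantage {n : ℕ} {A : AcceptRule} (hA : ∀ k i, MeasurableSet (A k i))
    (c : ℕ → ℝ) (i : ℕ) : Measurable fun r => advantage n A c r i := by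
  classical
  refine Realisation.measurable_index
    (f := fun k (r : Realisation) => if 0 < k ∧ r.history i ∈ A k i then r.value i - c k else 0)
    (fun k => ?_) (measurable_workersLeft hA i)
  exact Measurable.ite ((MeasurableSet.const _).inter (Realisation.measurable_history i (hA k i)))
    ((Realisation.measurable_value i).sub_const _) measurable_const

theorem measurable_bestAdvantage (c : ℕ → ℝ) (k : ℕ) : Measurable (bestAdvantage c k) := by
  unfold bestAdvantage
  split_ifs
  · exact measurable_const
  · fun_prop

theorem integrable_bestAdvantage (hν : Integrable (fun x : ℝ => x) ν) (c : ℕ → ℝ) (k : ℕ) :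
    Integrable (bestAdvantage c k) ν := by
  unfold bestAdvantage
  split_ifs
  · exact integrable_zero _ _ _
  · exact integrable_max_sub_zero hν _

theorem advantage_le_bestAdvantage (n : ℕ) (A : AcceptRule) (c : ℕ → ℝ) (r : Realisation) (i : ℕ) :
    advantage n A c r i ≤ bestAdvantage c (workersLeft n A r i) (r.value i) := by
  unfold advantage bestAdvantage
  split_ifs with h1 h2 h2
  · exact absurd h1.1 (by omega)
  · exact le_max_left _ _
  · exact le_rfl
  · exact le_max_right _ _

theorem abs_bestAdvantage_le {C : ℝ} (hC : 0 ≤ C) {c : ℕ → ℝ} {k : ℕ}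
    (hc : 0 < k → |c k| ≤ C) (x : ℝ) : |bestAdvantage c k x| ≤ |x| + C := by
  unfold bestAdvantage
  split_ifs with h
  · rw [abs_zero]
    positivity
  · have h1 := hc (Nat.pos_of_ne_zero h)
    rw [abs_of_nonneg (le_max_right _ _)]
    refine max_le ?_ (by positivity)
    rw [abs_le] at h1
    linarith [le_abs_self x]

theorem abs_advantage_le {n : ℕ} (A : AcceptRule) {C : ℝ} (hC : 0 ≤ C) {c : ℕ → ℝ}
    (hc : ∀ k, 0 < k → k ≤ n → |c k| ≤ C) (r : Realisation) (i : ℕ) :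
    |advantage n A c r i| ≤ |r.value i| + C := by
  unfold advantage
  split_ifs with h
  · exact (abs_sub _ _).trans (by linarith [hc _ h.1 (workersLeft_le (n := n) (A := A) r i)])
  · rw [abs_zero]
    positivity

theorem abs_gain_le (n : ℕ) (A : AcceptRule) (r : Realisation) (i : ℕ) :
    |gain n A r i| ≤ |r.value i| := by
  unfold gain
  split_ifs
  · exact le_rfl
  · rw [abs_zero]
    positivity

theorem abs_arrives_mul_le (s s' : ℝ) (r : Realisation) (i : ℕ) (x : ℝ) :
    |arrives s s' r i * x| ≤ |x| := by
  rw [abs_mul, abs_of_nonneg (arrives_nonneg s s' r i)]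
  exact mul_le_of_le_one_left (abs_nonneg x) (arrives_le_one s s' r i)

end Arrivals

/-! ### The expected worth of a decision rule over short times. -/

section Arrivals

variable {Ω : Type*} [MeasurableSpace Ω] {P : Measure Ω} {T : ℝ}
  {lam : ℝ → ℝ} {ν : Measure ℝ} {X : Ω → Realisation}
  {C : ℝ} {n : ℕ} {y : ℕ → ℝ → ℝ} {A : AcceptRule}

theorem measurable_workersLeft_count (hA : ∀ k i, MeasurableSet (A k i)) (s : ℝ) :
    Measurable fun r => workersLeft n A r (r.count (Iio s)) :=
  Realisation.measurable_index (f := fun i r => workersLeft n A r i) (measurable_workersLeft hA)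
    (Realisation.measurable_count measurableSet_Iio)

/-- Every decision of `A` is correct up to an error `η` in the comparison of the value of the job
with that of the worker. -/
def IsNearOptimal (T η : ℝ) (n : ℕ) (y : ℕ → ℝ → ℝ) (A : AcceptRule) : Prop :=
  ∀ k, 0 < k → k ≤ n → ∀ i (h : Fin (i + 1) → ℝ × ℝ), (h (Fin.last i)).1 ∈ Icc 0 T →
    (h ∈ A k i → y k (h (Fin.last i)).1 - η ≤ (h (Fin.last i)).2) ∧
    (h ∉ A k i → (h (Fin.last i)).2 ≤ y k (h (Fin.last i)).1 + η)

/-- A wrong decision costs no more than the distance of the job value from the curve at time `s'`: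
`η` at the arrival time, plus the movement of the curve until `s'`. -/
theorem IsNearOptimal.le_advantage {η : ℝ} (hA : IsNearOptimal T η n y A) (hη : 0 ≤ η)
    (hV : IsValueFamily T C lam (meanShortage ν) n y) {s s' : ℝ} (hs : 0 ≤ s)
    (hss' : s ≤ s') (hs' : s' ≤ T) {r : Realisation} {i : ℕ} (ht : r.time i ∈ Ico s s') :
    bestAdvantage (fun k => y k s') (workersLeft n A r i) (r.value i) - (η + C * (s' - s)) ≤
      advantage n A (fun k => y k s') r i := by
  have hC := mul_nonneg hV.nonneg (sub_nonneg.2 hss')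
  unfold bestAdvantage advantage
  rcases Nat.eq_zero_or_pos (workersLeft n A r i) with h0 | h0
  · simp only [h0, lt_irrefl, false_and, if_false, if_true]
    linarith
  · have hle := workersLeft_le (n := n) (A := A) r i
    have h1 := hA _ h0 hle i (r.history i) ⟨hs.trans ht.1, ht.2.le.trans hs'⟩
    have h2 := hV.lipschitz _ h0 hle (r.time i) s' (hs.trans ht.1) ht.2.le hs'
    have h3 : C * (s' - r.time i) ≤ C * (s' - s) :=
      mul_le_mul_of_nonneg_left (by linarith [ht.1]) hV.nonneg
    have h4 : (r.history i (Fin.last i)).1 = r.time i := rfl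
    have h5 : (r.history i (Fin.last i)).2 = r.value i := rfl
    rw [h4, h5] at h1
    rw [abs_le] at h2
    rw [if_neg h0.ne']
    by_cases hmem : r.history i ∈ A (workersLeft n A r i) i
    · rw [if_pos ⟨h0, hmem⟩]
      have := h1.1 hmem
      rcases max_cases (r.value i - y (workersLeft n A r i) s') 0 with h6 | h6 <;> linarith
    · rw [if_neg fun h => hmem h.2]
      have := h1.2 hmem
      rcases max_cases (r.value i - y (workersLeft n A r i) s') 0 with h6 | h6 <;> linarith

/-- The expected reward before time `s` plus the value of the workers that are free at time `s`. -/
def expectedWorth (P : Measure Ω) (X : Ω → Realisation) (n : ℕ) (A : AcceptRule) (y : ℕ → ℝ → ℝ)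
    (s : ℝ) : ℝ :=
  ∫ ω, (∑ i ∈ Finset.range ((X ω).count (Iio s)), gain n A (X ω) i +
    curveValue y (workersLeft n A (X ω) ((X ω).count (Iio s))) s) ∂P

theorem expectedWorth_horizon (hgood : ∀ ω, (X ω).Good T)
    (hV : IsValueFamily T C lam (meanShortage ν) n y) :
    expectedWorth P X n A y T = expectedReward P X n A := by
  refine integral_congr_ae (.of_forall fun ω => ?_)
  have h0 : (X ω).count (Iio T) = (X ω).num :=
    (X ω).count_eq_num fun i hi => ((hgood ω).time_mem i hi).2
  have h1 : curveValue y (workersLeft n A (X ω) (X ω).num) T = 0 :=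
    Finset.sum_eq_zero fun j hj => hV.terminal (j + 1) (Nat.succ_pos j)
      ((Finset.mem_range.1 hj).trans_le (workersLeft_le _ _))
  simp only [h0, h1, add_zero, reward_eq_sum_gain]

variable [IsProbabilityMeasure P]

theorem expectedWorth_zero (hgood : ∀ ω, (X ω).Good T) :
    expectedWorth P X n A y 0 = curveValue y n 0 := by
  have h0 : ∀ ω, (X ω).count (Iio 0) = 0 := by
    intro ω
    by_contra hne
    have h1 := ((hgood ω).lt_count_iff 0 0).1 (Nat.pos_of_ne_zero hne)
    exact absurd h1.2 (not_lt.2 ((hgood ω).time_mem 0 h1.1).1)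
  simp [expectedWorth, h0, workersLeft]

theorem IsJobProcess.integrable_comp_workersLeft (h : IsJobProcess P T lam ν X)
    (hA : ∀ k i, MeasurableSet (A k i)) (s : ℝ) (g : ℕ → ℝ) :
    Integrable (fun ω => g (workersLeft n A (X ω) ((X ω).count (Iio s)))) P := by
  refine Integrable.of_bound ((measurable_from_nat (f := g)).comp
    ((measurable_workersLeft_count hA s).comp h.measurable)).aestronglyMeasurable
    (∑ k ∈ Finset.range (n + 1), |g k|) (.of_forall fun ω => ?_)
  exact Finset.single_le_sum (f := fun k => |g k|) (fun k _ => abs_nonneg _)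
    (Finset.mem_range.2 (Nat.lt_succ_of_le (workersLeft_le _ _)))

variable [IsProbabilityMeasure ν]

theorem IsJobProcess.integrable_bestAdvantage (h : IsJobProcess P T lam ν X)
    (hlam : ∀ t ∈ Icc 0 T, 0 < lam t) (hν : Integrable (fun x : ℝ => x) ν)
    (hV : IsValueFamily T C lam (meanShortage ν) n y) (hA : ∀ k i, MeasurableSet (A k i))
    (s : ℝ) {s' : ℝ} (hs' : s' ∈ Icc 0 T) :
    Integrable (fun ω => ∑ i ∈ Finset.range (X ω).num, arrives s s' (X ω) i *
      bestAdvantage (fun k => y k s') (workersLeft n A (X ω) i) ((X ω).value i)) P := by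
  refine h.integrable_sum_num hlam hν hV.nonneg (f := fun i r => arrives s s' r i *
    bestAdvantage (fun k => y k s') (workersLeft n A r i) (r.value i)) (fun i => ?_) (fun i r => ?_)
    Realisation.measurable_num fun _ => le_rfl
  · refine (measurable_arrives s s' i).mul (Realisation.measurable_index
      (f := fun k (r : Realisation) => bestAdvantage (fun k => y k s') k (r.value i)) (fun k => ?_)
      (measurable_workersLeft hA i))
    exact (measurable_bestAdvantage _ k).comp (Realisation.measurable_value i)
  · exact (abs_arrives_mul_le _ _ _ _ _).trans (abs_bestAdvantage_le hV.nonneg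
      (fun hk => hV.abs_le _ hk (workersLeft_le _ _) s' hs') _)

theorem IsJobProcess.integrable_advantage (h : IsJobProcess P T lam ν X)
    (hlam : ∀ t ∈ Icc 0 T, 0 < lam t) (hν : Integrable (fun x : ℝ => x) ν)
    (hV : IsValueFamily T C lam (meanShortage ν) n y) (hA : ∀ k i, MeasurableSet (A k i))
    (s : ℝ) {s' : ℝ} (hs' : s' ∈ Icc 0 T) :
    Integrable (fun ω => ∑ i ∈ Finset.range (X ω).num, arrives s s' (X ω) i *
      advantage n A (fun k => y k s') (X ω) i) P := by
  refine h.integrable_sum_num hlam hν hV.nonneg (f := fun i r => arrives s s' r i *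
    advantage n A (fun k => y k s') r i) (fun i => ?_) (fun i r => ?_)
    Realisation.measurable_num fun _ => le_rfl
  · exact (measurable_arrives s s' i).mul (measurable_advantage hA _ i)
  · exact (abs_arrives_mul_le _ _ _ _ _).trans (abs_advantage_le A hV.nonneg
      (fun k hk hkn => hV.abs_le k hk hkn s' hs') r i)

theorem IsJobProcess.integrable_gain (h : IsJobProcess P T lam ν X)
    (hlam : ∀ t ∈ Icc 0 T, 0 < lam t) (hν : Integrable (fun x : ℝ => x) ν)
    (hA : ∀ k i, MeasurableSet (A k i)) (s : ℝ) :
    Integrable (fun ω => ∑ i ∈ Finset.range ((X ω).count (Iio s)), gain n A (X ω) i) P :=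
  h.integrable_sum_num hlam hν le_rfl (f := fun i r => gain n A r i) (fun i => measurable_gain hA i)
    (fun i r => by simpa using abs_gain_le n A r i)
    (Realisation.measurable_count measurableSet_Iio) fun r => r.count_le_num _

/-- Over a short time, the expected advantage of the best decisions balances the decay of the
value of the free workers. -/
theorem IsJobProcess.abs_bestAdvantage_add_drift_le (h : IsJobProcess P T lam ν X)
    (hgood : ∀ ω, (X ω).Good T) (hlam : ∀ t ∈ Icc 0 T, 0 < lam t)
    (hν : Integrable (fun x : ℝ => x) ν)
    (hV : IsValueFamily T C lam (meanShortage ν) n y) (hA : ∀ k i, MeasurableSet (A k i))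
    {s s' : ℝ} (hs : 0 ≤ s) (hss' : s ≤ s') (hs' : s' ≤ T) :
    |∫ ω, ∑ i ∈ Finset.range (X ω).num, arrives s s' (X ω) i *
        bestAdvantage (fun k => y k s') (workersLeft n A (X ω) i) ((X ω).value i) ∂P +
      ∫ ω, (curveValue y (workersLeft n A (X ω) ((X ω).count (Iio s))) s' -
        curveValue y (workersLeft n A (X ω) ((X ω).count (Iio s))) s) ∂P|
      ≤ (C + C ^ 3) * (s' - s) ^ 2 := by
  have hC := hV.nonneg
  have hs'T : s' ∈ Icc 0 T := ⟨hs.trans hss', hs'⟩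
  have hBT : Ico s s' ⊆ Icc 0 T := fun t ht => ⟨hs.trans ht.1, ht.2.le.trans hs'⟩
  set L := ∫ t in Ico s s', lam t with hL
  have hL0 : 0 ≤ L := setIntegral_nonneg measurableSet_Ico fun t ht => (hlam t (hBT ht)).le
  set ψ : ℕ → ℝ := fun k => if k = 0 then 0 else meanShortage ν (y k s') with hψ
  have hψm : ∀ k ≤ n, ψ k ∈ Icc 0 C := by
    intro k hk
    simp only [hψ]
    split_ifs with h0
    · exact ⟨le_rfl, hC⟩
    · exact hV.shortage_mem k (Nat.pos_of_ne_zero h0) hk s' hs'T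
  have hI1 := h.integrable_bestAdvantage hlam hν hV hA s hs'T
  have hI2 : Integrable (fun ω => ∑ i ∈ Finset.range (X ω).num, arrives s s' (X ω) i *
      ψ (workersLeft n A (X ω) i)) P := by
    refine h.integrable_sum_num hlam hν hC (f := fun i r => arrives s s' r i *
      ψ (workersLeft n A r i)) (fun i => ?_) (fun i r => ?_)
      Realisation.measurable_num fun _ => le_rfl
    · exact (measurable_arrives s s' i).mul ((measurable_from_nat (f := ψ)).comp (measurable_workersLeft hA i))
    · have h1 := hψm _ (workersLeft_le (n := n) (A := A) r i)
      refine (abs_arrives_mul_le _ _ _ _ _).trans ?_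
      rw [abs_of_nonneg h1.1]
      linarith [h1.2, abs_nonneg (r.value i)]
  -- The value of a job is averaged out, being independent of its arrival time and of the number of
  -- free workers it meets.
  have hS : ∫ ω, ∑ i ∈ Finset.range (X ω).num, arrives s s' (X ω) i *
        bestAdvantage (fun k => y k s') (workersLeft n A (X ω) i) ((X ω).value i) ∂P =
      ∫ ω, ∑ i ∈ Finset.range (X ω).num, arrives s s' (X ω) i * ψ (workersLeft n A (X ω) i) ∂P := by
    rw [← sub_eq_zero, ← integral_sub hI1 hI2]
    have h1 := h.integral_sum_value_sub_eq_zero hlam n hA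
      (f := bestAdvantage fun k => y k s') (measurable_bestAdvantage _)
      (SeqAlloc.integrable_bestAdvantage hν _) (g := fun x => |x| + C + C) (by fun_prop)
      ((hν.abs.add (integrable_const C)).add (integrable_const C)) (fun k hk x => ?_) s s'
    · simp only [integral_bestAdvantage] at h1
      rw [← h1]
      refine integral_congr_ae (.of_forall fun ω => ?_)
      simp only
      rw [← Finset.sum_sub_distrib]
      refine Finset.sum_congr rfl fun i _ => ?_
      rw [← mul_sub]
      rfl
    · rw [integral_bestAdvantage]
      have h2 := hψm k hk
      refine (abs_sub _ _).trans (add_le_add (abs_bestAdvantage_le hC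
        (fun h0 => hV.abs_le k h0 hk s' hs'T) x) ?_)
      change |ψ k| ≤ C
      rw [abs_of_nonneg h2.1]
      exact h2.2
  set K : Ω → ℕ := fun ω => workersLeft n A (X ω) ((X ω).count (Iio s)) with hK
  have hKi : ∀ g : ℕ → ℝ, Integrable (fun ω => g (K ω)) P := h.integrable_comp_workersLeft hA s
  have hci := h.integrable_count measurableSet_Ico hBT
  have hind : IndepFun (fun ω => ((X ω).count (Ico s s') : ℝ)) (fun ω => ψ (K ω)) P :=
    (h.indepFun_count_workersLeft hgood hs hss' hs' n hA).comp (φ := fun c : ℕ => (c : ℝ))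
      (ψ := ψ) measurable_from_nat measurable_from_nat
  have hprod : ∫ ω, ((X ω).count (Ico s s') : ℝ) * ψ (K ω) ∂P = L * ∫ ω, ψ (K ω) ∂P := by
    rw [hind.integral_fun_mul_eq_mul_integral hci.aestronglyMeasurable (hKi ψ).aestronglyMeasurable,
      h.integral_count measurableSet_Ico hBT hlam]
  have hprodi : Integrable (fun ω => ((X ω).count (Ico s s') : ℝ) * ψ (K ω)) P :=
    hind.integrable_mul hci (hKi ψ)
  obtain ⟨hei, hel⟩ := h.integral_count_sub_one_le hlam measurableSet_Ico hBT
  -- The number of free workers is frozen at its value at `s`. Only jobs after the first one in `[s,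
  -- s')` can meet another number, and their expected number is of second order.
  have hE2 : |∫ ω, ∑ i ∈ Finset.range (X ω).num, arrives s s' (X ω) i *
      ψ (workersLeft n A (X ω) i) ∂P - L * ∫ ω, ψ (K ω) ∂P| ≤ C * L ^ 2 := by
    rw [← hprod, ← integral_sub hI2 hprodi]
    refine (abs_integral_le_integral_abs).trans ?_
    refine (integral_mono (hI2.sub hprodi).abs (hei.const_mul C) fun ω => ?_).trans ?_
    · have hc : (X ω).count (Ico s s') = (X ω).count (Iio s') - (X ω).count (Iio s) := by
        have := (X ω).count_Iio_add hss'
        omega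
      have hle : (X ω).count (Iio s) ≤ (X ω).count (Iio s') := by
        have := (X ω).count_Iio_add hss'
        omega
      simp only [Pi.sub_apply]
      rw [(hgood ω).sum_arrives, hc]
      refine abs_sum_Ico_sub_le (g := fun i => ψ (workersLeft n A (X ω) i)) hle fun i => ?_
      have h1 := hψm _ (workersLeft_le (n := n) (A := A) (X ω) i)
      have h2 := hψm _ (workersLeft_le (n := n) (A := A) (X ω) ((X ω).count (Iio s)))
      rw [abs_le]
      constructor <;> linarith [h1.1, h1.2, h2.1, h2.2]
    · rw [integral_const_mul]
      exact mul_le_mul_of_nonneg_left hel hC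
  have hE4 : |∫ ω, (curveValue y (K ω) s' - curveValue y (K ω) s) ∂P + L * ∫ ω, ψ (K ω) ∂P|
      ≤ C * (s' - s) ^ 2 := by
    have hVi : Integrable (fun ω => curveValue y (K ω) s' - curveValue y (K ω) s) P :=
      hKi fun k => curveValue y k s' - curveValue y k s
    rw [← integral_const_mul, ← integral_add hVi ((hKi ψ).const_mul L)]
    refine abs_integral_le_integral_abs.trans ?_
    refine (integral_mono (hVi.add ((hKi ψ).const_mul L)).abs
      (integrable_const (C * (s' - s) ^ 2)) fun ω => ?_).trans (by simp)
    exact hV.drift _ (workersLeft_le _ _) s s' hs hss' hs'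
  have hLC : C * L ^ 2 ≤ C ^ 3 * (s' - s) ^ 2 := by
    have h1 : L ^ 2 ≤ (C * (s' - s)) ^ 2 := pow_le_pow_left₀ hL0 (hV.rate_le s s' hs hss' hs') 2
    calc C * L ^ 2 ≤ C * (C * (s' - s)) ^ 2 := mul_le_mul_of_nonneg_left h1 hC
      _ = C ^ 3 * (s' - s) ^ 2 := by ring
  rw [hS]
  rw [abs_le] at hE2 hE4 ⊢
  constructor <;> linarith [hE2.1, hE2.2, hE4.1, hE4.2]

/-- The identity holds path by path: acceptances are settled with the curves at `s'`, and what
remains is the ageing of the workers free at `s`. -/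
theorem IsJobProcess.expectedWorth_sub (h : IsJobProcess P T lam ν X)
    (hgood : ∀ ω, (X ω).Good T) (hlam : ∀ t ∈ Icc 0 T, 0 < lam t)
    (hν : Integrable (fun x : ℝ => x) ν)
    (hV : IsValueFamily T C lam (meanShortage ν) n y) (hA : ∀ k i, MeasurableSet (A k i))
    {s s' : ℝ} (hs : 0 ≤ s) (hss' : s ≤ s') (hs' : s' ≤ T) :
    expectedWorth P X n A y s' - expectedWorth P X n A y s =
      ∫ ω, ∑ i ∈ Finset.range (X ω).num, arrives s s' (X ω) i *
        advantage n A (fun k => y k s') (X ω) i ∂P +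
      ∫ ω, (curveValue y (workersLeft n A (X ω) ((X ω).count (Iio s))) s' -
        curveValue y (workersLeft n A (X ω) ((X ω).count (Iio s))) s) ∂P := by
  have hW : ∀ u, Integrable (fun ω => ∑ i ∈ Finset.range ((X ω).count (Iio u)), gain n A (X ω) i +
      curveValue y (workersLeft n A (X ω) ((X ω).count (Iio u))) u) P := fun u =>
    (h.integrable_gain hlam hν hA u).add
      (h.integrable_comp_workersLeft hA u fun k => curveValue y k u)
  rw [expectedWorth, expectedWorth, ← integral_sub (hW s') (hW s), ← integral_add
    (h.integrable_advantage hlam hν hV hA s ⟨hs.trans hss', hs'⟩)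
    (h.integrable_comp_workersLeft hA s fun k => curveValue y k s' - curveValue y k s)]
  refine integral_congr_ae (.of_forall fun ω => ?_)
  have hle : (X ω).count (Iio s) ≤ (X ω).count (Iio s') := by
    have := (X ω).count_Iio_add hss'
    omega
  have h1 := curveValue_workersLeft_sub n A y (X ω) s' hle
  have h2 := Finset.sum_range_add_sum_Ico (fun i => gain n A (X ω) i) hle
  simp only
  rw [(hgood ω).sum_arrives]
  rw [Finset.sum_sub_distrib] at h1
  linarith

theorem IsJobProcess.expectedWorth_sub_le (h : IsJobProcess P T lam ν X)
    (hgood : ∀ ω, (X ω).Good T) (hlam : ∀ t ∈ Icc 0 T, 0 < lam t)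
    (hν : Integrable (fun x : ℝ => x) ν)
    (hV : IsValueFamily T C lam (meanShortage ν) n y) (hA : ∀ k i, MeasurableSet (A k i))
    {s s' : ℝ} (hs : 0 ≤ s) (hss' : s ≤ s') (hs' : s' ≤ T) :
    expectedWorth P X n A y s' - expectedWorth P X n A y s ≤ (C + C ^ 3) * (s' - s) ^ 2 := by
  have hs'T : s' ∈ Icc 0 T := ⟨hs.trans hss', hs'⟩
  rw [h.expectedWorth_sub hgood hlam hν hV hA hs hss' hs']
  have h1 := (abs_le.1 (h.abs_bestAdvantage_add_drift_le hgood hlam hν hV hA hs hss' hs')).2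
  have h2 := integral_mono (h.integrable_advantage hlam hν hV hA s hs'T)
    (h.integrable_bestAdvantage hlam hν hV hA s hs'T) fun ω => Finset.sum_le_sum fun i _ =>
      mul_le_mul_of_nonneg_left (advantage_le_bestAdvantage n A (fun k => y k s') (X ω) i)
        (arrives_nonneg s s' (X ω) i)
  linarith

/-- Each job costs at most `η + C (s' - s)` against the best decision. The expected number of jobs
is at most `C (s' - s)`, so the second part contributes the extra `C ^ 2`. -/
theorem IsJobProcess.le_expectedWorth_sub (h : IsJobProcess P T lam ν X)
    (hgood : ∀ ω, (X ω).Good T) (hlam : ∀ t ∈ Icc 0 T, 0 < lam t)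
    (hν : Integrable (fun x : ℝ => x) ν)
    (hV : IsValueFamily T C lam (meanShortage ν) n y) (hA : ∀ k i, MeasurableSet (A k i))
    {η : ℝ} (hη : 0 ≤ η) (hAη : IsNearOptimal T η n y A)
    {s s' : ℝ} (hs : 0 ≤ s) (hss' : s ≤ s') (hs' : s' ≤ T) :
    -((C + C ^ 3 + C ^ 2) * (s' - s) ^ 2) - η * ∫ t in Ico s s', lam t ≤
      expectedWorth P X n A y s' - expectedWorth P X n A y s := by
  have hs'T : s' ∈ Icc 0 T := ⟨hs.trans hss', hs'⟩
  have hBT : Ico s s' ⊆ Icc 0 T := fun t ht => ⟨hs.trans ht.1, ht.2.le.trans hs'⟩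
  have hci := h.integrable_count measurableSet_Ico hBT
  have hbi := h.integrable_bestAdvantage hlam hν hV hA s hs'T
  rw [h.expectedWorth_sub hgood hlam hν hV hA hs hss' hs']
  have h1 := (abs_le.1 (h.abs_bestAdvantage_add_drift_le hgood hlam hν hV hA hs hss' hs')).1
  have h2 := integral_mono (hbi.sub (hci.const_mul (η + C * (s' - s))))
    (h.integrable_advantage hlam hν hV hA s hs'T) fun ω => ?_
  · simp only [Pi.sub_apply] at h2
    rw [integral_sub hbi (hci.const_mul _), integral_const_mul,
      h.integral_count measurableSet_Ico hBT hlam] at h2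
    have h3 := mul_le_mul_of_nonneg_left (hV.rate_le s s' hs hss' hs')
      (mul_nonneg hV.nonneg (sub_nonneg.2 hss'))
    linarith
  · classical
    simp only [Pi.sub_apply]
    have hc : ((X ω).count (Ico s s') : ℝ) =
        ∑ i ∈ Finset.range (X ω).num, arrives s s' (X ω) i := by
      rw [Realisation.count_eq_sum]
      refine Finset.sum_congr rfl fun i hi => ?_
      simp [arrives, Finset.mem_range.1 hi]
    rw [hc, Finset.mul_sum, ← Finset.sum_sub_distrib]
    refine Finset.sum_le_sum fun i _ => ?_
    rw [mul_comm (η + C * (s' - s)), ← mul_sub]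
    unfold arrives
    split_ifs with hi
    · rw [one_mul, one_mul]
      exact hAη.le_advantage hη hV hs hss' hs' hi.2
    · simp

/-- No decision rule has an expected reward larger than the initial value of the workers. -/
theorem IsJobProcess.expectedReward_le (h : IsJobProcess P T lam ν X) (hT : 0 ≤ T)
    (hgood : ∀ ω, (X ω).Good T) (hlam : ∀ t ∈ Icc 0 T, 0 < lam t)
    (hν : Integrable (fun x : ℝ => x) ν)
    (hV : IsValueFamily T C lam (meanShortage ν) n y) (hA : ∀ k i, MeasurableSet (A k i)) :
    expectedReward P X n A ≤ curveValue y n 0 := by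
  rw [← expectedWorth_horizon hgood hV, ← expectedWorth_zero (P := P) hgood]
  exact le_of_sub_le_sq hT fun s s' hs hss' hs' =>
    h.expectedWorth_sub_le hgood hlam hν hV hA hs hss' hs'

/-- A nearly optimal rule nearly attains the initial value of the workers. -/
theorem IsJobProcess.le_expectedReward (h : IsJobProcess P T lam ν X) (hT : 0 ≤ T)
    (hgood : ∀ ω, (X ω).Good T) (hlamc : IntegrableOn lam (Icc 0 T))
    (hlam : ∀ t ∈ Icc 0 T, 0 < lam t) (hν : Integrable (fun x : ℝ => x) ν)
    (hV : IsValueFamily T C lam (meanShortage ν) n y) (hA : ∀ k i, MeasurableSet (A k i))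
    {η : ℝ} (hη : 0 ≤ η) (hAη : IsNearOptimal T η n y A) :
    curveValue y n 0 - η * ∫ t in Ico 0 T, lam t ≤ expectedReward P X n A := by
  rw [← expectedWorth_horizon hgood hV, ← expectedWorth_zero (P := P) hgood]
  -- The first-order loss `η ∫ lam` is additive in time, so it is included in `U`, leaving only
  -- quadratic errors.
  have key := le_of_sub_le_sq (C := C + C ^ 3 + C ^ 2)
    (U := fun s => -expectedWorth P X n A y s - η * ∫ t in Ico 0 s, lam t) hT
    fun s s' hs hss' hs' => ?_
  · simp only [Ico_self, Measure.restrict_empty, integral_zero_measure, mul_zero, sub_zero] at key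
    linarith
  · have h1 := h.le_expectedWorth_sub hgood hlam hν hV hA hη hAη hs hss' hs'
    have hsub : ∀ a b, 0 ≤ a → b ≤ T → Ico a b ⊆ Icc 0 T := fun a b ha hb t ht =>
      ⟨ha.trans ht.1, ht.2.le.trans hb⟩
    have h2 : ∫ t in Ico 0 s', lam t = (∫ t in Ico 0 s, lam t) + ∫ t in Ico s s', lam t := by
      rw [← setIntegral_union (Ico_disjoint_Ico_same) measurableSet_Ico
        (hlamc.mono_set (hsub _ _ le_rfl (hss'.trans hs'))) (hlamc.mono_set (hsub _ _ hs hs')),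
        Ico_union_Ico_eq_Ico hs hss']
    simp only [h2]
    linarith

end Arrivals

/-! ### The critical curves of the true process -/

theorem isShortage_meanShortage {ν : Measure ℝ} [IsProbabilityMeasure ν]
    (hν : Integrable (fun x : ℝ => x) ν) : IsShortage (meanShortage ν) where
  nonneg y := integral_nonneg fun x => le_max_right _ _
  antitone x y hxy := integral_mono (integrable_max_sub_zero hν y) (integrable_max_sub_zero hν x)
    fun v => max_le_max_right 0 (by linarith)
  abs_sub_le x y := by
    rw [meanShortage, meanShortage, ← integral_sub (integrable_max_sub_zero hν x)
      (integrable_max_sub_zero hν y)]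
    refine abs_integral_le_integral_abs.trans ?_
    refine (integral_mono ((integrable_max_sub_zero hν x).sub (integrable_max_sub_zero hν y)).abs
      (integrable_const |x - y|) fun v => abs_max_sub_zero_sub_le v x y).trans (by simp)

/-- A nonnegative value with a density is almost surely positive. This is what makes the optimal
reward positive. -/
theorem meanShortage_zero_pos {ν : Measure ℝ} [IsProbabilityMeasure ν]
    (hν : Integrable (fun x : ℝ => x) ν) (hν0 : ν (Iio 0) = 0) (hνd : ν ≪ volume) :
    0 < meanShortage ν 0 := by
  rw [meanShortage, integral_pos_iff_support_of_nonneg (f := fun x => max (x - 0) 0)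
    (fun x => le_max_right _ _)
    (integrable_max_sub_zero hν 0)]
  have h1 : Function.support (fun x : ℝ => max (x - 0) 0) = Ioi 0 := by
    ext x
    simp
  have h2 : ν (Iic 0) = 0 := by
    rw [← Iio_union_right]
    exact measure_union_null hν0 (hνd (by simp))
  have h3 : ν (Ioi 0) = 1 := by
    rw [← compl_Iic]
    exact (prob_compl_eq_one_iff measurableSet_Iic).2 h2
  rw [h1, h3]
  exact one_pos

/-- The expected number of jobs that arrive after `t`. -/
def remaining (T : ℝ) (lam : ℝ → ℝ) (t : ℝ) : ℝ := ∫ u in t..T, lam u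

theorem hasDerivAt_remaining {lam : ℝ → ℝ} (hlam : Continuous lam) (T t : ℝ) :
    HasDerivAt (remaining T lam) (-lam t) t :=
  intervalIntegral.integral_hasDerivAt_left (hlam.intervalIntegrable _ _)
    (hlam.stronglyMeasurableAtFilter _ _) hlam.continuousAt

theorem isRemaining_remaining {lam : ℝ → ℝ} (hlam : Continuous lam) {T : ℝ}
    (hlam0 : ∀ t ∈ Icc 0 T, 0 < lam t) : IsRemaining T lam (remaining T lam) where
  continuousOn := fun _ _ => (hasDerivAt_remaining hlam T _).continuousAt.continuousWithinAt
  nonneg _ ht := intervalIntegral.integral_nonneg ht.2 fun u hu =>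
    (hlam0 u ⟨ht.1.trans hu.1, hu.2⟩).le
  terminal := intervalIntegral.integral_same
  rate_nonneg t ht := (hlam0 t (Ioo_subset_Icc_self ht)).le
  deriv := ⟨∅, finite_empty, fun t _ => hasDerivAt_remaining hlam T t⟩

theorem remaining_sub {lam : ℝ → ℝ} (hlam : Continuous lam) (T : ℝ) {s s' : ℝ} (hss' : s ≤ s') :
    remaining T lam s - remaining T lam s' = ∫ t in Ico s s', lam t := by
  rw [integral_Ico_eq_integral_Ioc, ← intervalIntegral.integral_of_le hss', remaining, remaining,
    sub_eq_iff_eq_add, intervalIntegral.integral_add_adjacent_intervals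
      (hlam.intervalIntegrable _ _) (hlam.intervalIntegrable _ _)]

/-- The right-hand sides of the system telescope. -/
theorem IsOperational.hasDerivWithinAt_curveValue {phi : ℝ → ℝ} {S : ℝ} {n : ℕ} {z : ℕ → ℝ → ℝ}
    (hz : IsOperational phi S n z) {s : ℝ} (hs : s ∈ Icc 0 S) (k : ℕ) (hk : k ≤ n) :
    HasDerivWithinAt (curveValue z k) (if k = 0 then 0 else phi (z k s)) (Icc 0 S) s := by
  induction k with
  | zero =>
    have : curveValue z 0 = fun _ => 0 := by
      funext t
      simp [curveValue]
    rw [this]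
    simpa using hasDerivWithinAt_const s (Icc 0 S) (0 : ℝ)
  | succ k ih =>
    have h1 := (ih (by omega)).add ((hz k (by omega)).2 s hs)
    have h2 : curveValue z (k + 1) = curveValue z k + z (k + 1) := by
      funext t
      simp [curveValue, Finset.sum_range_succ]
    rw [h2]
    rw [add_sub_cancel] at h1
    rwa [if_neg (Nat.succ_ne_zero k)]

/-- The total value increases from `0`. Were it `0` at `s`, it would vanish on `[0, s]`, although
its derivative at `0` is `phi 0 > 0`. -/
theorem IsOperational.curveValue_pos {phi : ℝ → ℝ} (hphi : IsShortage phi) (h0 : 0 < phi 0)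
    {S : ℝ} {n : ℕ} (hn : 0 < n) {z : ℕ → ℝ → ℝ} (hz : IsOperational phi S n z) {s : ℝ}
    (hs : 0 < s) (hsS : s ≤ S) : 0 < curveValue z n s := by
  have hd : ∀ t ∈ Icc 0 S, HasDerivWithinAt (curveValue z n) (phi (z n t)) (Icc 0 S) t := by
    intro t ht
    simpa [hn.ne'] using hz.hasDerivWithinAt_curveValue ht n le_rfl
  have hc : ContinuousOn (curveValue z n) (Icc 0 S) := fun t ht => (hd t ht).continuousWithinAt
  have hmono : ∀ a b, 0 ≤ a → a ≤ b → b ≤ S → curveValue z n a ≤ curveValue z n b := by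
    intro a b ha hab hb
    refine le_of_hasDerivAt_nonneg_off_finite (f' := fun t => phi (z n t)) finite_empty hab
      (hc.mono (Icc_subset_Icc ha hb)) (fun t ht => ?_) fun t _ => hphi.nonneg _
    have h1 : 0 < t := ha.trans_lt ht.1.1
    have h2 : t < S := ht.1.2.trans_le hb
    exact (hd t ⟨h1.le, h2.le⟩).hasDerivAt (Icc_mem_nhds h1 h2)
  have hz0 : ∀ j < n, z (j + 1) 0 = 0 := fun j hj => (hz j hj).1
  have hV0 : curveValue z n 0 = 0 :=
    Finset.sum_eq_zero fun j hj => hz0 j (Finset.mem_range.1 hj)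
  have hzn : z n 0 = 0 := by
    obtain ⟨m, rfl⟩ := Nat.exists_eq_succ_of_ne_zero hn.ne'
    exact hz0 m (Nat.lt_succ_self m)
  by_contra hcon
  have hzero : ∀ t ∈ Icc 0 s, curveValue z n t = 0 := fun t ht => le_antisymm
    ((hmono t s ht.1 ht.2 hsS).trans (not_lt.1 hcon))
    (hV0 ▸ hmono 0 t le_rfl ht.1 (ht.2.trans hsS))
  have h1 := (hd 0 ⟨le_rfl, hs.le.trans hsS⟩).mono (Icc_subset_Icc_right hsS)
  have h2 : HasDerivWithinAt (curveValue z n) 0 (Icc 0 s) 0 :=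
    (hasDerivWithinAt_const (0 : ℝ) (Icc 0 s) (0 : ℝ)).congr hzero
      (hzero 0 ⟨le_rfl, hs.le⟩)
  have h3 := (uniqueDiffOn_Icc hs 0 ⟨le_rfl, hs.le⟩).eq_deriv _ h1 h2
  rw [hzn] at h3
  exact h0.ne' h3

/-- Bounds for the solution of the system in operational time. -/
theorem IsOperational.exists_bounds {phi : ℝ → ℝ} (hphi : IsShortage phi) {S : ℝ} {n : ℕ}
    {z : ℕ → ℝ → ℝ} (hz : IsOperational phi S n z) :
    ∃ R Z : ℝ, 0 ≤ R ∧ 0 ≤ Z ∧ (∀ k, 0 < k → k ≤ n → ∀ s ∈ Icc 0 S, |z k s| ≤ R) ∧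
      (∀ k, 0 < k → k ≤ n → ∀ s ∈ Icc 0 S, phi (z k s) ∈ Icc 0 Z) ∧
      ∀ k, 0 < k → k ≤ n → ∀ s ∈ Icc 0 S, ∀ s' ∈ Icc 0 S, |z k s - z k s'| ≤ Z * |s - s'| := by
  have h1 : ∀ k, ∃ R, 0 ≤ R ∧ (k < n → ∀ s ∈ Icc 0 S, |z (k + 1) s| ≤ R) := by
    intro k
    by_cases hk : k < n
    · obtain ⟨R, hR⟩ := isCompact_Icc.exists_bound_of_continuousOn (hz.continuousOn hk)
      exact ⟨max R 0, le_max_right _ _, fun _ s hs => (hR s hs).trans (le_max_left _ _)⟩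
    · exact ⟨0, le_rfl, fun h => absurd h hk⟩
  choose R hR0 hR using h1
  set Q := ∑ k ∈ Finset.range n, R k
  have hQ : ∀ k, 0 < k → k ≤ n → ∀ s ∈ Icc 0 S, |z k s| ≤ Q := by
    intro k hk hkn s hs
    obtain ⟨m, rfl⟩ := Nat.exists_eq_succ_of_ne_zero hk.ne'
    exact (hR m hkn s hs).trans
      (Finset.single_le_sum (fun j _ => hR0 j) (Finset.mem_range.2 hkn))
  have hZ : ∀ k, 0 < k → k ≤ n → ∀ s ∈ Icc 0 S, phi (z k s) ∈ Icc 0 (phi (-Q)) :=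
    fun k hk hkn s hs => ⟨hphi.nonneg _, hphi.antitone (abs_le.1 (hQ k hk hkn s hs)).1⟩
  refine ⟨Q, phi (-Q), Finset.sum_nonneg fun k _ => hR0 k, hphi.nonneg _, hQ, hZ, ?_⟩
  intro k hk hkn s hs s' hs'
  obtain ⟨m, rfl⟩ := Nat.exists_eq_succ_of_ne_zero hk.ne'
  refine (convex_Icc 0 S).norm_image_sub_le_of_norm_hasDerivWithin_le
    (fun t ht => (hz m hkn).2 t ht) (fun t ht => ?_) hs' hs
  have h2 := hZ (m + 1) hk hkn t ht
  rw [Real.norm_eq_abs, abs_le]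
  split_ifs with h0
  · constructor <;> linarith [h2.1, h2.2]
  · have h3 := hZ m (Nat.pos_of_ne_zero h0) (by omega) t ht
    constructor <;> linarith [h2.1, h2.2, h3.1, h3.2]

theorem IsOperational.exists_isValueFamily {phi lam : ℝ → ℝ} (hphi : IsShortage phi) {S T : ℝ}
    {n : ℕ} {z : ℕ → ℝ → ℝ} (hz : IsOperational phi S n z)
    (hlam : Continuous lam) (hlam0 : ∀ t ∈ Icc 0 T, 0 < lam t)
    (hmem : ∀ t ∈ Icc 0 T, remaining T lam t ∈ Icc 0 S) :
    ∃ C, IsValueFamily T C lam phi n (fun k t => z k (remaining T lam t)) := by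
  obtain ⟨R, Z, hR0, hZ0, hR, hZ, hL⟩ := hz.exists_bounds hphi
  obtain ⟨B, hB⟩ := (isCompact_Icc (a := (0 : ℝ)) (b := T)).exists_bound_of_continuousOn
    hlam.continuousOn
  set B' := max B 0
  have hB0 : 0 ≤ B' := le_max_right _ _
  have hrate : ∀ s s', 0 ≤ s → s ≤ s' → s' ≤ T →
      0 ≤ ∫ t in Ico s s', lam t ∧ ∫ t in Ico s s', lam t ≤ B' * (s' - s) := by
    intro s s' hs hss' hs'
    have hsub : Ico s s' ⊆ Icc 0 T := fun t ht => ⟨hs.trans ht.1, ht.2.le.trans hs'⟩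
    refine ⟨setIntegral_nonneg measurableSet_Ico fun t ht => (hlam0 t (hsub ht)).le, ?_⟩
    have h1 : ∫ t in Ico s s', lam t ≤ ∫ t in Ico s s', B' :=
      setIntegral_mono_on ((hlam.integrableOn_Icc).mono_set Ico_subset_Icc_self)
        (integrableOn_const (by simp)) measurableSet_Ico fun t ht =>
          (le_abs_self _).trans ((hB t (hsub ht)).trans (le_max_left _ _))
    refine h1.trans_eq ?_
    simp [hss', mul_comm]
  refine ⟨R + Z + B' + Z * B' + Z * B' ^ 2, ?_⟩
  set C := R + Z + B' + Z * B' + Z * B' ^ 2 with hC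
  have p1 : 0 ≤ Z * B' := mul_nonneg hZ0 hB0
  have p2 : 0 ≤ Z * B' ^ 2 := mul_nonneg hZ0 (sq_nonneg _)
  have hC1 : R ≤ C ∧ Z ≤ C ∧ B' ≤ C ∧ Z * B' ≤ C ∧ Z * B' ^ 2 ≤ C := by
    refine ⟨?_, ?_, ?_, ?_, ?_⟩ <;> linarith
  have hrem : ∀ s s', 0 ≤ s → s ≤ s' → s' ≤ T →
      |remaining T lam s - remaining T lam s'| ≤ B' * (s' - s) := by
    intro s s' hs hss' hs'
    rw [remaining_sub hlam T hss', abs_of_nonneg (hrate s s' hs hss' hs').1]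
    exact (hrate s s' hs hss' hs').2
  refine ⟨by linarith, fun s s' hs hss' hs' => ?_, fun k hk hkn t ht => ?_,
    fun k hk hkn t ht => ?_, fun k hk hkn s s' hs hss' hs' => ?_, fun k hk hkn => ?_,
    fun k hkn s s' hs hss' hs' => ?_⟩
  · exact (hrate s s' hs hss' hs').2.trans
      (mul_le_mul_of_nonneg_right hC1.2.2.1 (sub_nonneg.2 hss'))
  · have h1 := hZ k hk hkn _ (hmem t ht)
    exact ⟨h1.1, h1.2.trans hC1.2.1⟩
  · exact (hR k hk hkn _ (hmem t ht)).trans hC1.1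
  · refine (hL k hk hkn _ (hmem s ⟨hs, hss'.trans hs'⟩) _ (hmem s' ⟨hs.trans hss', hs'⟩)).trans ?_
    refine (mul_le_mul_of_nonneg_left (hrem s s' hs hss' hs') hZ0).trans ?_
    rw [← mul_assoc]
    exact mul_le_mul_of_nonneg_right hC1.2.2.2.1 (sub_nonneg.2 hss')
  · obtain ⟨m, rfl⟩ := Nat.exists_eq_succ_of_ne_zero hk.ne'
    have : remaining T lam T = 0 := intervalIntegral.integral_same
    simp only [this]
    exact (hz m hkn).1
  · set a := remaining T lam s' with ha
    set b := remaining T lam s with hb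
    have hab : b - a = ∫ t in Ico s s', lam t := remaining_sub hlam T hss'
    have hle : a ≤ b := by linarith [(hrate s s' hs hss' hs').1]
    have haS : a ∈ Icc 0 S := hmem s' ⟨hs.trans hss', hs'⟩
    have hbS : b ∈ Icc 0 S := hmem s ⟨hs, hss'.trans hs'⟩
    set c : ℝ := if k = 0 then 0 else phi (z k a) with hc
    have hsub : Icc a b ⊆ Icc 0 S := Icc_subset_Icc haS.1 hbS.2
    -- On the operational interval the value is compared with the line of slope `c`. The slopes
    -- differ by at most `Z (b - a)`, as `phi` is 1-Lipschitz and the curves are `Z`-Lipschitz, so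
    -- the error is quadratic.
    have key := (convex_Icc a b).norm_image_sub_le_of_norm_hasDerivWithin_le
      (f := fun u => curveValue z k u - u * c)
      (f' := fun u => (if k = 0 then 0 else phi (z k u)) - 1 * c) (C := Z * (b - a))
      (fun u hu => ((hz.hasDerivWithinAt_curveValue (hsub hu) k hkn).mono hsub).sub
        ((hasDerivWithinAt_id u _).mul_const c)) (fun u hu => ?_)
      (left_mem_Icc.2 hle) (right_mem_Icc.2 hle)
    · have h1 : curveValue (fun k t => z k (remaining T lam t)) k s' = curveValue z k a := rfl
      have h2 : curveValue (fun k t => z k (remaining T lam t)) k s = curveValue z k b := rfl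
      rw [h1, h2, ← hab]
      have h3 : |curveValue z k a - curveValue z k b + (b - a) * c| ≤ Z * (b - a) * (b - a) := by
        rw [Real.norm_eq_abs, Real.norm_eq_abs, abs_of_nonneg (sub_nonneg.2 hle)] at key
        rw [← abs_neg]
        convert key using 2
        ring
      refine h3.trans ?_
      have h4 : (b - a) ^ 2 ≤ (B' * (s' - s)) ^ 2 := by
        refine pow_le_pow_left₀ (sub_nonneg.2 hle) ?_ 2
        rw [hab]
        exact (hrate s s' hs hss' hs').2
      calc Z * (b - a) * (b - a) = Z * (b - a) ^ 2 := by ring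
        _ ≤ Z * (B' * (s' - s)) ^ 2 := mul_le_mul_of_nonneg_left h4 hZ0
        _ = Z * B' ^ 2 * (s' - s) ^ 2 := by ring
        _ ≤ C * (s' - s) ^ 2 := mul_le_mul_of_nonneg_right hC1.2.2.2.2 (sq_nonneg _)
    · rw [Real.norm_eq_abs, one_mul, hc]
      split_ifs with h0
      · simpa using mul_nonneg hZ0 (sub_nonneg.2 hle)
      · refine (hphi.abs_sub_le _ _).trans ((hL k (Nat.pos_of_ne_zero h0) hkn u (hsub hu) a
          haS).trans (mul_le_mul_of_nonneg_left ?_ hZ0))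
        rw [abs_of_nonneg (sub_nonneg.2 hu.1)]
        linarith [hu.2]

/-! ### Consistency of the estimators -/

/-- Monotone functions that converge at all rational points to a continuous function converge
locally uniformly. -/
theorem tendstoLocallyUniformly_of_monotone {F : ℕ → ℝ → ℝ} {f : ℝ → ℝ} (hF : ∀ m, Monotone (F m))
    (hf : Continuous f) (h : ∀ q : ℚ, Tendsto (fun m => F m q) atTop (𝓝 (f q))) :
    TendstoLocallyUniformly F f atTop := by
  rw [Metric.tendstoLocallyUniformly_iff]
  intro ε hε x
  have hε3 : 0 < ε / 4 := by linarith
  obtain ⟨d, hd, hfd⟩ := Metric.continuousAt_iff.1 (hf.continuousAt (x := x)) (ε / 4) hε3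
  obtain ⟨p, hp1, hp2⟩ := exists_rat_btwn (show x - d < x by linarith)
  obtain ⟨q, hq1, hq2⟩ := exists_rat_btwn (show x < x + d by linarith)
  have hball : ∀ u ∈ Icc (p : ℝ) q, |f u - f x| < ε / 4 := by
    intro u hu
    refine hfd ?_
    rw [Real.dist_eq, abs_lt]
    constructor <;> linarith [hu.1, hu.2]
  have hpq : (p : ℝ) ≤ q := (hp2.trans hq1).le
  refine ⟨Icc p q, Icc_mem_nhds hp2 hq1, ?_⟩
  filter_upwards [Metric.tendsto_nhds.1 (h p) _ hε3, Metric.tendsto_nhds.1 (h q) _ hε3]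
    with m hmp hmq u hu
  have h1 := abs_lt.1 (hball p ⟨le_rfl, hpq⟩)
  have h2 := abs_lt.1 (hball q ⟨hpq, le_rfl⟩)
  have h3 := abs_lt.1 (hball u hu)
  have h4 := hF m hu.1
  have h5 := hF m hu.2
  rw [Real.dist_eq, abs_lt] at *
  constructor <;> linarith [h1.1, h1.2, h2.1, h2.2, h3.1, h3.2, hmp.1, hmp.2, hmq.1, hmq.2]

theorem eventually_abs_sub_le_of_tendstoLocallyUniformly {F : ℕ → ℝ → ℝ} {f : ℝ → ℝ}
    (h : TendstoLocallyUniformly F f atTop) (a b : ℝ) {ε : ℝ} (hε : 0 < ε) :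
    ∀ᶠ m in atTop, ∀ x ∈ Icc a b, |F m x - f x| ≤ ε := by
  have h1 := tendstoLocallyUniformlyOn_iff_tendstoUniformlyOn_of_compact
    (isCompact_Icc (a := a) (b := b)) |>.1 h.tendstoLocallyUniformlyOn
  filter_upwards [Metric.tendstoUniformlyOn_iff.1 h1 ε hε] with m hm x hx
  have := hm x hx
  rw [dist_comm, Real.dist_eq] at this
  exact this.le

/-- The expected number of jobs before `u`. -/
def cumulative (T : ℝ) (lam : ℝ → ℝ) (u : ℝ) : ℝ := ∫ t in Iio u ∩ Icc 0 T, lam t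

theorem cumulative_eq {T : ℝ} (hT : 0 ≤ T) (lam : ℝ → ℝ) (u : ℝ) :
    cumulative T lam u = ∫ t in (0 : ℝ)..(max 0 (min u T)), lam t := by
  rw [intervalIntegral.integral_of_le (le_max_left _ _), ← integral_Ico_eq_integral_Ioc, cumulative]
  rcases le_total u T with h | h
  · have h1 : Iio u ∩ Icc 0 T = Ico 0 (max 0 (min u T)) := by
      ext t
      simp only [mem_inter_iff, mem_Iio, mem_Icc, mem_Ico, lt_max_iff, lt_min_iff]
      constructor
      · rintro ⟨h2, h3, h4⟩
        exact ⟨h3, Or.inr ⟨h2, h2.trans_le h⟩⟩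
      · rintro ⟨h2, h3 | h3⟩
        · exact absurd h3 (not_lt.2 h2)
        · exact ⟨h3.1, h2, h3.2.le⟩
    rw [h1]
  · rw [min_eq_right h, max_eq_right hT]
    refine setIntegral_congr_set ?_
    have h1 : (Iio u ∩ Icc 0 T : Set ℝ) =ᵐ[volume] (Iic u ∩ Icc 0 T : Set ℝ) :=
      ae_eq_set_inter Iio_ae_eq_Iic (ae_eq_refl _)
    refine h1.trans ?_
    rw [inter_eq_right.2 fun t ht => ht.2.trans h]
    exact Ico_ae_eq_Icc.symm

theorem continuous_cumulative {T : ℝ} (hT : 0 ≤ T) {lam : ℝ → ℝ} (hlam : Continuous lam) :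
    Continuous (cumulative T lam) := by
  have h1 : cumulative T lam = fun u => ∫ t in (0 : ℝ)..(max 0 (min u T)), lam t :=
    funext fun u => cumulative_eq hT lam u
  rw [h1]
  exact (intervalIntegral.continuous_primitive (fun a b => hlam.intervalIntegrable a b) 0).comp
    (by fun_prop)

theorem cumulative_sub {T : ℝ} {lam : ℝ → ℝ} (hlam : Continuous lam) {t : ℝ} (ht : t ∈ Icc 0 T) :
    cumulative T lam T - cumulative T lam t = remaining T lam t := by
  have hT : 0 ≤ T := ht.1.trans ht.2
  rw [cumulative_eq hT, cumulative_eq hT, min_self, max_eq_right hT, min_eq_left ht.2,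
    max_eq_right ht.1, remaining, sub_eq_iff_eq_add', intervalIntegral.integral_add_adjacent_intervals
      (hlam.intervalIntegrable _ _) (hlam.intervalIntegrable _ _)]

section Arrivals

variable {Ω : Type*} [MeasurableSpace Ω] {P : Measure Ω} {T : ℝ}
  {lam : ℝ → ℝ} {ν : Measure ℝ} {X : ℕ → Ω → Realisation}

theorem strongLaw_count (hX : ∀ m, IsJobProcess P T lam ν (X m)) (hXi : iIndepFun X P)
    (hlam : ∀ t ∈ Icc 0 T, 0 < lam t) (u : ℝ) :
    ∀ᵐ ω ∂P, Tendsto (fun M => empiricalCum M (fun m => X m ω) u) atTop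
      (𝓝 (cumulative T lam u)) := by
  have hB : MeasurableSet (Iio u ∩ Icc 0 T) := measurableSet_Iio.inter measurableSet_Icc
  have hBT : Iio u ∩ Icc 0 T ⊆ Icc 0 T := inter_subset_right
  have hcm : Measurable fun r : Realisation => (r.count (Iio u ∩ Icc 0 T) : ℝ) :=
    measurable_from_nat.comp (Realisation.measurable_count hB)
  have h1 := strong_law_ae_real (fun m ω => ((X m ω).count (Iio u ∩ Icc 0 T) : ℝ))
    ((hX 0).integrable_count hB hBT)
    (fun i j hij => (hXi.indepFun hij).comp hcm hcm) fun m => by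
      have h2 : IdentDistrib (fun ω => (X m ω).count (Iio u ∩ Icc 0 T))
          (fun ω => (X 0 ω).count (Iio u ∩ Icc 0 T)) P P :=
        ⟨((hX m).measurable_count hB).aemeasurable, ((hX 0).measurable_count hB).aemeasurable, by
          rw [(hX m).count_law _ hB hBT, (hX 0).count_law _ hB hBT]⟩
      exact h2.comp (u := fun c : ℕ => (c : ℝ)) measurable_from_nat
  rw [(hX 0).integral_count hB hBT hlam] at h1
  filter_upwards [h1, ae_all_iff.2 fun m => (hX m).time_mem] with ω h3 h4
  refine h3.congr fun M => ?_
  rw [empiricalCum]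
  congr 1
  refine Finset.sum_congr rfl fun m _ => ?_
  congr 1
  exact Realisation.count_congr _ fun i hi => ⟨fun h => h.1, fun h => ⟨h, h4 m i hi⟩⟩

variable [IsProbabilityMeasure P]

theorem strongLaw_sum [IsProbabilityMeasure ν] (hX : ∀ m, IsJobProcess P T lam ν (X m))
    (hXi : iIndepFun X P) (hlam : ∀ t ∈ Icc 0 T, 0 < lam t) {g : ℝ → ℝ} (hgm : Measurable g)
    (hg : Integrable g ν) :
    ∀ᵐ ω ∂P, Tendsto (fun M : ℕ => (∑ m ∈ Finset.range M,
      ∑ i ∈ Finset.range (X m ω).num, g ((X m ω).value i)) / M) atTop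
      (𝓝 ((∫ t in Icc 0 T, lam t) * ∫ x, g x ∂ν)) := by
  have hsm : Measurable fun r : Realisation => ∑ i ∈ Finset.range r.num, g (r.value i) :=
    Realisation.measurable_sum_num (fun i => hgm.comp (Realisation.measurable_value i))
      Realisation.measurable_num
  have hw := (hX 0).wald hlam hgm hg
  have h1 := strong_law_ae_real
    (fun m ω => ∑ i ∈ Finset.range (X m ω).num, g ((X m ω).value i)) hw.1
    (fun i j hij => (hXi.indepFun hij).comp hsm hsm) fun m => by
      have hmm : ∀ m, Measurable fun ω => ((X m ω).num, (X m ω).value) := fun m =>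
        (Realisation.measurable_num.comp (hX m).measurable).prodMk
          (measurable_pi_lambda _ (hX m).measurable_value)
      have h2 : IdentDistrib (fun ω => ((X m ω).num, (X m ω).value))
          (fun ω => ((X 0 ω).num, (X 0 ω).value)) P P :=
        ⟨(hmm m).aemeasurable, (hmm 0).aemeasurable, by
          rw [(hX m).map_num_value, (hX 0).map_num_value]⟩
      exact h2.comp (u := fun p : ℕ × (ℕ → ℝ) => ∑ i ∈ Finset.range p.1, g (p.2 i))
        (measurable_from_prod_countable_right fun n =>
          Finset.measurable_sum (Finset.range n) fun i _ => hgm.comp (measurable_pi_apply i))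
  rwa [hw.2] at h1

/-- The sample size is random, so the estimator is a quotient of two averages over realisations:
total excess, with limit `Λ φ(y)`, and number of jobs, with limit `Λ > 0`. -/
theorem strongLaw_shortage [IsProbabilityMeasure ν] (hX : ∀ m, IsJobProcess P T lam ν (X m))
    (hXi : iIndepFun X P) (hlam : ∀ t ∈ Icc 0 T, 0 < lam t) (hL : 0 < ∫ t in Icc 0 T, lam t)
    (hν : Integrable (fun x : ℝ => x) ν) (y : ℝ) :
    ∀ᵐ ω ∂P, Tendsto (fun M => shortageEstimator M (fun m => X m ω) y) atTop
      (𝓝 (meanShortage ν y)) := by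
  filter_upwards [strongLaw_sum hX hXi hlam (g := fun _ => 1) measurable_const (integrable_const 1),
    strongLaw_sum hX hXi hlam (g := fun x => max (x - y) 0) (by fun_prop)
      (integrable_max_sub_zero hν y)] with ω h1 h2
  have h3 : ∀ M, ∑ m ∈ Finset.range M, ∑ i ∈ Finset.range (X m ω).num, (1 : ℝ) =
      sampleSize M fun m => X m ω := by
    intro M
    simp [sampleSize]
  simp only [h3, integral_const, probReal_univ, smul_eq_mul, mul_one] at h1
  have h4 := h2.div h1 hL.ne'
  rw [mul_div_cancel_left₀ _ hL.ne'] at h4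
  refine h4.congr' ?_
  filter_upwards [h1.eventually (lt_mem_nhds hL)] with M hM
  have hM0 : (M : ℝ) ≠ 0 := by
    rintro h0
    simp [h0] at hM
  have hN : sampleSize M (fun m => X m ω) ≠ 0 := by
    intro h0
    simp [h0] at hM
  rw [shortageEstimator_of_sampleSize_ne_zero hN, Pi.div_apply, div_div_div_cancel_right₀ hM0,
    one_div, ← div_eq_inv_mul]
  rfl

/-- Almost surely, the estimators converge locally uniformly. -/
theorem ae_tendsto_estimators [IsProbabilityMeasure ν] (hT : 0 < T)
    (hX : ∀ m, IsJobProcess P T lam ν (X m)) (hXi : iIndepFun X P) (hlamc : Continuous lam)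
    (hlam : ∀ t ∈ Icc 0 T, 0 < lam t) (hL : 0 < ∫ t in Icc 0 T, lam t)
    (hν : Integrable (fun x : ℝ => x) ν) :
    ∀ᵐ ω ∂P, TendstoLocallyUniformly (fun M => cumEstimator T M fun m => X m ω)
        (cumulative T lam) atTop ∧
      TendstoLocallyUniformly (fun M => shortageEstimator M fun m => X m ω)
        (meanShortage ν) atTop := by
  have h1 := ae_all_iff.2 fun q : ℚ => strongLaw_count hX hXi hlam (q : ℝ)
  have h2 := ae_all_iff.2 fun q : ℚ => strongLaw_shortage hX hXi hlam hL hν (q : ℝ)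
  filter_upwards [h1, h2] with ω h1 h2
  have hc := continuous_cumulative hT.le hlamc
  have hA := tendstoLocallyUniformly_of_monotone (fun M => empiricalCum_mono M _) hc h1
  constructor
  · refine tendstoLocallyUniformly_of_monotone (fun M => cumEstimator_mono hT M _) hc fun q => ?_
    have hb := tendsto_binWidth T
    have hm : Tendsto (fun M => (q : ℝ) - binWidth T M) atTop (𝓝 q) := by
      simpa using tendsto_const_nhds.sub hb
    have hp : Tendsto (fun M => (q : ℝ) + binWidth T M) atTop (𝓝 q) := by
      simpa using tendsto_const_nhds.add hb
    -- Locally uniform convergence of the empirical counts permits evaluation at the moving points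
    -- `q ± binWidth T M`.
    refine tendsto_of_tendsto_of_tendsto_of_le_of_le' (hA.tendsto_comp hc.continuousAt hm)
      (hA.tendsto_comp hc.continuousAt hp) ?_ ?_
    · filter_upwards [eventually_gt_atTop 0] with M hM
      exact empiricalCum_le_cumEstimator hT hM _ _
    · filter_upwards [eventually_gt_atTop 0] with M hM
      exact cumEstimator_le_empiricalCum hT hM _ _
  · have h3 := tendstoLocallyUniformly_of_monotone
      (F := fun M y => -shortageEstimator M (fun m => X m ω) y) (f := fun y => -meanShortage ν y)
      (fun M => (isShortage_shortageEstimator M _).antitone.neg)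
      (isShortage_meanShortage hν).continuous.neg fun q => (h2 q).neg
    simpa [Pi.neg_def] using h3.neg

end Arrivals

/-! ### The reward of the estimated critical curves -/

/-- Only decisions on actual jobs with a free worker count. Curves may thus be changed outside `[0,
T]`, where they need not be measurable. -/
theorem reward_congr {n : ℕ} {A A' : AcceptRule} {r : Realisation}
    (h : ∀ k, 0 < k → k ≤ n → ∀ i < r.num, (r.history i ∈ A k i ↔ r.history i ∈ A' k i)) :
    reward n A r = reward n A' r := by
  have hw : ∀ i ≤ r.num, workersLeft n A r i = workersLeft n A' r i := by
    intro i
    induction i with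
    | zero => exact fun _ => rfl
    | succ i ih =>
      intro hi
      rw [workersLeft, workersLeft, ih (by omega)]
      rcases Nat.eq_zero_or_pos (workersLeft n A' r i) with h0 | h0
      · simp [h0]
      · have hiff := h _ h0 (workersLeft_le r i) i hi
        by_cases hm : r.history i ∈ A' (workersLeft n A' r i) i
        · rw [if_pos hm, if_pos (hiff.2 hm)]
        · rw [if_neg hm, if_neg fun hm' => hm (hiff.1 hm')]
  refine Finset.sum_congr rfl fun i hi => ?_
  rw [hw i (Finset.mem_range.1 hi).le]
  rcases Nat.eq_zero_or_pos (workersLeft n A' r i) with h0 | h0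
  · simp [h0]
  · have hiff := h _ h0 (workersLeft_le r i) i (Finset.mem_range.1 hi)
    by_cases hm : r.history i ∈ A' (workersLeft n A' r i) i
    · rw [if_pos ⟨h0, hiff.2 hm⟩, if_pos ⟨h0, hm⟩]
    · rw [if_neg fun hm' => hm (hiff.1 hm'.2), if_neg fun hm' => hm hm'.2]

theorem measurableSet_curveRule {y : ℕ → ℝ → ℝ} (hy : ∀ k, Measurable (y k)) (k i : ℕ) :
    MeasurableSet (curveRule y k i) := by
  have hp : Measurable fun h : Fin (i + 1) → ℝ × ℝ => h (Fin.last i) := measurable_pi_apply _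
  exact measurableSet_lt ((hy k).comp (measurable_fst.comp hp)) (measurable_snd.comp hp)

/-- Continuous curves on `[0, T]`, extended to measurable functions. -/
def extendCurves (T : ℝ) (n : ℕ) (y : ℕ → ℝ → ℝ) (k : ℕ) (t : ℝ) : ℝ :=
  if 0 < k ∧ k ≤ n then y k (max 0 (min T t)) else 0

theorem extendCurves_eq {T : ℝ} {n : ℕ} (y : ℕ → ℝ → ℝ) {k : ℕ} (hk : 0 < k) (hkn : k ≤ n) {t : ℝ}
    (ht : t ∈ Icc 0 T) : extendCurves T n y k t = y k t := by
  rw [extendCurves, if_pos ⟨hk, hkn⟩, min_eq_right ht.2, max_eq_right ht.1]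

theorem measurable_extendCurves {T : ℝ} (hT : 0 ≤ T) {n : ℕ} {y : ℕ → ℝ → ℝ}
    (hy : ∀ k, 0 < k → k ≤ n → ContinuousOn (y k) (Icc 0 T)) (k : ℕ) :
    Measurable (extendCurves T n y k) := by
  by_cases hk : 0 < k ∧ k ≤ n
  · have h1 : extendCurves T n y k = fun t => y k (max 0 (min T t)) := by
      funext t
      rw [extendCurves, if_pos hk]
    rw [h1]
    exact ((hy k hk.1 hk.2).comp_continuous (by fun_prop) fun t =>
      ⟨le_max_left _ _, max_le hT (min_le_left _ _)⟩).measurable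
  · have h1 : extendCurves T n y k = fun _ => 0 := by
      funext t
      rw [extendCurves, if_neg hk]
    rw [h1]
    exact measurable_const

section Arrivals

variable {Ω : Type*} [MeasurableSpace Ω] {P : Measure Ω} {T : ℝ} {lam : ℝ → ℝ} {ν : Measure ℝ}

theorem IsJobProcess.congr_rate {X : Ω → Realisation} (h : IsJobProcess P T lam ν X)
    {lam' : ℝ → ℝ} (hl : ∀ t ∈ Icc 0 T, lam t = lam' t) : IsJobProcess P T lam' ν X where
  measurable := h.measurable
  time_mem := h.time_mem
  time_lt := h.time_lt
  count_law B hB hBT := by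
    rw [h.count_law B hB hBT, setIntegral_congr_fun hB fun t ht => hl t (hBT ht)]
  count_indep := h.count_indep
  value_law := h.value_law
  value_indep := h.value_indep
  indep := h.indep

theorem expectedReward_congr_ae {X X' : Ω → Realisation} (h : X =ᵐ[P] X') (n : ℕ)
    (A : AcceptRule) : expectedReward P X n A = expectedReward P X' n A := by
  refine integral_congr_ae ?_
  filter_upwards [h] with ω hω
  rw [hω]

variable [IsProbabilityMeasure P] [IsProbabilityMeasure ν]

theorem IsJobProcess.le_expectedReward_curveRule {X : Ω → Realisation}
    (h : IsJobProcess P T lam ν X) (hT : 0 ≤ T)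
    (hgood : ∀ ω, (X ω).Good T) (hlamc : IntegrableOn lam (Icc 0 T))
    (hlam : ∀ t ∈ Icc 0 T, 0 < lam t) (hν : Integrable (fun x : ℝ => x) ν) {C : ℝ} {n : ℕ}
    {y y' : ℕ → ℝ → ℝ} (hV : IsValueFamily T C lam (meanShortage ν) n y) {η : ℝ} (hη : 0 ≤ η)
    (hy' : ∀ k, 0 < k → k ≤ n → ContinuousOn (y' k) (Icc 0 T))
    (hclose : ∀ k, 0 < k → k ≤ n → ∀ t ∈ Icc 0 T, |y' k t - y k t| ≤ η) :
    curveValue y n 0 - η * ∫ t in Ico 0 T, lam t ≤ expectedReward P X n (curveRule y') := by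
  have h1 : expectedReward P X n (curveRule y') =
      expectedReward P X n (curveRule (extendCurves T n y')) := by
    refine integral_congr_ae (.of_forall fun ω => reward_congr fun k hk hkn i hi => ?_)
    have ht : (X ω).time i ∈ Icc 0 T := Ico_subset_Icc_self ((hgood ω).time_mem i hi)
    change y' k ((X ω).time i) < _ ↔ extendCurves T n y' k ((X ω).time i) < _
    rw [extendCurves_eq y' hk hkn ht]
  rw [h1]
  refine h.le_expectedReward hT hgood hlamc hlam hν hV
    (measurableSet_curveRule (measurable_extendCurves hT hy')) hη fun k hk hkn i g hg => ?_
  have h2 := abs_le.1 (hclose k hk hkn _ hg)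
  have h3 := extendCurves_eq y' hk hkn hg
  have h4 : g ∈ curveRule (extendCurves T n y') k i ↔
      extendCurves T n y' k (g (Fin.last i)).1 < (g (Fin.last i)).2 := Iff.rfl
  rw [h4, h3]
  constructor <;> intro h5 <;> linarith [h2.1, h2.2]

/-- The optimal expected reward is the initial value of the critical curves. -/
theorem IsJobProcess.optimalReward_eq {Y : Ω → Realisation}
    (h : IsJobProcess P T lam ν Y) (hT : 0 ≤ T) (hlamc : IntegrableOn lam (Icc 0 T))
    (hlam : ∀ t ∈ Icc 0 T, 0 < lam t) (hν : Integrable (fun x : ℝ => x) ν) {C : ℝ} {n : ℕ}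
    {y : ℕ → ℝ → ℝ} (hV : IsValueFamily T C lam (meanShortage ν) n y)
    (hy : ∀ k, 0 < k → k ≤ n → ContinuousOn (y k) (Icc 0 T)) :
    optimalReward P Y n = curveValue y n 0 := by
  obtain ⟨Y', hY', hae, hgood⟩ := h.exists_good_version hT
  have hle : ∀ D : DecisionRule, expectedReward P Y n D.accept ≤ curveValue y n 0 := fun D => by
    rw [expectedReward_congr_ae hae]
    exact hY'.expectedReward_le hT hgood hlam hν hV D.measurable
  set D : DecisionRule := ⟨curveRule (extendCurves T n y),
    measurableSet_curveRule (measurable_extendCurves hT hy)⟩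
  have : Nonempty DecisionRule := ⟨D⟩
  refine le_antisymm (ciSup_le hle) ?_
  refine le_trans ?_ (le_ciSup (f := fun D : DecisionRule => expectedReward P Y n D.accept)
    ⟨_, by rintro _ ⟨D, rfl⟩; exact hle D⟩ D)
  rw [expectedReward_congr_ae hae]
  have h1 := hY'.le_expectedReward_curveRule hT hgood hlamc hlam hν hV (y' := extendCurves T n y)
    le_rfl (fun k hk hkn => (hy k hk hkn).congr fun t ht => extendCurves_eq y hk hkn ht)
    fun k hk hkn t ht => by rw [extendCurves_eq y hk hkn ht, sub_self, abs_zero]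
  simpa using h1

/-- On the event that the estimators converge, the estimated critical curves converge uniformly. -/
theorem eventually_curves_close {phi : ℝ → ℝ} (hphi : IsShortage phi) (hT : 0 < T)
    (hlamc : Continuous lam) {S : ℝ} (hS : remaining T lam 0 + 1 ≤ S)
    (hlam : ∀ t ∈ Icc 0 T, 0 < lam t) {n : ℕ} {z : ℕ → ℝ → ℝ} (hz : IsOperational phi S n z)
    {X : ℕ → Realisation}
    (hcum : TendstoLocallyUniformly (fun M => cumEstimator T M X) (cumulative T lam) atTop)
    (hsh : TendstoLocallyUniformly (fun M => shortageEstimator M X) phi atTop)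
    {η : ℝ} (hη : 0 < η) :
    ∀ᶠ M in atTop, ∀ y, IsNPSACurves T n M X y → ∀ k, 0 < k → k ≤ n → ∀ t ∈ Icc 0 T,
      |y k t - z k (remaining T lam t)| ≤ η := by
  have hrem := isRemaining_remaining hlamc hlam
  have hrem0 : 0 ≤ remaining T lam 0 := hrem.nonneg 0 ⟨le_rfl, hT.le⟩
  have hS0 : 0 ≤ S := by linarith
  obtain ⟨R, Z, hR0, hZ0, hR, -, hL⟩ := hz.exists_bounds hphi
  set Q := ∑ k ∈ Finset.range n, stabConst S (k + 1)
  have hQ0 : 0 ≤ Q := Finset.sum_nonneg fun k _ => stabConst_nonneg hS0 _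
  set D := η / (2 * (Q + 1)) with hD
  have hD0 : 0 < D := by positivity
  -- The bound by `1` keeps the estimated clock inside `[0, S]`, where `z` is defined; the other
  -- bound controls `z` between the estimated and the true clock.
  set d := min 1 (η / (2 * (Z + 1))) with hd
  have hd0 : 0 < d := lt_min one_pos (by positivity)
  have hQD : Q * D ≤ η / 2 := by
    rw [hD, ← mul_div_assoc, div_le_div_iff₀ (by positivity) two_pos]
    nlinarith
  have hZd : Z * d ≤ η / 2 := by
    refine (mul_le_mul_of_nonneg_left (min_le_right _ _) hZ0).trans ?_
    rw [← mul_div_assoc, div_le_div_iff₀ (by positivity) two_pos]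
    nlinarith
  filter_upwards [eventually_abs_sub_le_of_tendstoLocallyUniformly hcum 0 T (half_pos hd0),
    eventually_abs_sub_le_of_tendstoLocallyUniformly hsh (-R) R hD0]
    with M hM1 hM2 y hy k hk hkn t ht
  have hest : ∀ t ∈ Icc 0 T, |remainingEstimator T M X t - remaining T lam t| ≤ d := by
    intro t ht
    have h1 := abs_le.1 (hM1 t ht)
    have h2 := abs_le.1 (hM1 T ⟨hT.le, le_rfl⟩)
    rw [← cumulative_sub hlamc ht, remainingEstimator, abs_le]
    constructor <;> linarith [h1.1, h1.2, h2.1, h2.2]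
  have hremS : ∀ t ∈ Icc 0 T, remaining T lam t ∈ Icc 0 S := fun t ht =>
    ⟨hrem.nonneg t ht, (hrem.le le_rfl ht.1 ht.2).trans (by linarith)⟩
  have hmem : ∀ t ∈ Icc 0 T, remainingEstimator T M X t ∈ Icc 0 S := by
    intro t ht
    refine ⟨(isRemaining_remainingEstimator hT M X).nonneg t ht, ?_⟩
    have h1 := (abs_le.1 (hest t ht)).2
    have h2 := hrem.le le_rfl ht.1 ht.2
    have h3 : d ≤ 1 := min_le_left _ _
    linarith
  obtain ⟨m, rfl⟩ := Nat.exists_eq_succ_of_ne_zero hk.ne'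
  have h1 := IsCriticalCurves.abs_sub_le hy (isRemaining_remainingEstimator hT M X)
    (isShortage_shortageEstimator M X) hz hmem hS0 hD0.le
    (fun j hj s hs => hM2 _ (abs_le.1 (hR (j + 1) (Nat.succ_pos j) hj s hs))) m hkn t ht
  have h2 : stabConst S (m + 1) * D ≤ Q * D := mul_le_mul_of_nonneg_right
    (Finset.single_le_sum (f := fun k => stabConst S (k + 1))
      (fun j _ => stabConst_nonneg hS0 _) (Finset.mem_range.2 hkn)) hD0.le
  have h3 := (hL (m + 1) hk hkn _ (hmem t ht) _ (hremS t ht)).trans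
    (mul_le_mul_of_nonneg_left (hest t ht) hZ0)
  refine (abs_sub_le _ (z (m + 1) (remainingEstimator T M X t)) _).trans ?_
  linarith

end Arrivals

/-- The computed curves are not assumed measurable in `ω`, so neither are the events. The increasing
tail intersections need no measurability for continuity from below. -/
theorem tendsto_measure_of_ae_eventually {Ω : Type*} [MeasurableSpace Ω] {P : Measure Ω}
    [IsProbabilityMeasure P] {E : ℕ → Set Ω} (h : ∀ᵐ ω ∂P, ∀ᶠ M in atTop, ω ∈ E M) :
    Tendsto (fun M => P (E M)) atTop (𝓝 1) := by
  set F : ℕ → Set Ω := fun M => ⋂ m ≥ M, E m with hF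
  have hmono : Monotone F := fun a b hab => biInter_mono (fun m hm => hab.trans hm) fun m _ => le_rfl
  have hU : P (⋃ M, F M) = 1 := by
    have h1 : ∀ᵐ ω ∂P, ω ∈ ⋃ M, F M := by
      filter_upwards [h] with ω hω
      obtain ⟨M, hM⟩ := eventually_atTop.1 hω
      exact mem_iUnion.2 ⟨M, mem_iInter₂.2 fun m hm => hM m hm⟩
    rw [← measure_univ (μ := P)]
    exact measure_congr (eventuallyEq_univ.2 h1)
  have hlim : Tendsto (fun M => P (F M)) atTop (𝓝 1) := by
    rw [← hU, hmono.measure_iUnion]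
    exact tendsto_atTop_iSup fun a b hab => measure_mono (hmono hab)
  exact tendsto_of_tendsto_of_tendsto_of_le_of_le hlim tendsto_const_nhds
    (fun M => measure_mono (biInter_subset_of_mem (le_refl M))) fun M => prob_le_one

end SeqAlloc
end

theorem mainTheorem1
    -- horizon, number of workers, arrival intensity
    (T : ℝ) (hT : 0 < T) (n : ℕ) (hn : 1 ≤ n)
    (lam : ℝ → ℝ) (hlam : ContinuousOn lam (Set.Icc 0 T)) (hlam0 : ∀ t ∈ Set.Icc 0 T, 0 < lam t)
    -- law of the job values: nonnegative, with a density, with finite mean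
    (ν : MeasureTheory.Measure ℝ) [MeasureTheory.IsProbabilityMeasure ν]
    (hν0 : ν (Set.Iio 0) = 0) (hνd : ν ≪ MeasureTheory.volume)
    (hνm : MeasureTheory.Integrable (fun x : ℝ => x) ν)
    -- the observed realisations, i.i.d.
    {Ω : Type*} [MeasurableSpace Ω] (P : MeasureTheory.Measure Ω)
    [MeasureTheory.IsProbabilityMeasure P]
    (X : ℕ → Ω → SeqAlloc.Realisation)
    (hX : ∀ m, SeqAlloc.IsJobProcess P T lam ν (X m)) (hXi : ProbabilityTheory.iIndepFun X P)
    -- the job arrival process at test time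
    {Ω' : Type*} [MeasurableSpace Ω'] (P' : MeasureTheory.Measure Ω')
    [MeasureTheory.IsProbabilityMeasure P']
    (Y : Ω' → SeqAlloc.Realisation) (hY : SeqAlloc.IsJobProcess P' T lam ν Y) :
    (∀ (M : ℕ) (ω : Ω), ∃ y : ℕ → ℝ → ℝ, SeqAlloc.IsNPSACurves T n M (fun m => X m ω) y) ∧
    ∀ y : ℕ → Ω → ℕ → ℝ → ℝ,
      (∀ (M : ℕ) (ω : Ω), SeqAlloc.IsNPSACurves T n M (fun m => X m ω) (y M ω)) →
      ∀ ε : ℝ, 0 < ε → ε < 1 →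
        Filter.Tendsto
          (fun M : ℕ => P {ω | 1 - ε ≤
            SeqAlloc.expectedReward P' Y n (SeqAlloc.curveRule (y M ω)) /
              SeqAlloc.optimalReward P' Y n})
          Filter.atTop (nhds 1) := by
  open SeqAlloc in
  refine ⟨fun M ω => exists_isNPSACurves hT n M _, fun y hy ε hε _ => ?_⟩
  -- The constant extension beyond the end points makes the intensity continuous on the line without
  -- changing the process.
  set lam' : ℝ → ℝ := Set.IccExtend hT.le ((Set.Icc 0 T).domRestrict lam)
  have heq : ∀ t ∈ Set.Icc 0 T, lam t = lam' t := fun t ht =>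
    (Set.IccExtend_of_mem hT.le ((Set.Icc 0 T).domRestrict lam) ht).symm
  have hlamc : Continuous lam' := hlam.domRestrict.Icc_extend'
  have hlam0' : ∀ t ∈ Set.Icc 0 T, 0 < lam' t := fun t ht => heq t ht ▸ hlam0 t ht
  have hX' := fun m => (hX m).congr_rate heq
  have hY' := hY.congr_rate heq
  have hint : MeasureTheory.IntegrableOn lam' (Set.Icc 0 T) := hlamc.integrableOn_Icc
  have hrem := isRemaining_remaining hlamc hlam0'
  have hL : remaining T lam' 0 = ∫ t in Set.Ico 0 T, lam' t := by
    rw [← remaining_sub hlamc T hT.le, hrem.terminal, sub_zero]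
  have hpos : 0 < remaining T lam' 0 :=
    intervalIntegral.intervalIntegral_pos_of_pos_on (hlamc.intervalIntegrable _ _)
      (fun t ht => hlam0' t (Set.Ioo_subset_Icc_self ht)) hT
  have hLpos : 0 < ∫ t in Set.Icc 0 T, lam' t := by
    rw [MeasureTheory.integral_Icc_eq_integral_Ico, ← hL]
    exact hpos
  have hphi := isShortage_meanShortage hνm
  -- The extra unit of operational time leaves room for an estimated clock that overshoots.
  obtain ⟨z, hz⟩ := hphi.exists_isOperational (S := remaining T lam' 0 + 1) (by linarith) n
  have hmem : ∀ t ∈ Set.Icc 0 T, remaining T lam' t ∈ Set.Icc 0 (remaining T lam' 0 + 1) :=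
    fun t ht => ⟨hrem.nonneg t ht, (hrem.le le_rfl ht.1 ht.2).trans (by linarith)⟩
  obtain ⟨C, hV⟩ := hz.exists_isValueFamily hphi hlamc hlam0' hmem
  have hcont : ∀ {w : ℕ → ℝ → ℝ} {r p : ℝ → ℝ}, IsCriticalCurves T r p n w →
      ∀ k, 0 < k → k ≤ n → ContinuousOn (w k) (Set.Icc 0 T) := by
    intro w r p hw k hk hkn
    obtain ⟨m, rfl⟩ := Nat.exists_eq_succ_of_ne_zero hk.ne'
    exact (hw m hkn).1
  set V := curveValue (fun k t => z k (remaining T lam' t)) n 0 with hVdef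
  have hVpos : 0 < V := hz.curveValue_pos hphi (meanShortage_zero_pos hνm hν0 hνd) hn hpos
    (by linarith)
  have hopt : optimalReward P' Y n = V := hY'.optimalReward_eq hT.le hint hlam0' hνm hV
    (hcont (hz.isCriticalCurves hrem hmem))
  obtain ⟨Y₁, hY₁, hae, hgood⟩ := hY'.exists_good_version hT.le
  refine tendsto_measure_of_ae_eventually ?_
  filter_upwards [ae_tendsto_estimators hT hX' hXi hlamc hlam0' hLpos hνm] with ω hω
  -- The choice of `η` makes the total loss `η Λ` equal to `ε V`.
  filter_upwards [eventually_curves_close hphi hT hlamc le_rfl hlam0' hz hω.1 hω.2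
    (η := ε * V / remaining T lam' 0) (by positivity)] with M hM
  have h1 := hY₁.le_expectedReward_curveRule hT.le hgood hint hlam0' hνm hV
    (y' := y M ω) (η := ε * V / remaining T lam' 0) (by positivity) (hcont (hy M ω))
    (hM _ (hy M ω))
  rw [← hL, div_mul_cancel₀ _ hpos.ne', ← expectedReward_congr_ae hae] at h1
  change 1 - ε ≤ _ / _
  rw [hopt, le_div_iff₀ hVpos]
  linarith
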